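/- Let $M$ be a compact real-analytic manifold without boundary, of dimension $n$, with a positive real-analytic density $\mu$ (for instance the Riemannian measure of a real-analytic metric); $L^2(M)=L^2(M,\mu)$. **Symbols.** Let $V\subset\mathbb R^n$ be open and $k\in\mathbb R$. A function $b(x,\xi)$ on $V\times\mathbb R^n$ belongs to $S^k_{ha}$ if there are an open $\Omega\subset\mathbb C^n$ containing $V$, an open cone $\Lambda\subset\mathbb C^n$ (invariant under multiplication by $t>0$) containing $\mathbb R^n\setminus 0$, and holomorphic functions $a_{k-j}$ $(j\ge 0)$ on $\Omega\times\Lambda$, homogeneous of degree $k-j$ in the second variable, with $|a_{k-j}(z,\zeta)|\le C_0^{j+1}j^j$ for $z\in\Omega$, $\zeta\in\Lambda$, $|\zeta|=1$ (where $0^0=1$), such that $b$ extends to $\Omega\times\mathbb R^n$, holomorphically in $z$, measurably in $\xi$, boundedly on $|\xi|\le 1$, and for every sufficiently large $C_1$ there is $C_2>0$ with $$\Big|b(z,\xi)-\sum_{0\le j\le|\xi|/C_1}a_{k-j}(z,\xi)\Big|\le C_2e^{-|\xi|/C_2},\qquad z\in\Omega,\ \xi\in\mathbb R^n,\ |\xi|\ge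 1 .$$ **Operators.** A linear map $P:C^\infty(M)\to C^\infty(M)$ is a *homogeneous analytic pseudodifferential operator of order $k$* if its Schwartz kernel is real analytic off the diagonal and if, in every real-analytic chart and near every point of the diagonal, i.e. on $V\times V$ for some neighbourhood $V$ of the given point, its kernel with respect to Lebesgue measure is $K+R$ with $R$ real analytic and $$K(x,y)=\frac1{(2\pi)^n}\int e^{i\langle x-y,\xi\rangle}b(x,\xi)\chi(|x-y|)\,d\xi ,$$ where $b\in S^k_{ha}$ over $V$, and $\chi\in C_c^\infty(\mathbb R)$ equals $1$ near $0$. For $u\in L^2(M)$, $Pu$ is the distribution obtained by extending $P$ by continuity. **Proposition.** Let $P$ be a homogeneous analytic pseudodifferential operator of order $k\ge -n$ on $M$, let $x_0\in M$, and let $U$ be an open neighbourhood of $x_0$ contained in the domain of a real-analytic chart; write $D=\frac1i\partial$ in these coordinates. Then there is an open neighbourhood $W\subset U$ of $x_0$ such that for all $C,\varepsilon_0,h_0>0$ there is $C'>0$ with the following property. Let $0<h\le h_0$, $0<\varepsilon\le\varepsilon_0$, $A\ge 0$, and let $u\in L^2(M)$ satisfy $\|u\|_{L^2(M)}\le A$,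 be smooth on $U$, and satisfy $$|(hD)^\alpha u(x)|\le A\,C^{|\alpha|+1}(h|\alpha|+\varepsilon)^{|\alpha|},\qquad x\in U,\ \alpha\in\mathbb N^n .$$ Then $Pu$ is smooth on $W$ and $$|(hD)^\beta Pu(x)|\le A\,h^{-k-n}\,C'^{\,|\beta|+1}(\varepsilon+h|\beta|)^{|\beta|},\qquad x\in W,\ \beta\in\mathbb N^n .$$ In particular $W$ and $C'$ do not depend on $h$, $\varepsilon$, $A$ or $u$, and $W$ does not depend on $C,\varepsilon_0,h_0$ either. -/

import Mathlib

open MeasureTheory Set Filter Topology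
open scoped ContDiff Manifold

/-- The coordinate space `ℝⁿ` with its Euclidean norm. -/
abbrev RSp (n : ℕ) := EuclideanSpace ℝ (Fin n)

/-- The complexified coordinate space `ℂⁿ`. -/
abbrev CSp (n : ℕ) := EuclideanSpace ℂ (Fin n)

/-- The inclusion of `ℝⁿ` in `ℂⁿ`. -/
def complexify {n : ℕ} (x : RSp n) : CSp n := WithLp.toLp 2 (fun i => (x i : ℂ))

/-! ### Semiclassical derivatives -/

/-- `h D_j = (h / i) ∂_j`, acting on functions on `ℝⁿ`. -/
noncomputable def hDer {n : ℕ} (h : ℝ) (j : Fin n) (f : RSp n → ℂ) : RSp n → ℂ :=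
  fun x => ((h : ℂ) / Complex.I) * fderiv ℝ f x (EuclideanSpace.single j 1)

/-- `(h D)^α = (h D_1)^{α_1} ⋯ (h D_n)^{α_n}` for a multi-index `α`. -/
noncomputable def hDerPow {n : ℕ} (h : ℝ) (α : Fin n → ℕ) (f : RSp n → ℂ) : RSp n → ℂ :=
  (List.finRange n).foldr (fun j g => (hDer h j)^[α j] g) f

/-- The length `|α|` of a multi-index. -/
def multiLen {n : ℕ} (α : Fin n → ℕ) : ℕ := ∑ i, α i

/-- `f` is smooth on the open set `O ⊆ ℝⁿ` and satisfies there the Cauchy-type estimates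
`|(hD)^α f| ≤ A C^{|α|+1} (h|α| + ε)^{|α|}` for all multi-indices `α`. -/
def CauchyEstimates {n : ℕ} (h ε A C : ℝ) (O : Set (RSp n)) (f : RSp n → ℂ) : Prop :=
  ContDiffOn ℝ ∞ f O ∧
    ∀ (α : Fin n → ℕ), ∀ x ∈ O,
      ‖hDerPow h α f x‖ ≤
        A * C ^ (multiLen α + 1) * (h * (multiLen α : ℝ) + ε) ^ (multiLen α)

/-! ### Homogeneous analytic symbols -/

/-- `b ∈ S^k_ha` over the open set `V ⊆ ℝⁿ`, in local coordinates.  The set `Ω ×ˢ Λ` is the complex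
conic neighbourhood of `V × (ℝⁿ \ 0)`; `a j` is the term of degree `k - j`; `B` is the extension of
`b` to complex `x`, holomorphic in `x` for each real `ξ`. -/
def IsHomogeneousAnalyticSymbol {n : ℕ} (k : ℝ) (V : Set (RSp n)) (b : RSp n → RSp n → ℂ) : Prop :=
  ∃ (Ω Λ : Set (CSp n)) (a : ℕ → CSp n → CSp n → ℂ) (B : CSp n → RSp n → ℂ),
    IsOpen Ω ∧ (∀ x ∈ V, complexify x ∈ Ω) ∧
    IsOpen Λ ∧ (∀ ξ : RSp n, ξ ≠ 0 → complexify ξ ∈ Λ) ∧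
    (∀ ζ ∈ Λ, ∀ t : ℝ, 0 < t → (t : ℂ) • ζ ∈ Λ) ∧
    (∀ j, DifferentiableOn ℂ (fun p : CSp n × CSp n => a j p.1 p.2) (Ω ×ˢ Λ)) ∧
    (∀ j, ∀ z ∈ Ω, ∀ ζ ∈ Λ, ∀ t : ℝ, 0 < t →
      a j z ((t : ℂ) • ζ) = ((t ^ (k - (j : ℝ)) : ℝ) : ℂ) * a j z ζ) ∧
    (∃ C₀ : ℝ, 0 < C₀ ∧ ∀ j, ∀ z ∈ Ω, ∀ ζ ∈ Λ, ‖ζ‖ = 1 →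
      ‖a j z ζ‖ ≤ C₀ ^ (j + 1) * (j : ℝ) ^ j) ∧
    (∀ x ∈ V, ∀ ξ, B (complexify x) ξ = b x ξ) ∧
    (∀ ξ, DifferentiableOn ℂ (fun z => B z ξ) Ω) ∧
    (∀ z ∈ Ω, Measurable (B z)) ∧
    (∃ C₃ : ℝ, ∀ z ∈ Ω, ∀ ξ : RSp n, ‖ξ‖ ≤ 1 → ‖B z ξ‖ ≤ C₃) ∧
    (∃ C₄ : ℝ, 0 < C₄ ∧ ∀ C₁ : ℝ, C₄ ≤ C₁ → ∃ C₂ : ℝ, 0 < C₂ ∧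
      ∀ z ∈ Ω, ∀ ξ : RSp n, 1 ≤ ‖ξ‖ →
        ‖B z ξ - ∑ j ∈ Finset.range (⌊‖ξ‖ / C₁⌋₊ + 1), a j z (complexify ξ)‖ ≤
          C₂ * Real.exp (-‖ξ‖ / C₂))

/-- The action on `f` (supported in `V`) of the kernel
`K(x,y) = (2π)^{-n} ∫ e^{i⟨x-y,ξ⟩} b(x,ξ) χ(|x-y|) dξ`, as an iterated integral. -/
noncomputable def oscillatoryAction {n : ℕ} (b : RSp n → RSp n → ℂ) (χ : ℝ → ℝ)
    (V : Set (RSp n)) (f : RSp n → ℂ) (x : RSp n) : ℂ :=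
  (((2 * Real.pi) ^ n : ℝ) : ℂ)⁻¹ *
    ∫ ξ : RSp n, b x ξ *
      ∫ y in V, Complex.exp (Complex.I * ((inner ℝ (x - y) ξ : ℝ) : ℂ)) *
        ((χ ‖x - y‖ : ℝ) : ℂ) * f y

/-! ### Operators on a compact real-analytic manifold -/

section Manifold

variable {n : ℕ} {M : Type*} [TopologicalSpace M] [ChartedSpace (RSp n) M]

/-- The space `C^∞(M)` of smooth complex-valued functions. -/
def smoothFunctions (n : ℕ) (M : Type*) [TopologicalSpace M] [ChartedSpace (RSp n) M] :
    Submodule ℂ (M → ℂ) where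
  carrier := {f | ContMDiff 𝓘(ℝ, RSp n) 𝓘(ℝ, ℂ) ∞ f}
  add_mem' hf hg := ContMDiff.add hf hg
  zero_mem' := contMDiff_const
  smul_mem' c _ hf :=
    ((ContinuousLinearMap.contDiff (c • ContinuousLinearMap.id ℝ ℂ)).contMDiff).comp hf

/-- `μ` is a positive real-analytic density: in every real-analytic chart it has a positive
real-analytic density with respect to Lebesgue measure. -/
def IsAnalyticDensity (n : ℕ) {M : Type*} [TopologicalSpace M] [ChartedSpace (RSp n) M]
    [MeasurableSpace M] (μ : Measure M) : Prop :=
  ∀ e ∈ IsManifold.maximalAtlas 𝓘(ℝ, RSp n) ω M,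
    ∃ ρ : RSp n → ℝ, AnalyticOnNhd ℝ ρ e.target ∧ (∀ y ∈ e.target, 0 < ρ y) ∧
      ∀ s : Set M, MeasurableSet s → s ⊆ e.source →
        μ s = ∫⁻ y in e.target ∩ e.symm ⁻¹' s, ENNReal.ofReal (ρ y)

/-- `P : C^∞(M) → C^∞(M)` is a homogeneous analytic pseudodifferential operator of order `k`:
its Schwartz kernel is real analytic off the diagonal and, in any analytic chart, near any point
of the diagonal, is the sum of the oscillatory kernel of a symbol in `S^k_ha` and of a real-analytic
kernel. -/
structure IsHomogeneousAnalyticPDO [MeasurableSpace M] (μ : Measure M) (k : ℝ)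
    (P : smoothFunctions n M →ₗ[ℂ] smoothFunctions n M) : Prop where
  off_diagonal : ∃ κ : M × M → ℂ,
    ContMDiffOn (𝓘(ℝ, RSp n).prod 𝓘(ℝ, RSp n)) 𝓘(ℝ, ℂ) ω κ {p | p.1 ≠ p.2} ∧
    ∀ (w : smoothFunctions n M) (x : M), x ∉ tsupport (w : M → ℂ) →
      (P w : M → ℂ) x = ∫ y, κ (x, y) * (w : M → ℂ) y ∂μ
  near_diagonal : ∀ e ∈ IsManifold.maximalAtlas 𝓘(ℝ, RSp n) ω M, ∀ x₀ ∈ e.source,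
    ∃ (V : Set (RSp n)) (b : RSp n → RSp n → ℂ) (χ : ℝ → ℝ) (R : RSp n × RSp n → ℂ),
      IsOpen V ∧ e x₀ ∈ V ∧ V ⊆ e.target ∧
      IsHomogeneousAnalyticSymbol k V b ∧
      ContDiff ℝ ∞ χ ∧ HasCompactSupport χ ∧ (∀ᶠ t in 𝓝 (0 : ℝ), χ t = 1) ∧
      AnalyticOnNhd ℝ R (V ×ˢ V) ∧
      ∀ w : smoothFunctions n M, tsupport (w : M → ℂ) ⊆ e.source ∩ e ⁻¹' V →
        ∀ x ∈ V, (P w : M → ℂ) (e.symm x) =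
          oscillatoryAction b χ V (fun y => (w : M → ℂ) (e.symm y)) x +
            ∫ y in V, R (x, y) * (w : M → ℂ) (e.symm y)

/-- For `u ∈ L²(M)`, the distribution `Pu` equals the function `v` on the open set `W`.  Here `Pu`
is the extension of `P` by continuity from `C^∞(M)` to `L²(M)`: against each test function
supported in `W`, `Pw` tends to `v` as `w ∈ C^∞(M)` tends to `u` in `L²(M)`. -/
def EqualsOn [MeasurableSpace M] (μ : Measure M)
    (P : smoothFunctions n M →ₗ[ℂ] smoothFunctions n M) (u : M → ℂ) (W : Set M) (v : M → ℂ) :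
    Prop :=
  ∀ φ : smoothFunctions n M, tsupport (φ : M → ℂ) ⊆ W →
    ∀ δ : ℝ, 0 < δ → ∃ η : ℝ, 0 < η ∧ ∀ w : smoothFunctions n M,
      eLpNorm (fun x => (w : M → ℂ) x - u x) 2 μ < ENNReal.ofReal η →
        ‖(∫ x, (P w : M → ℂ) x * (φ : M → ℂ) x ∂μ) - ∫ x, v x * (φ : M → ℂ) x ∂μ‖ < δ

end Manifold

/-! ### Integrals depending smoothly on a parameter -/

/-! Choose concentric cubes Q_r, Q_2r, Q_3r about c = e x₀ inside the chart image of U, so small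
that χ(|x-y|) = 1 for x in Q_r, y in Q_3r, and that the symbol extends holomorphically to complex
balls of a fixed radius about points of Q_r. Take W = Q_r. If θ is a cutoff equal to 1 on Q_2r and
supported in Q_3r, then on W the function Pu is P(θu) plus the off-diagonal kernel applied to
(1-θ)u, and P(θu) is an oscillatory integral plus an integral operator with analytic kernel. The two
analytic kernels contribute C^(m+1) m! times L¹ norms to the derivatives of order m, and h^m m! ≤
(hm)^m.

The oscillatory integral is ∫ B(x, 2πη) e^{2πi⟨x,η⟩} F(θu)(η) dη. Cauchy's estimate in x, on complex
balls of radius proportional to 1/(m + 1 + |η|) per derivative, bounds m derivatives of the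
integrand by C^(m+1) (m + 1 + |η|)^m (1 + |η|)^k |F(θu)(η)| (`norm_iteratedFDeriv_oscIntegrand_le`).
Since k + n ≥ 0, the weight is at most (L + |η|)^(m+k+n) (1 + |η|)^(-n) for L ≥ m + 1, up to
constants, and (1 + |η|)^(-n) is square integrable. Plancherel then reduces matters to L² bounds for
θu and for its pure derivatives of an order N = m + ⌈k+n⌉ (`integral_weighted_fourier_le`).

A single compactly supported θ cannot satisfy analytic estimates at all orders. For each m a
different θ is used, with |θ^(q)| ≤ (KN)^q for q ≤ N (`exists_cutoff_of_order`), so that by Leibniz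
the derivatives of θu satisfy the bound (κL)^N with L = 1 + N + ε/h. The outcome is C^(m+1)
L^(m+k+n) (`exists_oscIntegrand_estimate`); multiplied by h^m it is (hL)^m (hL)^(k+n) h^(-k-n),
which is the source of the factor h^(-k-n) (`exists_semiclassical_bound`).

The function representing Pu is defined with one fixed cutoff. It does not depend on that choice
(`apply_add_integral_kernel_eq`), so for each m it may be rewritten with the cutoff adapted to m.
That it represents the extension of P by continuity follows from the continuity of w ↦ ⟨Pw, φ⟩ in
L¹, proved by moving the Fourier integral onto the test function
(`exists_norm_integral_mul_oscIntegrand_le`, `equalsOn_of_norm_integral_le`). -/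

theorem aestronglyMeasurable_fderiv_of_param {𝕜 E G α : Type*} [RCLike 𝕜] [NormedAddCommGroup E]
    [NormedSpace 𝕜 E] [FiniteDimensional 𝕜 E] [NormedAddCommGroup G] [NormedSpace 𝕜 G]
    [MeasurableSpace α] {ν : Measure α} {g : E → α → G} {x : E}
    (hm : ∀ᶠ y in 𝓝 x, AEStronglyMeasurable (g y) ν)
    (hd : ∀ᵐ a ∂ν, DifferentiableAt 𝕜 (fun y => g y a) x) :
    AEStronglyMeasurable (fun a => fderiv 𝕜 (fun y => g y a) x) ν := by
  have key : ∀ v : E, AEStronglyMeasurable (fun a => fderiv 𝕜 (fun y => g y a) x v) ν := by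
    intro v
    have hc : Tendsto (fun k : ℕ => ‖((k : ℕ) : 𝕜)‖) atTop atTop := by
      simpa using tendsto_natCast_atTop_atTop (R := ℝ)
    have hx : Tendsto (fun k : ℕ => x + ((k : 𝕜))⁻¹ • v) atTop (𝓝 x) := by
      have h0 : Tendsto (fun k : ℕ => ((k : 𝕜))⁻¹) atTop (𝓝 0) :=
        tendsto_inv₀_cobounded.comp (tendsto_norm_atTop_iff_cobounded.1 hc)
      simpa using (h0.smul_const v).const_add x
    -- The derivative is the limit of difference quotients; they are started at index N, beyond
    -- which the shifted points lie where measurability is known.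
    obtain ⟨N, hN⟩ := eventually_atTop.1 (hx.eventually hm)
    refine aestronglyMeasurable_of_tendsto_ae (u := atTop)
      (f := fun (k : ℕ) a => ((k + N : ℕ) : 𝕜) • (g (x + (((k + N : ℕ) : 𝕜))⁻¹ • v) a - g x a))
      (fun k => ((hN _ (Nat.le_add_left N k)).sub hm.self_of_nhds).const_smul _) ?_
    filter_upwards [hd] with a ha
    exact (ha.hasFDerivAt.lim v hc).comp (tendsto_add_atTop_nat N)
  let b := Module.finBasis 𝕜 E
  have hL : ∀ L : E →L[𝕜] G, L = ∑ i, ContinuousLinearMap.smulRightL 𝕜 E G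
      (LinearMap.toContinuousLinearMap (b.coord i)) (L (b i)) := by
    intro L
    ext y
    calc L y = L (∑ i, b.repr y i • b i) := by rw [b.sum_repr]
      _ = _ := by rw [map_sum]; simp
  have : (fun a => fderiv 𝕜 (fun y => g y a) x) = fun a => ∑ i,
      ContinuousLinearMap.smulRightL 𝕜 E G (LinearMap.toContinuousLinearMap (b.coord i))
        (fderiv 𝕜 (fun y => g y a) x (b i)) := by
    funext a
    exact hL _
  rw [this]
  exact Finset.aestronglyMeasurable_fun_sum _ fun i _ =>
    (ContinuousLinearMap.continuous _).comp_aestronglyMeasurable (key _)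

/-- Induction on the order replaces g by its derivative in x, with values in `E →L[ℝ] G`, and shifts
the dominating sequence by one. The target space is therefore quantified inside, and E, G share a
universe so that the new target is admissible. -/
theorem contDiffOn_integral_of_dominated_aux {E : Type} [NormedAddCommGroup E]
    [NormedSpace ℝ E] [FiniteDimensional ℝ E] {α : Type*} [MeasurableSpace α] {ν : Measure α}
    {O : Set E} (hO : IsOpen O) (m : ℕ) : ∀ (G : Type) [NormedAddCommGroup G] [NormedSpace ℝ G]
    (g : E → α → G) (bd : ℕ → α → ℝ),
    (∀ x ∈ O, AEStronglyMeasurable (g x) ν) →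
    (∀ᵐ a ∂ν, ContDiffOn ℝ ∞ (fun x => g x a) O) →
    (∀ i, ∀ᵐ a ∂ν, ∀ x ∈ O, ‖iteratedFDeriv ℝ i (fun x => g x a) x‖ ≤ bd i a) →
    (∀ i, Integrable (bd i) ν) →
    ContDiffOn ℝ m (fun x => ∫ a, g x a ∂ν) O ∧
      ∀ x ∈ O, ‖iteratedFDeriv ℝ m (fun x => ∫ a, g x a ∂ν) x‖ ≤ ∫ a, bd m a ∂ν := by
  have step : ∀ (G : Type) [NormedAddCommGroup G] [NormedSpace ℝ G]
      (g : E → α → G) (bd : ℕ → α → ℝ),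
      (∀ x ∈ O, AEStronglyMeasurable (g x) ν) →
      (∀ᵐ a ∂ν, ContDiffOn ℝ ∞ (fun x => g x a) O) →
      (∀ i, ∀ᵐ a ∂ν, ∀ x ∈ O, ‖iteratedFDeriv ℝ i (fun x => g x a) x‖ ≤ bd i a) →
      (∀ i, Integrable (bd i) ν) → ∀ x ∈ O,
      AEStronglyMeasurable (fun a => fderiv ℝ (fun y => g y a) x) ν ∧
      HasFDerivAt (fun x => ∫ a, g x a ∂ν) (∫ a, fderiv ℝ (fun y => g y a) x ∂ν) x := by
    intro G _ _ g bd hm hs hb hi x hx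
    have hd : ∀ᵐ a ∂ν, ∀ y ∈ O, DifferentiableAt ℝ (fun y => g y a) y := by
      filter_upwards [hs] with a ha y hy
      exact (ha.differentiableOn (by simp)).differentiableAt (hO.mem_nhds hy)
    have hmeas := aestronglyMeasurable_fderiv_of_param (𝕜 := ℝ) (g := g) (x := x) (ν := ν)
      (by filter_upwards [hO.mem_nhds hx] with y hy using hm y hy)
      (by filter_upwards [hd] with a ha using ha x hx)
    refine ⟨hmeas, ?_⟩
    refine hasFDerivAt_integral_of_dominated_of_fderiv_le (𝕜 := ℝ) (s := O) (bound := bd 1)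
      (F' := fun x a => fderiv ℝ (fun y => g y a) x) (hO.mem_nhds hx)
      (by filter_upwards [hO.mem_nhds hx] with y hy using hm y hy) ?_ hmeas ?_ (hi 1) ?_
    · refine (hi 0).mono' (hm x hx) ?_
      filter_upwards [hb 0] with a ha
      simpa using ha x hx
    · filter_upwards [hb 1] with a ha y hy
      have := ha y hy
      rwa [← zero_add 1, ← norm_iteratedFDeriv_fderiv, norm_iteratedFDeriv_zero] at this
    · filter_upwards [hd] with a ha y hy using (ha y hy).hasFDerivAt
  induction m with
  | zero =>
    intro G _ _ g bd hm hs hb hi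
    refine ⟨?_, fun x hx => ?_⟩
    · rw [Nat.cast_zero, contDiffOn_zero]
      exact fun x hx => (step G g bd hm hs hb hi x hx).2.continuousAt.continuousWithinAt
    · rw [norm_iteratedFDeriv_zero]
      refine norm_integral_le_of_norm_le (hi 0) ?_
      filter_upwards [hb 0] with a ha
      simpa using ha x hx
  | succ m ih =>
    intro G _ _ g bd hm hs hb hi
    have hst := step G g bd hm hs hb hi
    have hih := ih (E →L[ℝ] G) (fun x a => fderiv ℝ (fun y => g y a) x) (fun i => bd (i + 1))
      (fun x hx => (hst x hx).1)
      (by filter_upwards [hs] with a ha using ha.fderiv_of_isOpen hO (by simp))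
      (fun i => by
        filter_upwards [hb (i + 1)] with a ha x hx
        have := ha x hx
        rwa [← norm_iteratedFDeriv_fderiv] at this) (fun i => hi (i + 1))
    have heq : ∀ x ∈ O, fderiv ℝ (fun x => ∫ a, g x a ∂ν) x = ∫ a, fderiv ℝ (fun y => g y a) x ∂ν :=
      fun x hx => (hst x hx).2.fderiv
    refine ⟨?_, fun x hx => ?_⟩
    · rw [Nat.cast_add, Nat.cast_one, contDiffOn_succ_iff_fderiv_of_isOpen hO]
      refine ⟨fun x hx => (hst x hx).2.differentiableAt.differentiableWithinAt, ?_,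
        hih.1.congr heq⟩
      intro h
      simp at h
    · rw [← norm_iteratedFDeriv_fderiv]
      have : fderiv ℝ (fun x => ∫ a, g x a ∂ν) =ᶠ[𝓝 x]
          fun x => ∫ a, fderiv ℝ (fun y => g y a) x ∂ν := by
        filter_upwards [hO.mem_nhds hx] with y hy using heq y hy
      rw [(this.iteratedFDeriv ℝ m).eq_of_nhds]
      exact hih.2 x hx

/-- Differentiation under the integral sign to all orders, with the bounds it gives. -/
theorem contDiffOn_integral_of_dominated {E G : Type} [NormedAddCommGroup E]
    [NormedSpace ℝ E] [FiniteDimensional ℝ E] [NormedAddCommGroup G] [NormedSpace ℝ G]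
    {α : Type*} [MeasurableSpace α] {ν : Measure α} {O : Set E} (hO : IsOpen O)
    {g : E → α → G} {bd : ℕ → α → ℝ}
    (hm : ∀ x ∈ O, AEStronglyMeasurable (g x) ν)
    (hs : ∀ᵐ a ∂ν, ContDiffOn ℝ ∞ (fun x => g x a) O)
    (hb : ∀ i, ∀ᵐ a ∂ν, ∀ x ∈ O, ‖iteratedFDeriv ℝ i (fun x => g x a) x‖ ≤ bd i a)
    (hi : ∀ i, Integrable (bd i) ν) :
    ContDiffOn ℝ ∞ (fun x => ∫ a, g x a ∂ν) O ∧
      ∀ m, ∀ x ∈ O, ‖iteratedFDeriv ℝ m (fun x => ∫ a, g x a ∂ν) x‖ ≤ ∫ a, bd m a ∂ν :=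
  ⟨contDiffOn_infty.2 fun m => (contDiffOn_integral_of_dominated_aux hO m G g bd hm hs hb hi).1,
    fun m => (contDiffOn_integral_of_dominated_aux hO m G g bd hm hs hb hi).2⟩

/-! ### Holomorphic functions of several variables -/

theorem norm_fderiv_le_of_forall_mem_ball {E G : Type*} [NormedAddCommGroup E] [NormedSpace ℂ E]
    [NormedAddCommGroup G] [NormedSpace ℂ G] {f : E → G} {c : E} {ρ M : ℝ} (hρ : 0 < ρ)
    (hf : DifferentiableOn ℂ f (Metric.ball c ρ)) (hM : ∀ z ∈ Metric.ball c ρ, ‖f z‖ ≤ M) :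
    ‖fderiv ℂ f c‖ ≤ M * (2 / ρ) := by
  -- The target ball is centred at f c, whence the radius 2M.
  have := Complex.norm_fderiv_le_div_of_mapsTo_ball (R₂ := 2 * M) hf (fun z hz => ?_) hρ
  · calc _ ≤ _ := this
      _ = _ := by ring
  · rw [mem_closedBall_iff_norm]
    linarith [norm_sub_le (f z) (f c), hM z hz, hM c (Metric.mem_ball_self hρ)]

/-- Cauchy's formula on a small circle in the complex line z + ℂv writes f'(z)v as an integral of
values of f, which can be differentiated in z under the integral sign. This gives one further
complex derivative, hence smoothness by iteration. -/
theorem DifferentiableOn.differentiableAt_fderiv_apply {E G : Type*} [NormedAddCommGroup E]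
    [NormedSpace ℂ E] [FiniteDimensional ℂ E] [NormedAddCommGroup G] [NormedSpace ℂ G]
    [CompleteSpace G] {f : E → G} {O : Set E} (hO : IsOpen O) (hf : DifferentiableOn ℂ f O) (v : E)
    {z₀ : E} (hz₀ : z₀ ∈ O) : DifferentiableAt ℂ (fun z => fderiv ℂ f z v) z₀ := by
  have hcont : ContinuousAt f z₀ := (hf.differentiableAt (hO.mem_nhds hz₀)).continuousAt
  obtain ⟨R, hR, hball⟩ : ∃ R > 0, ∀ z ∈ Metric.ball z₀ R, z ∈ O ∧ ‖f z‖ ≤ ‖f z₀‖ + 1 := by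
    have h1 : ∀ᶠ z in 𝓝 z₀, ‖f z‖ < ‖f z₀‖ + 1 :=
      hcont.norm.eventually_lt continuousAt_const (by simp)
    obtain ⟨R, hR, h⟩ := Metric.eventually_nhds_iff_ball.1 (h1.and (hO.mem_nhds hz₀))
    exact ⟨R, hR, fun z hz => ⟨(h z hz).2, (h z hz).1.le⟩⟩
  set M := ‖f z₀‖ + 1
  have hder : ∀ z ∈ Metric.ball z₀ (R / 2), ‖fderiv ℂ f z‖ ≤ M * (2 / (R / 2)) := by
    intro z hz
    have hsub : Metric.ball z (R / 2) ⊆ Metric.ball z₀ R := by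
      apply Metric.ball_subset_ball'
      rw [Metric.mem_ball] at hz
      linarith
    exact norm_fderiv_le_of_forall_mem_ball (by positivity)
      (hf.mono fun w hw => (hball w (hsub hw)).1) fun w hw => (hball w (hsub hw)).2
  -- For z within R/4 of z₀ the circle of radius s stays within R/2, where the first derivative is
  -- bounded because f is bounded on the ball of radius R.
  obtain ⟨s, hs, hsv⟩ : ∃ s > 0, s * ‖v‖ < R / 4 := by
    refine ⟨R / 4 / (‖v‖ + 1), by positivity, ?_⟩
    rw [div_mul_eq_mul_div, div_lt_iff₀ (by positivity)]
    nlinarith [norm_nonneg v]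
  have hmem : ∀ z ∈ Metric.ball z₀ (R / 4), ∀ w : ℂ, ‖w‖ ≤ s →
      z + w • v ∈ Metric.ball z₀ (R / 2) := by
    intro z hz w hw
    rw [mem_ball_iff_norm] at hz ⊢
    have h1 : ‖w • v‖ ≤ s * ‖v‖ := by
      rw [norm_smul]
      gcongr
    have h2 : z + w • v - z₀ = (z - z₀) + w • v := by abel
    rw [h2]
    linarith [norm_add_le (z - z₀) (w • v)]
  have hdiff : ∀ z ∈ Metric.ball z₀ (R / 2), DifferentiableAt ℂ f z := fun z hz =>
    hf.differentiableAt (hO.mem_nhds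
      (hball z (Metric.ball_subset_ball (by linarith) hz)).1)
  set c : ℝ → ℂ := fun θ => _root_.deriv (circleMap 0 s) θ * ((circleMap 0 s θ) ^ 2)⁻¹ with hcdef
  have hne : ∀ θ, circleMap 0 s θ ≠ 0 := fun θ => by
    simpa using hs.ne'
  have hnorm : ∀ θ, ‖circleMap 0 s θ‖ = s := fun θ => by simp [abs_of_pos hs]
  have hccont : Continuous c := by
    simp only [hcdef, deriv_circleMap]
    exact ((continuous_circleMap 0 s).mul continuous_const).mul
      (((continuous_circleMap 0 s).pow 2).inv₀ fun θ => pow_ne_zero _ (hne θ))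
  have hcnorm : ∀ θ, ‖c θ‖ = s⁻¹ := by
    intro θ
    simp only [hcdef, deriv_circleMap, norm_mul, norm_inv, norm_pow, hnorm, Complex.norm_I]
    field_simp
  set ν := volume.restrict (Ioc (0 : ℝ) (2 * Real.pi))
  have hrep : ∀ z ∈ Metric.ball z₀ (R / 4), fderiv ℂ f z v =
      (2 * Real.pi * Complex.I : ℂ)⁻¹ • ∫ θ, c θ • f (z + circleMap 0 s θ • v) ∂ν := by
    intro z hz
    have hU : IsOpen {w : ℂ | z + w • v ∈ Metric.ball z₀ (R / 2)} :=
      Metric.isOpen_ball.preimage (by fun_prop)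
    have hd : DifferentiableOn ℂ (fun w : ℂ => f (z + w • v))
        {w : ℂ | z + w • v ∈ Metric.ball z₀ (R / 2)} := by
      intro w hw
      refine (DifferentiableAt.comp w (g := f) (hdiff _ hw) ?_).differentiableWithinAt
      fun_prop
    have h1 := Complex.cderiv_eq_deriv hU hd hs (z := 0) (fun w hw => by
      exact hmem z hz w (by simpa using hw))
    have h2 : _root_.deriv (fun w : ℂ => f (z + w • v)) 0 = fderiv ℂ f z v := by
      have h3 : HasDerivAt (fun w : ℂ => z + w • v) v 0 := by
        simpa using ((hasDerivAt_id (0 : ℂ)).smul_const v).const_add z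
      have h4 : HasFDerivAt f (fderiv ℂ f z) (z + (0 : ℂ) • v) := by
        simpa using (hdiff z (Metric.ball_subset_ball (by linarith) hz)).hasFDerivAt
      exact (h4.comp_hasDerivAt (0 : ℂ) h3).deriv
    rw [← h2, ← h1, Complex.cderiv, circleIntegral, intervalIntegral.integral_of_le (by positivity)]
    simp [hcdef, smul_smul, ν]
  have hmeas : ∀ z ∈ Metric.ball z₀ (R / 4),
      Continuous (fun θ => c θ • f (z + circleMap 0 s θ • v)) := by
    intro z hz
    refine hccont.smul (continuous_iff_continuousAt.2 fun θ => ?_)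
    refine ContinuousAt.comp (g := f) (hdiff _ (hmem z hz _ (hnorm θ).le)).continuousAt ?_
    exact (continuous_const.add ((continuous_circleMap 0 s).smul continuous_const)).continuousAt
  have hz0 : z₀ ∈ Metric.ball z₀ (R / 4) := Metric.mem_ball_self (by positivity)
  have hcomp : ∀ z ∈ Metric.ball z₀ (R / 4), ∀ θ,
      HasFDerivAt (fun z => c θ • f (z + circleMap 0 s θ • v))
        (c θ • fderiv ℂ f (z + circleMap 0 s θ • v)) z := by
    intro z hz θ
    have h5 := (hdiff _ (hmem z hz _ (hnorm θ).le)).hasFDerivAt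
    have h6 : HasFDerivAt (fun z => z + circleMap 0 s θ • v) (ContinuousLinearMap.id ℂ E) z :=
      (hasFDerivAt_id z).add_const _
    exact (h5.comp z h6).const_smul (c θ)
  have hmain := hasFDerivAt_integral_of_dominated_of_fderiv_le (𝕜 := ℂ) (μ := ν) (x₀ := z₀)
    (F := fun z θ => c θ • f (z + circleMap 0 s θ • v))
    (F' := fun z θ => c θ • fderiv ℂ f (z + circleMap 0 s θ • v))
    (s := Metric.ball z₀ (R / 4)) (bound := fun _ => s⁻¹ * (M * (2 / (R / 2))))
    (Metric.ball_mem_nhds _ (by positivity))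
    (by filter_upwards [Metric.ball_mem_nhds z₀ (by positivity : 0 < R / 4)] with z hz
        exact (hmeas z hz).aestronglyMeasurable)
    ((hmeas z₀ hz0).integrableOn_Ioc)
    (by
      have := aestronglyMeasurable_fderiv_of_param (𝕜 := ℂ) (ν := ν) (x := z₀)
        (g := fun z θ => c θ • f (z + circleMap 0 s θ • v))
        (by filter_upwards [Metric.ball_mem_nhds z₀ (by positivity : 0 < R / 4)] with z hz
            exact (hmeas z hz).aestronglyMeasurable)
        (Eventually.of_forall fun θ => (hcomp z₀ hz0 θ).differentiableAt)
      refine this.congr (Eventually.of_forall fun θ => ?_)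
      exact (hcomp z₀ hz0 θ).fderiv)
    (Eventually.of_forall fun θ z hz => by
      rw [norm_smul, hcnorm]
      gcongr
      exact hder _ (hmem z hz _ (hnorm θ).le))
    (integrable_const _)
    (Eventually.of_forall fun θ z hz => hcomp z hz θ)
  refine (hmain.differentiableAt.const_smul (2 * Real.pi * Complex.I : ℂ)⁻¹).congr_of_eventuallyEq ?_
  filter_upwards [Metric.ball_mem_nhds z₀ (by positivity : 0 < R / 4)] with z hz
  exact hrep z hz

theorem DifferentiableOn.contDiffOn_nat_of_complex {E G : Type*} [NormedAddCommGroup E]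
    [NormedSpace ℂ E] [FiniteDimensional ℂ E] [NormedAddCommGroup G] [NormedSpace ℂ G]
    [CompleteSpace G] {O : Set E} (hO : IsOpen O) (m : ℕ) :
    ∀ {f : E → G}, DifferentiableOn ℂ f O → ContDiffOn ℂ m f O := by
  induction m with
  | zero =>
    intro f hf
    rw [Nat.cast_zero, contDiffOn_zero]
    exact hf.continuousOn
  | succ m ih =>
    intro f hf
    rw [Nat.cast_add, Nat.cast_one, contDiffOn_succ_iff_fderiv_of_isOpen hO]
    refine ⟨hf, fun h => by simp at h, contDiffOn_clm_apply.2 fun v => ih fun z hz => ?_⟩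
    exact (hf.differentiableAt_fderiv_apply hO v hz).differentiableWithinAt

theorem DifferentiableOn.contDiffOn_of_complex {E G : Type*} [NormedAddCommGroup E]
    [NormedSpace ℂ E] [FiniteDimensional ℂ E] [NormedAddCommGroup G] [NormedSpace ℂ G]
    [CompleteSpace G] {O : Set E} (hO : IsOpen O) {f : E → G} (hf : DifferentiableOn ℂ f O) :
    ContDiffOn ℂ ∞ f O :=
  contDiffOn_infty.2 fun m => hf.contDiffOn_nat_of_complex hO m

/-- Cauchy estimates for the restriction of a holomorphic function to a real subspace. -/
theorem norm_iteratedFDeriv_comp_real_le {E' E : Type} [NormedAddCommGroup E'] [NormedSpace ℝ E']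
    [NormedAddCommGroup E] [NormedSpace ℂ E] [FiniteDimensional ℂ E] (L : E' →L[ℝ] E)
    (hL : ‖L‖ ≤ 1) {ρ : ℝ} (hρ : 0 < ρ) (x : E') (m : ℕ) :
    ∀ (G : Type) [NormedAddCommGroup G] [NormedSpace ℂ G] [CompleteSpace G] (f : E → G) (M : ℝ),
      DifferentiableOn ℂ f (Metric.ball (L x) ((m + 1) * ρ)) →
      (∀ z ∈ Metric.ball (L x) ((m + 1) * ρ), ‖f z‖ ≤ M) →
      ‖iteratedFDeriv ℝ m (fun y => f (L y)) x‖ ≤ M * (2 / ρ) ^ m := by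
  induction m with
  | zero =>
    intro G _ _ _ f M hf hM
    simpa using hM (L x) (Metric.mem_ball_self (by simpa using hρ))
  | succ m ih =>
    intro G _ _ _ f M hf hM
    have hf2 : ContDiffOn ℂ ∞ (fderiv ℂ f) (Metric.ball (L x) ((m + 1 + 1) * ρ)) := by
      have := (hf.contDiffOn_of_complex Metric.isOpen_ball)
      push_cast at this
      exact this.fderiv_of_isOpen Metric.isOpen_ball (by simp)
    have hsub : Metric.ball (L x) ((m + 1) * ρ) ⊆ Metric.ball (L x) ((m + 1 + 1) * ρ) :=
      Metric.ball_subset_ball (by nlinarith)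
    push_cast at hf hM
    -- Each derivative spends ρ of the radius and costs a factor 2/ρ; the induction hypothesis is
    -- applied to the derivative, with its operator space as target.
    have h1 := ih (E →L[ℂ] G) (fderiv ℂ f) (M * (2 / ρ))
      ((hf2.differentiableOn (by simp)).mono hsub) (fun z hz => by
        have hb : Metric.ball z ρ ⊆ Metric.ball (L x) ((m + 1 + 1) * ρ) := by
          apply Metric.ball_subset_ball'
          rw [Metric.mem_ball] at hz
          linarith
        exact norm_fderiv_le_of_forall_mem_ball hρ (hf.mono hb) fun w hw => hM w (hb hw))
    let Φ : (E →L[ℂ] G) →L[ℝ] (E' →L[ℝ] G) :=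
      ((ContinuousLinearMap.compL ℝ E' E G).flip L).comp
        (ContinuousLinearMap.restrictScalarsL ℂ E G ℝ ℝ)
    have hΦ : ‖Φ‖ ≤ 1 := by
      refine ContinuousLinearMap.opNorm_le_bound _ zero_le_one fun A => ?_
      refine ContinuousLinearMap.opNorm_le_bound _ (by positivity) fun y => ?_
      have h3 : Φ A y = A (L y) := rfl
      rw [h3]
      calc ‖A (L y)‖ ≤ ‖A‖ * (‖L‖ * ‖y‖) := (A.le_opNorm _).trans (by gcongr; exact L.le_opNorm y)
        _ ≤ ‖A‖ * (1 * ‖y‖) := by gcongr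
        _ = 1 * ‖A‖ * ‖y‖ := by ring
    have hO : IsOpen (L ⁻¹' Metric.ball (L x) ((m + 1 + 1) * ρ)) :=
      Metric.isOpen_ball.preimage L.continuous
    have hxO : x ∈ L ⁻¹' Metric.ball (L x) ((m + 1 + 1) * ρ) :=
      Metric.mem_ball_self (by positivity)
    have heq : fderiv ℝ (fun y => f (L y)) =ᶠ[𝓝 x] Φ ∘ fun y => fderiv ℂ f (L y) := by
      filter_upwards [hO.mem_nhds hxO] with y hy
      have h4 := (hf.differentiableAt (Metric.isOpen_ball.mem_nhds hy)).hasFDerivAt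
      exact ((h4.restrictScalars ℝ).comp y L.hasFDerivAt).fderiv
    have hsm : ContDiffAt ℝ ∞ (fun y => fderiv ℂ f (L y)) x := by
      have h5 : ContDiffAt ℂ ∞ (fderiv ℂ f) (L x) :=
        hf2.contDiffAt (Metric.isOpen_ball.mem_nhds hxO)
      exact (h5.restrict_scalars ℝ).comp x L.contDiff.contDiffAt
    rw [← norm_iteratedFDeriv_fderiv, (heq.iteratedFDeriv ℝ m).eq_of_nhds]
    calc _ ≤ ‖Φ‖ * ‖iteratedFDeriv ℝ m (fun y => fderiv ℂ f (L y)) x‖ :=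
          Φ.norm_iteratedFDeriv_comp_left hsm (by exact_mod_cast le_top)
      _ ≤ 1 * (M * (2 / ρ) * (2 / ρ) ^ m) := by gcongr
      _ = M * (2 / ρ) ^ (m + 1) := by ring

/-! ### Derivatives of real-analytic functions -/

/-- Re-expanding the power series at a nearby point y gives coefficients that are geometrically
bounded uniformly in y, all being controlled by one convergent double series S. The m-th derivative
is the sum of the m-th coefficient over m! permutations of its arguments. -/
theorem AnalyticAt.eventually_norm_iteratedFDeriv_le {E F : Type*} [NormedAddCommGroup E]
    [NormedSpace ℝ E] [NormedAddCommGroup F] [NormedSpace ℝ F] [CompleteSpace F] {f : E → F} {x : E}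
    (hf : AnalyticAt ℝ f x) :
    ∃ C : ℝ, 0 < C ∧ ∀ᶠ y in 𝓝 x, ∀ m : ℕ, ‖iteratedFDeriv ℝ m f y‖ ≤ C ^ (m + 1) * m.factorial := by
  obtain ⟨p, R, hp⟩ := hf
  -- One r is for the displacement of the centre, the other for the radius of the re-expanded
  -- series.
  obtain ⟨r, hr0, hr⟩ : ∃ r : NNReal, 0 < r ∧ ((r + r : NNReal) : ENNReal) < R := by
    obtain ⟨s, hs0, hs⟩ := ENNReal.lt_iff_exists_nnreal_btwn.1 hp.r_pos
    refine ⟨s / 2, by simpa using (ENNReal.coe_pos.1 hs0), by simpa using hs⟩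
  have hrr : ((r : ENNReal) + r) < p.radius := by
    rw [← ENNReal.coe_add]
    exact hr.trans_le hp.r_le
  have hsum := p.changeOriginSeries_summable_aux₁ hrr
  set S := ∑' s : (Σ k l : ℕ, { s : Finset (Fin (k + l)) // s.card = l }),
    ‖p (s.1 + s.2.1)‖₊ * r ^ s.2.1 * r ^ s.1 with hS
  have hco : ∀ y : E, ‖y‖₊ < r → ∀ m, ‖p.changeOrigin y m‖₊ * r ^ m ≤ S := by
    intro y hy m
    have hyr : (‖y‖₊ : ENNReal) ≤ r + r :=
      le_trans (by exact_mod_cast hy.le : (‖y‖₊ : ENNReal) ≤ r) le_self_add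
    have h1 := p.nnnorm_changeOrigin_le (x := y) m (hyr.trans_lt hrr)
    have h2 := (NNReal.summable_sigma.1 hsum).1 m
    have h3 : ∑' s : (Σ l : ℕ, { s : Finset (Fin (m + l)) // s.card = l }),
        ‖p (m + s.1)‖₊ * r ^ s.1 * r ^ m ≤ S := by
      rw [hS, hsum.tsum_sigma' fun k => (NNReal.summable_sigma.1 hsum).1 k]
      exact (NNReal.summable_sigma.1 hsum).2.le_tsum m (fun _ _ => zero_le)
    calc ‖p.changeOrigin y m‖₊ * r ^ m
        ≤ (∑' s : (Σ l : ℕ, { s : Finset (Fin (m + l)) // s.card = l }),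
            ‖p (m + s.1)‖₊ * ‖y‖₊ ^ s.1) * r ^ m := by gcongr
      _ = ∑' s : (Σ l : ℕ, { s : Finset (Fin (m + l)) // s.card = l }),
            ‖p (m + s.1)‖₊ * ‖y‖₊ ^ s.1 * r ^ m := by rw [NNReal.tsum_mul_right]
      _ ≤ ∑' s : (Σ l : ℕ, { s : Finset (Fin (m + l)) // s.card = l }),
            ‖p (m + s.1)‖₊ * r ^ s.1 * r ^ m := by
          refine Summable.tsum_le_tsum (fun s => by gcongr) (NNReal.summable_of_le (fun s => ?_) h2) h2
          gcongr
      _ ≤ S := h3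
  refine ⟨max (S : ℝ) 1 * max (r⁻¹ : ℝ) 1, by positivity, ?_⟩
  have hnb : Metric.ball x r ∈ 𝓝 x := Metric.ball_mem_nhds _ (by exact_mod_cast hr0)
  filter_upwards [hnb] with y hy m
  set d := y - x with hd
  have hdr : ‖d‖₊ < r := by
    rw [mem_ball_iff_norm] at hy
    exact_mod_cast hy
  have hdR : (‖d‖₊ : ENNReal) < R :=
    lt_of_lt_of_le (by exact_mod_cast hdr : (‖d‖₊ : ENNReal) < r)
      (le_trans (by rw [ENNReal.coe_add]; exact le_self_add) hr.le)
  have hcy := hp.changeOrigin hdR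
  have hxy : x + d = y := by simp [hd]
  rw [hxy] at hcy
  have hnonneg : (0 : ℝ) ≤ ‖p.changeOrigin d m‖ * m.factorial := by positivity
  have hbound : ‖iteratedFDeriv ℝ m f y‖ ≤ ‖p.changeOrigin d m‖ * m.factorial := by
    refine ContinuousMultilinearMap.opNorm_le_bound hnonneg fun v => ?_
    rw [hcy.iteratedFDeriv_eq_sum_of_completeSpace v]
    refine (norm_sum_le _ _).trans ?_
    calc ∑ σ : Equiv.Perm (Fin m), ‖p.changeOrigin d m fun i => v (σ i)‖
        ≤ ∑ σ : Equiv.Perm (Fin m), ‖p.changeOrigin d m‖ * ∏ i, ‖v i‖ := by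
          refine Finset.sum_le_sum fun σ _ => ?_
          rw [← Equiv.prod_comp σ (fun i => ‖v i‖)]
          exact ContinuousMultilinearMap.le_opNorm _ _
      _ = _ := by
          rw [Finset.sum_const, Finset.card_univ, Fintype.card_perm, Fintype.card_fin, nsmul_eq_mul]
          ring
  refine hbound.trans ?_
  gcongr
  have h6 : ‖p.changeOrigin d m‖ * (r : ℝ) ^ m ≤ S := by exact_mod_cast hco d hdr m
  have hrpos : (0 : ℝ) < r := by exact_mod_cast hr0
  calc ‖p.changeOrigin d m‖ = ‖p.changeOrigin d m‖ * (r : ℝ) ^ m * (r⁻¹ : ℝ) ^ m := by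
        rw [mul_assoc, ← mul_pow, mul_inv_cancel₀ hrpos.ne', one_pow, mul_one]
    _ ≤ max (S : ℝ) 1 * (max (r⁻¹ : ℝ) 1) ^ m := by
        gcongr
        · exact h6.trans (le_max_left _ _)
        · exact le_max_left _ _
    _ ≤ (max (S : ℝ) 1) ^ (m + 1) * (max (r⁻¹ : ℝ) 1) ^ (m + 1) := by
        gcongr
        · exact le_self_pow₀ (le_max_right _ _) (by simp)
        · exact le_max_right _ _
        · simp
    _ = _ := by rw [mul_pow]

theorem norm_iteratedFDeriv_slice_le {E₁ E₂ F : Type*} [NormedAddCommGroup E₁] [NormedSpace ℝ E₁]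
    [NormedAddCommGroup E₂] [NormedSpace ℝ E₂] [NormedAddCommGroup F] [NormedSpace ℝ F]
    {f : E₁ × E₂ → F} {q : E₁ × E₂} (m : ℕ) (hf : ContDiffAt ℝ ∞ f q) :
    ‖iteratedFDeriv ℝ m (fun x => f (x, q.2)) q.1‖ ≤ ‖iteratedFDeriv ℝ m f q‖ := by
  set g : E₁ × E₂ → F := fun p => f (p + (0, q.2)) with hg
  have hq : (q.1, (0 : E₂)) + (0, q.2) = q := by simp
  have hga : ContDiffAt ℝ m g (ContinuousLinearMap.inl ℝ E₁ E₂ q.1) := by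
    refine ContDiffAt.comp _ ?_ (contDiff_id.add contDiff_const).contDiffAt
    simp only [ContinuousLinearMap.inl_apply, hq]
    exact hf.of_le (by exact_mod_cast le_top)
  have h1 : (fun x => f (x, q.2)) = g ∘ ContinuousLinearMap.inl ℝ E₁ E₂ := by
    funext x
    simp [hg]
  have h2 : iteratedFDeriv ℝ m g (ContinuousLinearMap.inl ℝ E₁ E₂ q.1) = iteratedFDeriv ℝ m f q := by
    rw [hg, iteratedFDeriv_comp_add_right]
    simp
  obtain ⟨u, hgu, hu, hqu⟩ := eventually_nhds_iff.1 (hga.eventually (by simp))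
  have hu' : IsOpen (ContinuousLinearMap.inl ℝ E₁ E₂ ⁻¹' u) :=
    hu.preimage (ContinuousLinearMap.continuous _)
  rw [h1, ← iteratedFDerivWithin_of_isOpen m hu' hqu,
    ContinuousLinearMap.iteratedFDerivWithin_comp_right (n := m) _
      (fun y hy => (hgu y hy).contDiffWithinAt) hu.uniqueDiffOn hu'.uniqueDiffOn hqu le_rfl,
    iteratedFDerivWithin_of_isOpen m hu hqu, h2]
  refine (ContinuousMultilinearMap.norm_compContinuousLinearMap_le _ _).trans ?_
  refine mul_le_of_le_one_right (norm_nonneg _) (Finset.prod_le_one (fun _ _ => norm_nonneg _)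
    fun _ _ => ?_)
  exact ContinuousLinearMap.norm_inl_le_one ℝ E₁ E₂

theorem AnalyticOnNhd.exists_norm_iteratedFDeriv_slice_le {E₁ E₂ F : Type*}
    [NormedAddCommGroup E₁] [NormedSpace ℝ E₁] [NormedAddCommGroup E₂] [NormedSpace ℝ E₂]
    [NormedAddCommGroup F] [NormedSpace ℝ F] [CompleteSpace F] {f : E₁ × E₂ → F}
    {S : Set (E₁ × E₂)} (hS : IsCompact S) (hf : AnalyticOnNhd ℝ f S) :
    ∃ C : ℝ, 0 < C ∧ ∀ q ∈ S, ∀ m : ℕ,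
      ‖iteratedFDeriv ℝ m (fun x => f (x, q.2)) q.1‖ ≤ C ^ (m + 1) * m.factorial := by
  refine hS.induction_on (p := fun s => ∃ C : ℝ, 0 < C ∧ ∀ q ∈ s, ∀ m : ℕ,
      ‖iteratedFDeriv ℝ m (fun x => f (x, q.2)) q.1‖ ≤ C ^ (m + 1) * m.factorial)
    ⟨1, one_pos, by simp⟩ ?_ ?_ ?_
  · rintro s t hst ⟨C, hC, h⟩
    exact ⟨C, hC, fun q hq => h q (hst hq)⟩
  · rintro s t ⟨C, hC, h⟩ ⟨D, hD, h'⟩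
    refine ⟨max C D, by positivity, ?_⟩
    rintro q (hq | hq) m
    · refine (h q hq m).trans ?_
      gcongr
      exact le_max_left _ _
    · refine (h' q hq m).trans ?_
      gcongr
      exact le_max_right _ _
  · intro q hq
    obtain ⟨C, hC, h⟩ := (hf q hq).eventually_norm_iteratedFDeriv_le
    have h2 := (hf q hq).eventually_analyticAt
    exact ⟨_, mem_nhdsWithin_of_mem_nhds (h.and h2), C, hC, fun y hy m =>
      (norm_iteratedFDeriv_slice_le m hy.2.contDiffAt).trans (hy.1 m)⟩

/-! ### Cutoff functions with analytic-type bounds up to a given order -/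

/-- Averaging over [t, t + δ] moves each boundary by at most δ and turns one derivative into a
difference quotient, so an additional derivative costs only 2/δ. -/
theorem exists_box_average {θ : ℝ → ℝ} (hθ : ContDiff ℝ ∞ θ) (h01 : ∀ t, 0 ≤ θ t ∧ θ t ≤ 1)
    {a b δ : ℝ} (hδ : 0 < δ) (h1 : ∀ t, |t| ≤ a → θ t = 1) (h0 : ∀ t, b ≤ |t| → θ t = 0) :
    ∃ ψ : ℝ → ℝ, ContDiff ℝ ∞ ψ ∧ (∀ t, 0 ≤ ψ t ∧ ψ t ≤ 1) ∧ (∀ t, |t| ≤ a - δ → ψ t = 1) ∧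
      (∀ t, b + δ ≤ |t| → ψ t = 0) ∧
      ∀ q t, iteratedDeriv (q + 1) ψ t =
        δ⁻¹ * (iteratedDeriv q θ (t + δ) - iteratedDeriv q θ t) := by
  have hc : Continuous θ := hθ.continuous
  set Φ : ℝ → ℝ := fun t => ∫ s in (0 : ℝ)..t, θ s with hΦ
  have hΦd : ∀ t, HasDerivAt Φ (θ t) t := fun t => hc.integral_hasStrictDerivAt 0 t |>.hasDerivAt
  set ψ : ℝ → ℝ := fun t => δ⁻¹ * (Φ (t + δ) - Φ t) with hψ
  have hψd : ∀ t, HasDerivAt ψ (δ⁻¹ * (θ (t + δ) - θ t)) t := fun t =>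
    (((hΦd (t + δ)).comp_add_const t δ).sub (hΦd t)).const_mul δ⁻¹
  have hψi : ∀ t, ψ t = δ⁻¹ * ∫ s in t..(t + δ), θ s := by
    intro t
    simp only [hψ, hΦ]
    rw [intervalIntegral.integral_interval_sub_left] <;> exact hc.intervalIntegrable _ _
  have hderiv : deriv ψ = fun t => δ⁻¹ * (θ (t + δ) - θ t) := funext fun t => (hψd t).deriv
  have hshift : ContDiff ℝ ∞ (fun t => θ (t + δ)) := hθ.comp (contDiff_id.add contDiff_const)
  have hlow : ∀ t, 0 ≤ ∫ s in t..(t + δ), θ s := fun t =>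
    intervalIntegral.integral_nonneg (by linarith) fun s _ => (h01 s).1
  have hint : ∀ t (c : ℝ), (∫ _ in t..(t + δ), c) = δ * c := fun t c => by simp
  refine ⟨ψ, ?_, fun t => ⟨?_, ?_⟩, fun t ht => ?_, fun t ht => ?_, fun q t => ?_⟩
  · rw [contDiff_infty_iff_deriv, hderiv]
    exact ⟨fun t => (hψd t).differentiableAt, contDiff_const.mul (hshift.sub hθ)⟩
  · rw [hψi]
    exact mul_nonneg (inv_nonneg.2 hδ.le) (hlow t)
  · rw [hψi, inv_mul_le_iff₀ hδ, ← hint t 1]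
    exact intervalIntegral.integral_mono_on (by linarith) (hc.intervalIntegrable _ _)
      (by simp) fun s _ => (h01 s).2
  · rw [hψi, intervalIntegral.integral_congr (g := fun _ => (1 : ℝ)), hint, mul_one,
      inv_mul_cancel₀ hδ.ne']
    intro s hs
    rw [uIcc_of_le (by linarith)] at hs
    refine h1 s (abs_le.2 ?_)
    rw [abs_le] at ht
    exact ⟨by linarith [hs.1], by linarith [hs.2]⟩
  · rw [hψi, intervalIntegral.integral_congr (g := fun _ => (0 : ℝ)), hint, mul_zero, mul_zero]
    intro s hs
    rw [uIcc_of_le (by linarith)] at hs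
    refine h0 s ?_
    rcases le_abs.1 ht with h | h
    · exact le_abs.2 (Or.inl (by linarith [hs.1]))
    · exact le_abs.2 (Or.inr (by linarith [hs.2]))
  · rw [iteratedDeriv_succ', hderiv, iteratedDeriv_const_mul_field,
      iteratedDeriv_fun_sub (hshift.contDiffAt.of_le (by exact_mod_cast le_top))
        (hθ.contDiffAt.of_le (by exact_mod_cast le_top)), iteratedDeriv_comp_add_const]

/-- Starting from a fixed bump with margins d on both sides, N averages of width d/N use up exactly
these margins. Each gains one derivative at cost 2N/d, so K = 2/d does not depend on N. These are
quasi-analytic cutoffs in the manner of Ehrenpreis and Hörmander. -/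
theorem exists_cutoff_of_order {a b : ℝ} (ha : 0 < a) (hab : a < b) :
    ∃ K : ℝ, 0 < K ∧ ∀ N : ℕ, ∃ θ : ℝ → ℝ, ContDiff ℝ ∞ θ ∧ (∀ t, 0 ≤ θ t ∧ θ t ≤ 1) ∧
      (∀ t, |t| ≤ a → θ t = 1) ∧ (∀ t, b ≤ |t| → θ t = 0) ∧
      ∀ q ≤ N, ∀ t, |iteratedDeriv q θ t| ≤ (K * N) ^ q := by
  set d := (b - a) / 3 with hd
  have hd0 : 0 < d := by simp only [hd]; linarith
  have main : ∀ δ : ℝ, 0 < δ → ∀ i : ℕ, ∃ θ : ℝ → ℝ, ContDiff ℝ ∞ θ ∧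
      (∀ t, 0 ≤ θ t ∧ θ t ≤ 1) ∧ (∀ t, |t| ≤ a + d - i * δ → θ t = 1) ∧
      (∀ t, b - d + i * δ ≤ |t| → θ t = 0) ∧
      ∀ q ≤ i, ∀ t, |iteratedDeriv q θ t| ≤ (2 / δ) ^ q := by
    intro δ hδ i
    induction i with
    | zero =>
      let f : ContDiffBump (0 : ℝ) := ⟨a + d, b - d, by positivity, by simp only [hd]; linarith⟩
      refine ⟨f, f.contDiff, fun t => ⟨f.nonneg, f.le_one⟩, fun t ht => ?_, fun t ht => ?_, ?_⟩
      · exact f.one_of_mem_closedBall (by simpa [f] using ht)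
      · exact f.zero_of_le_dist (by simpa [f] using ht)
      · intro q hq t
        obtain rfl : q = 0 := by omega
        simpa [abs_of_nonneg f.nonneg] using f.le_one
    | succ i ih =>
      obtain ⟨θ, hθ, h01, h1, h0, hK⟩ := ih
      obtain ⟨ψ, hψ, p01, p1, p0, pd⟩ := exists_box_average hθ h01 hδ h1 h0
      refine ⟨ψ, hψ, p01, fun t ht => p1 t ?_, fun t ht => p0 t ?_, fun q hq t => ?_⟩
      · push_cast at ht; linarith
      · push_cast at ht; linarith
      · rcases q with _ | q
        · simpa [abs_of_nonneg (p01 t).1] using (p01 t).2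
        · rw [pd, abs_mul, abs_of_pos (inv_pos.2 hδ)]
          have e1 := hK q (by omega) (t + δ)
          have e2 := hK q (by omega) t
          calc δ⁻¹ * |iteratedDeriv q θ (t + δ) - iteratedDeriv q θ t|
              ≤ δ⁻¹ * ((2 / δ) ^ q + (2 / δ) ^ q) := by
                gcongr
                exact (abs_sub _ _).trans (add_le_add e1 e2)
            _ = (2 / δ) ^ (q + 1) := by ring
  refine ⟨2 / d, by positivity, fun N => ?_⟩
  -- For N = 0 the width d/N is meaningless; no averaging is needed and only the order q = 0 is
  -- concerned.
  rcases Nat.eq_zero_or_pos N with rfl | hN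
  · obtain ⟨θ, hθ, h01, h1, h0, hK⟩ := main 1 one_pos 0
    refine ⟨θ, hθ, h01, fun t ht => h1 t ?_, fun t ht => h0 t ?_, fun q hq t => ?_⟩
    · simp; linarith
    · simp; linarith
    · obtain rfl : q = 0 := by omega
      simpa using hK 0 le_rfl t
  · have hN' : (0 : ℝ) < N := by exact_mod_cast hN
    have hNd : (N : ℝ) * (d / N) = d := by field_simp
    obtain ⟨θ, hθ, h01, h1, h0, hK⟩ := main (d / N) (by positivity) N
    refine ⟨θ, hθ, h01, fun t ht => h1 t ?_, fun t ht => h0 t ?_, fun q hq t => ?_⟩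
    · rw [hNd]; linarith
    · rw [hNd]; linarith
    · have := hK q hq t
      rwa [show 2 / (d / N) = 2 / d * N by field_simp] at this

/-! ### Derivatives along coordinate lines -/

theorem contDiffOn_hDer {n : ℕ} {h : ℝ} {j : Fin n} {f : RSp n → ℂ} {O : Set (RSp n)}
    (hO : IsOpen O) (hf : ContDiffOn ℝ ∞ f O) : ContDiffOn ℝ ∞ (hDer h j f) O :=
  contDiffOn_const.mul ((hf.fderiv_of_isOpen hO (by simp)).clm_apply contDiffOn_const)

theorem contDiffOn_hDer_iterate {n : ℕ} {h : ℝ} {j : Fin n} {f : RSp n → ℂ} {O : Set (RSp n)}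
    (hO : IsOpen O) (hf : ContDiffOn ℝ ∞ f O) (q : ℕ) : ContDiffOn ℝ ∞ ((hDer h j)^[q] f) O := by
  induction q with
  | zero => exact hf
  | succ q ih =>
    rw [Function.iterate_succ_apply']
    exact contDiffOn_hDer hO ih

theorem hasDerivAt_line {n : ℕ} {f : RSp n → ℂ} {x e : RSp n} {t : ℝ}
    (hf : DifferentiableAt ℝ f (x + t • e)) :
    HasDerivAt (fun s : ℝ => f (x + s • e)) (fderiv ℝ f (x + t • e) e) t := by
  have h3 : HasDerivAt (fun s : ℝ => x + s • e) e t := by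
    simpa using ((hasDerivAt_id t).smul_const e).const_add x
  exact hf.hasFDerivAt.comp_hasDerivAt t h3

/-- Only pure derivatives of u enter the Fourier estimate, and along a coordinate line these are
ordinary one-variable derivatives, to which the one-variable Leibniz rule applies. -/
theorem hDer_iterate_line {n : ℕ} {h : ℝ} {j : Fin n} {f : RSp n → ℂ} {O : Set (RSp n)}
    (hO : IsOpen O) (hf : ContDiffOn ℝ ∞ f O) (x : RSp n) (q : ℕ) : ∀ t : ℝ,
    x + t • EuclideanSpace.single j (1 : ℝ) ∈ O →
    (hDer h j)^[q] f (x + t • EuclideanSpace.single j (1 : ℝ)) =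
      ((h : ℂ) / Complex.I) ^ q *
        iteratedDeriv q (fun s : ℝ => f (x + s • EuclideanSpace.single j (1 : ℝ))) t := by
  set e : RSp n := EuclideanSpace.single j (1 : ℝ)
  induction q with
  | zero => simp
  | succ q ih =>
    intro t ht
    have hopen : IsOpen {s : ℝ | x + s • e ∈ O} := hO.preimage (by fun_prop)
    -- The induction divides by (h/i)^q; for h = 0 both sides vanish at order q + 1.
    by_cases hh : (h : ℂ) = 0
    · rw [Function.iterate_succ_apply']
      simp [hDer, hh]
    have hc : ((h : ℂ) / Complex.I) ^ q ≠ 0 := pow_ne_zero _ (div_ne_zero hh Complex.I_ne_zero)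
    have heq : iteratedDeriv q (fun s : ℝ => f (x + s • e)) =ᶠ[𝓝 t]
        fun s => (((h : ℂ) / Complex.I) ^ q)⁻¹ * (hDer h j)^[q] f (x + s • e) := by
      filter_upwards [hopen.mem_nhds ht] with s hs
      rw [ih s hs, inv_mul_cancel_left₀ hc]
    have hd : DifferentiableAt ℝ ((hDer h j)^[q] f) (x + t • e) :=
      ((contDiffOn_hDer_iterate hO hf q).differentiableOn (by simp)).differentiableAt
        (hO.mem_nhds ht)
    rw [iteratedDeriv_succ, heq.deriv_eq, ((hasDerivAt_line hd).const_mul _).deriv,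
      Function.iterate_succ_apply', hDer, pow_succ]
    field_simp
    rfl

open LineDeriv in
theorem SchwartzMap.lineDerivOp_iterate_line {n : ℕ} (S : SchwartzMap (RSp n) ℂ) (e x : RSp n)
    (q : ℕ) : ∀ t : ℝ, ((lineDerivOp e : SchwartzMap (RSp n) ℂ → SchwartzMap (RSp n) ℂ)^[q] S)
      (x + t • e) = iteratedDeriv q (fun s : ℝ => S (x + s • e)) t := by
  induction q with
  | zero => simp
  | succ q ih =>
    intro t
    rw [iteratedDeriv_succ, ← funext ih, Function.iterate_succ_apply',
      SchwartzMap.lineDerivOp_apply_eq_fderiv]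
    exact (hasDerivAt_line (SchwartzMap.differentiableAt _)).deriv.symm

theorem hDerPow_single {n : ℕ} (h : ℝ) (j : Fin n) (q : ℕ) (f : RSp n → ℂ) :
    hDerPow h (Pi.single j q) f = (hDer h j)^[q] f := by
  have key : ∀ l : List (Fin n), l.Nodup →
      l.foldr (fun i g => (hDer h i)^[(Pi.single j q : Fin n → ℕ) i] g) f =
        if j ∈ l then (hDer h j)^[q] f else f := by
    intro l
    induction l with
    | nil => simp
    | cons i l ih =>
      intro hl
      rw [List.nodup_cons] at hl
      rw [List.foldr_cons, ih hl.2]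
      by_cases hij : i = j
      · subst hij
        simp [hl.1]
      · have hji : j ≠ i := fun h => hij h.symm
        simp [hij, hji]
  rw [hDerPow, key _ (List.nodup_finRange n), if_pos (List.mem_finRange j)]

theorem multiLen_single {n : ℕ} (j : Fin n) (q : ℕ) : multiLen (Pi.single j q : Fin n → ℕ) = q := by
  simp [multiLen]

theorem norm_hDer_iterate_le {n : ℕ} {h : ℝ} (hh : 0 ≤ h) {O : Set (RSp n)} (hO : IsOpen O)
    {x : RSp n} (hx : x ∈ O) (j : Fin n) (q : ℕ) : ∀ (m : ℕ) (f : RSp n → ℂ), ContDiffOn ℝ ∞ f O →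
    ‖iteratedFDeriv ℝ m ((hDer h j)^[q] f) x‖ ≤ h ^ q * ‖iteratedFDeriv ℝ (m + q) f x‖ := by
  induction q with
  | zero => intro m f hf; simp
  | succ q ih =>
    intro m f hf
    rw [Function.iterate_succ_apply]
    refine (ih m (hDer h j f) (contDiffOn_hDer hO hf)).trans ?_
    set e : RSp n := EuclideanSpace.single j (1 : ℝ) with he
    let Λ : (RSp n →L[ℝ] ℂ) →L[ℝ] ℂ :=
      ((h : ℂ) / Complex.I) • ContinuousLinearMap.apply ℝ ℂ e
    have hΛ : ‖Λ‖ ≤ h := by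
      refine ContinuousLinearMap.opNorm_le_bound _ hh fun A => ?_
      have h1 : Λ A = ((h : ℂ) / Complex.I) * A e := rfl
      rw [h1, norm_mul, norm_div, Complex.norm_I, div_one, Complex.norm_real, Real.norm_eq_abs,
        abs_of_nonneg hh]
      gcongr
      calc ‖A e‖ ≤ ‖A‖ * ‖e‖ := A.le_opNorm e
        _ = ‖A‖ := by simp [he]
    have h2 : hDer h j f = Λ ∘ fderiv ℝ f := rfl
    have h3 : ContDiffAt ℝ ∞ (fderiv ℝ f) x :=
      (hf.fderiv_of_isOpen hO (by simp)).contDiffAt (hO.mem_nhds hx)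
    calc h ^ q * ‖iteratedFDeriv ℝ (m + q) (hDer h j f) x‖
        ≤ h ^ q * (‖Λ‖ * ‖iteratedFDeriv ℝ (m + q) (fderiv ℝ f) x‖) := by
          rw [h2]
          gcongr
          exact Λ.norm_iteratedFDeriv_comp_left h3 (by exact_mod_cast le_top)
      _ ≤ h ^ q * (h * ‖iteratedFDeriv ℝ (m + q + 1) f x‖) := by
          rw [norm_iteratedFDeriv_fderiv]
          gcongr
      _ = h ^ (q + 1) * ‖iteratedFDeriv ℝ (m + (q + 1)) f x‖ := by
          rw [← add_assoc]; ring

/-- Mixed derivatives are needed only for the output: the full Fréchet derivative of order |α|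
dominates them all, since it is evaluated on unit vectors. -/
theorem norm_hDerPow_le {n : ℕ} {h : ℝ} (hh : 0 ≤ h) {O : Set (RSp n)} (hO : IsOpen O)
    {x : RSp n} (hx : x ∈ O) (α : Fin n → ℕ) {f : RSp n → ℂ} (hf : ContDiffOn ℝ ∞ f O) :
    ‖hDerPow h α f x‖ ≤ h ^ multiLen α * ‖iteratedFDeriv ℝ (multiLen α) f x‖ := by
  have key : ∀ l : List (Fin n),
      ContDiffOn ℝ ∞ (l.foldr (fun i g => (hDer h i)^[α i] g) f) O ∧
      ∀ m, ‖iteratedFDeriv ℝ m (l.foldr (fun i g => (hDer h i)^[α i] g) f) x‖ ≤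
        h ^ (l.map α).sum * ‖iteratedFDeriv ℝ (m + (l.map α).sum) f x‖ := by
    intro l
    induction l with
    | nil =>
      refine ⟨hf, fun m => ?_⟩
      change ‖iteratedFDeriv ℝ m f x‖ ≤ h ^ 0 * ‖iteratedFDeriv ℝ m f x‖
      simp
    | cons i l ih =>
      refine ⟨contDiffOn_hDer_iterate hO ih.1 _, fun m => ?_⟩
      rw [List.foldr_cons, List.map_cons, List.sum_cons]
      refine (norm_hDer_iterate_le hh hO hx i (α i) m _ ih.1).trans ?_
      calc _ ≤ h ^ α i * (h ^ (l.map α).sum *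
            ‖iteratedFDeriv ℝ (m + α i + (l.map α).sum) f x‖) := by
            gcongr
            exact ih.2 _
        _ = _ := by rw [← add_assoc]; ring
  have h1 : ((List.finRange n).map α).sum = multiLen α := by
    rw [multiLen, ← List.sum_ofFn, List.ofFn_eq_map]
  have h2 := (key (List.finRange n)).2 0
  rw [norm_iteratedFDeriv_zero, h1, zero_add] at h2
  exact h2

/-! ### Box cutoffs -/

/-- The open cube with centre `c` and half side `r`. -/
def openCube {n : ℕ} (c : RSp n) (r : ℝ) : Set (RSp n) := {y | ∀ j, |y j - c j| < r}

/-- The closed cube with centre `c` and half side `r`. -/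
def closedCube {n : ℕ} (c : RSp n) (r : ℝ) : Set (RSp n) := {y | ∀ j, |y j - c j| ≤ r}

/-- The product of a function with a box cutoff. -/
noncomputable def cutProd {n : ℕ} (θ : ℝ → ℝ) (c : RSp n) (f : RSp n → ℂ) : RSp n → ℂ :=
  fun y => ((∏ j, θ (y j - c j) : ℝ) : ℂ) * f y

theorem isOpen_openCube {n : ℕ} (c : RSp n) (r : ℝ) : IsOpen (openCube c r) := by
  have : openCube c r = ⋂ j, {y : RSp n | |y j - c j| < r} := by
    ext y; simp [openCube]
  rw [this]
  exact isOpen_iInter_of_finite fun j => isOpen_lt (by fun_prop) continuous_const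

theorem isClosed_closedCube {n : ℕ} (c : RSp n) (r : ℝ) : IsClosed (closedCube c r) := by
  have : closedCube c r = ⋂ j, {y : RSp n | |y j - c j| ≤ r} := by
    ext y; simp [closedCube]
  rw [this]
  exact isClosed_iInter fun j => isClosed_le (by fun_prop) continuous_const

theorem openCube_subset_closedCube {n : ℕ} (c : RSp n) {r s : ℝ} (h : r ≤ s) :
    openCube c r ⊆ closedCube c s := fun _ hy j => (hy j).le.trans h

theorem closedCube_subset_openCube {n : ℕ} (c : RSp n) {r s : ℝ} (h : r < s) :
    closedCube c r ⊆ openCube c s := fun _ hy j => (hy j).trans_lt h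

theorem mem_openCube_self {n : ℕ} (c : RSp n) {r : ℝ} (h : 0 < r) : c ∈ openCube c r :=
  fun j => by simpa using h

theorem norm_sub_le_of_mem_closedCube {n : ℕ} {c y : RSp n} {r : ℝ} (hr : 0 ≤ r)
    (hy : y ∈ closedCube c r) : ‖y - c‖ ≤ (n : ℝ) * r := by
  refine (pow_le_pow_iff_left₀ (norm_nonneg _) (by positivity) two_ne_zero).1 ?_
  rw [EuclideanSpace.norm_sq_eq]
  calc ∑ j, ‖(y - c) j‖ ^ 2 ≤ ∑ _j : Fin n, r ^ 2 := Finset.sum_le_sum fun j _ => by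
        have : ‖(y - c) j‖ ≤ r := by simpa using hy j
        gcongr
    _ = n * r ^ 2 := by simp
    _ ≤ (n : ℝ) ^ 2 * r ^ 2 := by
        gcongr
        exact_mod_cast Nat.le_self_pow two_ne_zero n
    _ = (n * r) ^ 2 := by ring

theorem isCompact_closedCube {n : ℕ} (c : RSp n) {r : ℝ} (hr : 0 ≤ r) :
    IsCompact (closedCube c r) :=
  (isCompact_closedBall c (n * r)).of_isClosed_subset (isClosed_closedCube c r) fun y hy => by
    rw [mem_closedBall_iff_norm]
    exact norm_sub_le_of_mem_closedCube hr hy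

theorem cutProd_eq_self {n : ℕ} {θ : ℝ → ℝ} {c : RSp n} {f : RSp n → ℂ} {a : ℝ}
    (h1 : ∀ t, |t| ≤ a → θ t = 1) {y : RSp n} (hy : y ∈ closedCube c a) :
    cutProd θ c f y = f y := by
  simp [cutProd, Finset.prod_eq_one fun j _ => h1 _ (hy j)]

theorem cutProd_eq_zero {n : ℕ} {θ : ℝ → ℝ} {c : RSp n} {f : RSp n → ℂ} {b : ℝ}
    (h0 : ∀ t, b ≤ |t| → θ t = 0) {y : RSp n} (hy : y ∉ openCube c b) :
    cutProd θ c f y = 0 := by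
  obtain ⟨j, hj⟩ := not_forall.1 hy
  rw [cutProd, Finset.prod_eq_zero (Finset.mem_univ j) (h0 _ (not_lt.1 hj))]
  simp

theorem norm_cutProd_le {n : ℕ} {θ : ℝ → ℝ} (c : RSp n) (f : RSp n → ℂ)
    (h01 : ∀ t, 0 ≤ θ t ∧ θ t ≤ 1) (y : RSp n) : ‖cutProd θ c f y‖ ≤ ‖f y‖ := by
  rw [cutProd, norm_mul, Complex.norm_real, Real.norm_eq_abs,
    abs_of_nonneg (Finset.prod_nonneg fun j _ => (h01 _).1)]
  exact mul_le_of_le_one_left (norm_nonneg _)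
    (Finset.prod_le_one (fun j _ => (h01 _).1) fun j _ => (h01 _).2)

theorem support_cutProd_subset {n : ℕ} {θ : ℝ → ℝ} {c : RSp n} {f : RSp n → ℂ} {b : ℝ}
    (h0 : ∀ t, b ≤ |t| → θ t = 0) : Function.support (cutProd θ c f) ⊆ closedCube c b := by
  intro y hy
  by_contra h
  exact hy (cutProd_eq_zero h0 fun h' => h (openCube_subset_closedCube c le_rfl h'))

theorem tsupport_cutProd_subset {n : ℕ} {θ : ℝ → ℝ} {c : RSp n} {f : RSp n → ℂ} {b : ℝ}
    (h0 : ∀ t, b ≤ |t| → θ t = 0) : tsupport (cutProd θ c f) ⊆ closedCube c b :=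
  closure_minimal (support_cutProd_subset h0) (isClosed_closedCube c b)

theorem contDiff_boxCutoff {n : ℕ} {θ : ℝ → ℝ} (c : RSp n) (hθ : ContDiff ℝ ∞ θ) :
    ContDiff ℝ ∞ (fun y : RSp n => ((∏ j, θ (y j - c j) : ℝ) : ℂ)) := by
  have : ContDiff ℝ ∞ (fun y : RSp n => ∏ j, θ (y j - c j)) :=
    contDiff_prod fun j _ => hθ.comp (by fun_prop)
  exact Complex.ofRealCLM.contDiff.comp this

theorem contDiff_cutProd {n : ℕ} {θ : ℝ → ℝ} {c : RSp n} {f : RSp n → ℂ} {b : ℝ}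
    {O : Set (RSp n)} (hO : IsOpen O) (hf : ContDiffOn ℝ ∞ f O) (hθ : ContDiff ℝ ∞ θ)
    (h0 : ∀ t, b ≤ |t| → θ t = 0) (hcO : closedCube c b ⊆ O) : ContDiff ℝ ∞ (cutProd θ c f) := by
  rw [contDiff_iff_contDiffAt]
  intro y
  by_cases hy : y ∈ O
  · exact (contDiff_boxCutoff c hθ).contDiffAt.mul (hf.contDiffAt (hO.mem_nhds hy))
  · have : cutProd θ c f =ᶠ[𝓝 y] fun _ => 0 := by
      filter_upwards [(isClosed_closedCube c b).isOpen_compl.mem_nhds fun h => hy (hcO h)] with z hz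
      exact cutProd_eq_zero h0 fun h => hz (openCube_subset_closedCube c le_rfl h)
    exact contDiffAt_const.congr_of_eventuallyEq this

/-- Along the j-th coordinate line only one factor of the box cutoff varies. Leibniz with the bounds
(KN)^i and (C(N + lam))^(q-i) sums by the binomial theorem to the q-th power of their sum; i ≤ N is
what allows N in place of i. -/
theorem norm_iteratedDeriv_cutProd_le {n : ℕ} {θ : ℝ → ℝ} {c : RSp n} {f : RSp n → ℂ}
    {b K D C lam : ℝ} {N : ℕ} {O : Set (RSp n)} (hO : IsOpen O) (hf : ContDiffOn ℝ ∞ f O)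
    (hθ : ContDiff ℝ ∞ θ) (h01 : ∀ t, 0 ≤ θ t ∧ θ t ≤ 1)
    (h0 : ∀ t, b ≤ |t| → θ t = 0) (hcO : closedCube c b ⊆ O) (hK : 0 < K) (hD : 0 ≤ D) (hC : 0 < C)
    (hlam : 0 ≤ lam) (hθK : ∀ q ≤ N, ∀ t, |iteratedDeriv q θ t| ≤ (K * N) ^ q) (j : Fin n)
    (hfb : ∀ (q : ℕ), ∀ y ∈ O,
      ‖iteratedDeriv q (fun s : ℝ => f (y + s • EuclideanSpace.single j (1 : ℝ))) 0‖ ≤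
        D * (C * (q + lam)) ^ q)
    {q : ℕ} (hq : q ≤ N) (y : RSp n) :
    ‖iteratedDeriv q (fun s : ℝ => cutProd θ c f (y + s • EuclideanSpace.single j (1 : ℝ))) 0‖ ≤
      D * (K * N + C * (N + lam)) ^ q ∧
    (y ∉ closedCube c b →
      iteratedDeriv q (fun s : ℝ => cutProd θ c f (y + s • EuclideanSpace.single j (1 : ℝ))) 0
        = 0) := by
  set e : RSp n := EuclideanSpace.single j (1 : ℝ) with he
  have hline : Continuous fun s : ℝ => y + s • e := by fun_prop
  have hz : y ∉ closedCube c b → iteratedDeriv q (fun s : ℝ => cutProd θ c f (y + s • e)) 0 = 0 := by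
    intro hy
    have h1 : (fun s : ℝ => cutProd θ c f (y + s • e)) =ᶠ[𝓝 0] fun _ => 0 := by
      have h2 : IsOpen ((fun s : ℝ => y + s • e) ⁻¹' (closedCube c b)ᶜ) :=
        (isClosed_closedCube c b).isOpen_compl.preimage hline
      filter_upwards [h2.mem_nhds (by simpa using hy)] with s hs
      exact cutProd_eq_zero h0 fun h => hs (openCube_subset_closedCube c le_rfl h)
    rw [h1.iteratedDeriv_eq]
    simp
  refine ⟨?_, hz⟩
  by_cases hy : y ∈ closedCube c b
  swap
  · rw [hz hy, norm_zero]
    positivity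
  have hyO := hcO hy
  set T : Set ℝ := (fun s : ℝ => y + s • e) ⁻¹' O with hT
  have hTo : IsOpen T := hO.preimage hline
  have h0T : (0 : ℝ) ∈ T := by simpa [hT] using hyO
  -- The factors constant on the line, whose product lies in [0, 1].
  set c0 : ℝ := ∏ i ∈ Finset.univ.erase j, θ (y i - c i) with hc0
  have hc01 : 0 ≤ c0 ∧ c0 ≤ 1 := ⟨Finset.prod_nonneg fun i _ => (h01 _).1,
    Finset.prod_le_one (fun i _ => (h01 _).1) fun i _ => (h01 _).2⟩
  set g : ℝ → ℂ := fun s => ((c0 * θ (y j - c j + s) : ℝ) : ℂ) with hg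
  have hprod : ∀ s : ℝ, cutProd θ c f (y + s • e) = g s * f (y + s • e) := by
    intro s
    have hp : ∏ i, θ ((y + s • e) i - c i) = c0 * θ (y j - c j + s) := by
      rw [← Finset.prod_erase_mul Finset.univ _ (Finset.mem_univ j), hc0]
      congr 1
      · refine Finset.prod_congr rfl fun i hi => ?_
        have : i ≠ j := (Finset.mem_erase.1 hi).1
        simp [he, this]
      · simp only [he, PiLp.add_apply, PiLp.smul_apply, PiLp.single_apply, if_true,
          smul_eq_mul, mul_one]
        congr 1
        ring
    rw [cutProd, hp]
  have hgr : ContDiff ℝ ∞ (fun s => c0 * θ (y j - c j + s)) :=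
    contDiff_const.mul (hθ.comp (contDiff_const.add contDiff_id))
  have hgs : ContDiff ℝ ∞ g := Complex.ofRealCLM.contDiff.comp hgr
  have hgb : ∀ i ≤ N, ‖iteratedFDeriv ℝ i g 0‖ ≤ (K * N) ^ i := by
    intro i hi
    have h1 : g = Complex.ofRealLI ∘ fun s => c0 * θ (y j - c j + s) := rfl
    rw [h1, LinearIsometry.norm_iteratedFDeriv_comp_left _ hgr.contDiffAt
      (by exact_mod_cast le_top), norm_iteratedFDeriv_eq_norm_iteratedDeriv,
      iteratedDeriv_const_mul_field, iteratedDeriv_comp_const_add, norm_mul, Real.norm_eq_abs,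
      abs_of_nonneg hc01.1]
    exact (mul_le_of_le_one_left (norm_nonneg _) hc01.2).trans (hθK i hi _)
  have hfs : ContDiffOn ℝ ∞ (fun s : ℝ => f (y + s • e)) T :=
    hf.comp (by fun_prop) fun s hs => hs
  have hfq : ∀ i : ℕ, i ≤ N → ‖iteratedFDeriv ℝ i (fun s : ℝ => f (y + s • e)) 0‖ ≤
      D * (C * (N + lam)) ^ i := by
    intro i hi
    rw [norm_iteratedFDeriv_eq_norm_iteratedDeriv]
    refine (hfb i y hyO).trans ?_
    gcongr
  have hL := norm_iteratedFDerivWithin_mul_le (hgs.contDiffOn (s := T)) hfs hTo.uniqueDiffOn h0T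
    (n := q) (by exact_mod_cast le_top)
  rw [funext hprod, ← norm_iteratedFDeriv_eq_norm_iteratedDeriv]
  simp only [iteratedFDerivWithin_of_isOpen _ hTo h0T] at hL
  refine hL.trans ?_
  rw [add_pow, Finset.mul_sum]
  refine Finset.sum_le_sum fun i hi => ?_
  have hiq : i ≤ q := Nat.lt_succ_iff.1 (Finset.mem_range.1 hi)
  calc (q.choose i : ℝ) * ‖iteratedFDeriv ℝ i g 0‖ *
        ‖iteratedFDeriv ℝ (q - i) (fun s : ℝ => f (y + s • e)) 0‖
      ≤ (q.choose i : ℝ) * (K * N) ^ i * (D * (C * (N + lam)) ^ (q - i)) := by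
        gcongr
        · exact hgb i (hiq.trans hq)
        · exact hfq _ (by omega)
    _ = _ := by ring

/-! ### Weighted bounds for Fourier transforms -/

open LineDeriv FourierTransform in
theorem norm_fourier_lineDerivOp_iterate {n : ℕ} (e : RSp n) (q : ℕ) :
    ∀ (S : SchwartzMap (RSp n) ℂ) (ξ : RSp n),
    ‖𝓕 ((lineDerivOp e : SchwartzMap (RSp n) ℂ → SchwartzMap (RSp n) ℂ)^[q] S) ξ‖ =
      (2 * Real.pi * |inner ℝ ξ e|) ^ q * ‖𝓕 S ξ‖ := by
  induction q with
  | zero => intro S ξ; simp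
  | succ q ih =>
    intro S ξ
    rw [Function.iterate_succ_apply, ih, SchwartzMap.fourier_lineDerivOp_eq]
    rw [smul_apply, SchwartzMap.smulLeftCLM_apply_apply (by fun_prop)]
    simp only [norm_smul, norm_mul, Complex.norm_real, Complex.norm_ofNat, Complex.norm_I,
      Real.norm_eq_abs, abs_of_pos Real.pi_pos]
    ring

theorem one_add_mul_pow_le {a : ℝ} (ha : 0 ≤ a) (Q : ℕ) : (1 + a) ^ Q ≤ 2 ^ Q * (1 + a ^ Q) := by
  have h1 : 1 + a ≤ 2 * max 1 a := by linarith [le_max_left 1 a, le_max_right 1 a]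
  calc (1 + a) ^ Q ≤ (2 * max 1 a) ^ Q := by gcongr
    _ = 2 ^ Q * (max 1 a) ^ Q := mul_pow _ _ _
    _ ≤ 2 ^ Q * (1 + a ^ Q) := by
        gcongr
        rcases max_choice 1 a with h | h <;> rw [h]
        · simpa using pow_nonneg ha Q
        · linarith

/-- The power mean inequality, which makes pure derivatives sufficient after Plancherel. The summand
1 covers n = Q = 0. -/
theorem norm_pow_le_sum {n : ℕ} (ξ : RSp n) (Q : ℕ) :
    ‖ξ‖ ^ (2 * Q) ≤ 1 + (n : ℝ) ^ Q * ∑ j, |ξ j| ^ (2 * Q) := by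
  have h0 : ‖ξ‖ ^ 2 = ∑ j, ‖ξ j‖ ^ 2 := EuclideanSpace.norm_sq_eq _
  rcases Nat.eq_zero_or_pos Q with rfl | hQ
  · simp
  rw [pow_mul, h0]
  obtain ⟨p, rfl⟩ : ∃ p, Q = p + 1 := ⟨Q - 1, by omega⟩
  refine (pow_sum_le_card_mul_sum_pow (fun j _ => by positivity) p).trans ?_
  simp only [← pow_mul, Finset.card_univ, Fintype.card_fin, Real.norm_eq_abs]
  rcases Nat.eq_zero_or_pos n with rfl | hn
  · simp
  have hn1 : (1 : ℝ) ≤ n := by exact_mod_cast hn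
  calc (n : ℝ) ^ p * ∑ j, |ξ j| ^ (2 * (p + 1))
      ≤ (n : ℝ) ^ (p + 1) * ∑ j, |ξ j| ^ (2 * (p + 1)) := by
        gcongr
        omega
    _ ≤ _ := by linarith

theorem integrable_inv_one_add_norm_sq (n : ℕ) :
    Integrable (fun η : RSp n => (((1 + 2 * Real.pi * ‖η‖) ^ n)⁻¹) ^ 2) := by
  rcases Nat.eq_zero_or_pos n with rfl | hn
  · simp only [pow_zero, inv_one, one_pow]
    exact integrable_const _
  · have hn' : (0 : ℝ) < n := by exact_mod_cast hn
    have h := integrable_one_add_norm (E := RSp n) (μ := volume) (r := ((2 * n : ℕ) : ℝ)) (by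
      simp; linarith)
    refine h.mono' (Continuous.aestronglyMeasurable ?_) (Eventually.of_forall fun η => ?_)
    · refine ((Continuous.pow (by fun_prop) n).inv₀ fun η => ?_).pow 2
      have := Real.pi_pos
      exact (show (0 : ℝ) < (1 + 2 * Real.pi * ‖η‖) ^ n by positivity).ne'
    · have hpi := Real.pi_gt_three
      rw [Real.rpow_neg (by positivity), Real.rpow_natCast, Real.norm_eq_abs,
        abs_of_nonneg (by positivity), inv_pow, ← pow_mul, mul_comm n 2]
      gcongr
      nlinarith [norm_nonneg η]

open FourierTransform in
-- Purely qualitative: it justifies differentiation under the integral and comparison of integrals.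
-- The uniform bound is `integral_weighted_fourier_le`.
theorem integrable_weight_mul_fourier {n : ℕ} (S : SchwartzMap (RSp n) ℂ) {a : ℝ} (ha : 0 ≤ a)
    (i : ℕ) (k : ℝ) :
    Integrable fun η => (a + 2 * Real.pi * ‖η‖) ^ i * (1 + 2 * Real.pi * ‖η‖) ^ k * ‖𝓕 S η‖ := by
  have hpi := Real.pi_gt_three
  set q := ⌈k⌉₊
  set b := 1 + a + 2 * Real.pi
  have h0 := ((𝓕 S).integrable_pow_mul volume 0).add ((𝓕 S).integrable_pow_mul volume (i + q))
  refine (h0.const_mul (b ^ (i + q) * 2 ^ (i + q))).mono' (Continuous.aestronglyMeasurable ?_)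
    (Eventually.of_forall fun η => ?_)
  · refine ((Continuous.pow (by fun_prop) i).mul ?_).mul (𝓕 S).continuous.norm
    refine Continuous.rpow_const (by fun_prop) fun η => Or.inl ?_
    positivity
  · have hη := norm_nonneg η
    have h1 : (1 + 2 * Real.pi * ‖η‖) ^ k ≤ (1 + 2 * Real.pi * ‖η‖) ^ q := by
      rw [← Real.rpow_natCast]
      exact Real.rpow_le_rpow_of_exponent_le (by nlinarith) (Nat.le_ceil k)
    rw [Real.norm_eq_abs, abs_of_nonneg (by positivity)]
    calc (a + 2 * Real.pi * ‖η‖) ^ i * (1 + 2 * Real.pi * ‖η‖) ^ k * ‖𝓕 S η‖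
        ≤ (b * (1 + ‖η‖)) ^ i * (b * (1 + ‖η‖)) ^ q * ‖𝓕 S η‖ := by
          gcongr
          · simp only [b]; nlinarith
          · refine h1.trans ?_
            gcongr
            simp only [b]; nlinarith
      _ = b ^ (i + q) * (1 + ‖η‖) ^ (i + q) * ‖𝓕 S η‖ := by
          rw [← pow_add, mul_pow]
      _ ≤ b ^ (i + q) * (2 ^ (i + q) * (1 + ‖η‖ ^ (i + q))) * ‖𝓕 S η‖ := by
          gcongr
          exact one_add_mul_pow_le hη _
      _ = _ := by
          simp only [Pi.add_apply, pow_zero]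
          ring

open FourierTransform LineDeriv in
-- Cauchy–Schwarz against the square integrable (1 + 2π|η|)^(-n), in the form w X ≤ t w² + X²/t,
-- followed by Plancherel for S and its pure derivatives of order Q. The loss is exponential in Q,
-- while the power of L is exactly p; this is essential because p may be non-integral and L^(p-m)
-- later becomes the power of 1/h. The constant depends on n, κ and the volume only.
theorem integral_weighted_fourier_le (n : ℕ) {κ Vol : ℝ} (hκ : 1 ≤ κ) (hVol : 0 ≤ Vol) :
    ∃ c : ℝ, 0 < c ∧ ∀ (S : SchwartzMap (RSp n) ℂ) (B : Set (RSp n)) (D L p : ℝ) (Q : ℕ),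
      MeasurableSet B → volume B ≤ ENNReal.ofReal Vol → 0 ≤ D → 1 ≤ L → 0 ≤ p → p ≤ Q →
      (∀ x, ‖S x‖ ≤ D) → (∀ x ∉ B, S x = 0) →
      (∀ (j : Fin n) (x : RSp n), ‖((lineDerivOp (EuclideanSpace.single j (1 : ℝ)) :
        SchwartzMap (RSp n) ℂ → SchwartzMap (RSp n) ℂ)^[Q] S) x‖ ≤ D * (κ * L) ^ Q) →
      (∀ (j : Fin n), ∀ x ∉ B, ((lineDerivOp (EuclideanSpace.single j (1 : ℝ)) :
        SchwartzMap (RSp n) ℂ → SchwartzMap (RSp n) ℂ)^[Q] S) x = 0) →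
      ∫ η, (L + 2 * Real.pi * ‖η‖) ^ p * ((1 + 2 * Real.pi * ‖η‖) ^ n)⁻¹ * ‖𝓕 S η‖ ≤
        c ^ (Q + 1) * D * L ^ p := by
  set I : ℝ := ∫ η : RSp n, (((1 + 2 * Real.pi * ‖η‖) ^ n)⁻¹) ^ 2 with hI
  have hI0 : 0 ≤ I := integral_nonneg fun η => by positivity
  have hpi := Real.pi_gt_three
  set c₀ : ℝ := 1 + I + 4 * (1 + Vol) + 4 * (2 * Real.pi) ^ 2 * (1 + Vol) +
    4 * n * κ ^ 2 * (1 + Vol) with hc₀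
  have hc1 : 0 ≤ 4 * (2 * Real.pi) ^ 2 * (1 + Vol) := by positivity
  have hc2 : 0 ≤ 4 * n * κ ^ 2 * (1 + Vol) := by positivity
  refine ⟨4 * c₀, by positivity, ?_⟩
  intro S B D L p Q hB hBV hD hL hp hpQ hS hSB hdS hdSB
  have hL0 : 0 < L := by linarith
  -- The balancing parameter t = D L^p must be nonzero.
  rcases hD.eq_or_lt with rfl | hD
  · have hS0 : S = 0 := by
      ext x
      simpa using hS x
    have : (𝓕 S : SchwartzMap (RSp n) ℂ) = 0 := by
      rw [hS0]
      exact map_zero (SchwartzMap.fourierTransformCLM ℂ)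
    simp [this]
  have hPl : ∀ (S' : SchwartzMap (RSp n) ℂ) (E : ℝ), (∀ x, ‖S' x‖ ≤ E) → (∀ x ∉ B, S' x = 0) →
      Integrable (fun η => ‖𝓕 S' η‖ ^ 2) ∧ ∫ η, ‖𝓕 S' η‖ ^ 2 ≤ Vol * E ^ 2 := by
    intro S' E hE hE0
    constructor
    · have := (𝓕 S').memLp 2 volume
      exact this.integrable_norm_pow (by norm_num)
    · rw [SchwartzMap.integral_norm_sq_fourier]
      have hfin : volume B < ⊤ := hBV.trans_lt ENNReal.ofReal_lt_top
      rw [← setIntegral_eq_integral_of_forall_compl_eq_zero (s := B)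
        fun x hx => by rw [hE0 x hx]; simp]
      refine (Real.le_norm_self _).trans ?_
      refine (norm_setIntegral_le_of_norm_le_const hfin (C := E ^ 2) fun x _ => ?_).trans ?_
      · rw [Real.norm_eq_abs, abs_of_nonneg (by positivity)]
        have := hE x
        gcongr
      · rw [mul_comm]
        gcongr
        exact ENNReal.toReal_le_of_le_ofReal hVol hBV
  -- The expected size of the answer: with this t both terms of w X ≤ t w² + X²/t are of order t.
  set t : ℝ := D * L ^ p with ht
  have ht0 : 0 < t := by positivity
  let dS : Fin n → SchwartzMap (RSp n) ℂ := fun j =>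
    ((lineDerivOp (EuclideanSpace.single j (1 : ℝ)) :
        SchwartzMap (RSp n) ℂ → SchwartzMap (RSp n) ℂ)^[Q] S)
  have hdF : ∀ j η, ‖𝓕 (dS j) η‖ ^ 2 = (2 * Real.pi * |η j|) ^ (2 * Q) * ‖𝓕 S η‖ ^ 2 := by
    intro j η
    have h1 : inner ℝ η (EuclideanSpace.single j (1 : ℝ)) = η j := by
      simp [EuclideanSpace.inner_single_right]
    rw [norm_fourier_lineDerivOp_iterate, h1, mul_pow, ← pow_mul, mul_comm Q 2]
  have hP0 := hPl S D hS hSB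
  have hPj := fun j => hPl (dS j) _ (hdS j) (hdSB j)
  set RHS : RSp n → ℝ := fun η => t * (((1 + 2 * Real.pi * ‖η‖) ^ n)⁻¹) ^ 2 +
    t⁻¹ * ((L ^ p) ^ 2 * 4 ^ Q * ((1 + (2 * Real.pi) ^ (2 * Q)) * ‖𝓕 S η‖ ^ 2 +
      n ^ Q * L⁻¹ ^ (2 * Q) * ∑ j, ‖𝓕 (dS j) η‖ ^ 2)) with hRHS
  have hRi1 := (integrable_inv_one_add_norm_sq n).const_mul t
  have hRi2 := hP0.1.const_mul (1 + (2 * Real.pi) ^ (2 * Q))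
  have hRi3 := (integrable_finsetSum (μ := volume) (Finset.univ : Finset (Fin n))
    (f := fun j η => ‖𝓕 (dS j) η‖ ^ 2) fun j _ => (hPj j).1)
  have hRi4 := hRi3.const_mul (n ^ Q * L⁻¹ ^ (2 * Q))
  have hRi5 := ((hRi2.add hRi4).const_mul ((L ^ p) ^ 2 * 4 ^ Q)).const_mul t⁻¹
  have hRint : Integrable RHS := hRi1.add hRi5
  have hpt : ∀ η : RSp n, (L + 2 * Real.pi * ‖η‖) ^ p * ((1 + 2 * Real.pi * ‖η‖) ^ n)⁻¹ * ‖𝓕 S η‖ ≤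
      RHS η := by
    intro η
    set a := 2 * Real.pi * ‖η‖ with ha
    have ha0 : 0 ≤ a := by positivity
    set w := ((1 + a) ^ n)⁻¹ with hw
    set X := (L + a) ^ p * ‖𝓕 S η‖ with hX
    have h1 : (L + a) ^ p * w * ‖𝓕 S η‖ ≤ t * w ^ 2 + t⁻¹ * X ^ 2 := by
      have h2 : (L + a) ^ p * w * ‖𝓕 S η‖ = w * X := by rw [hX]; ring
      have h3 : 0 ≤ t⁻¹ * (t * w - X) ^ 2 := by positivity
      have h4 : t⁻¹ * (t * w - X) ^ 2 = t * w ^ 2 - 2 * (w * X) + t⁻¹ * X ^ 2 := by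
        field_simp
        ring
      have h5 : 0 ≤ w * X := by positivity
      rw [h2]
      linarith
    -- After L^p is taken out, the remaining real power may be raised to the integer Q, to which
    -- Plancherel applies.
    have h6 : (L + a) ^ p ≤ L ^ p * (1 + a / L) ^ Q := by
      have : L + a = L * (1 + a / L) := by field_simp
      rw [this, Real.mul_rpow hL0.le (by positivity), ← Real.rpow_natCast (1 + a / L) Q]
      gcongr
      have : 0 ≤ a / L := by positivity
      linarith
    have h7 : (1 + a / L) ^ (2 * Q) ≤ 4 ^ Q * ((1 + (2 * Real.pi) ^ (2 * Q)) +
        n ^ Q * L⁻¹ ^ (2 * Q) * ∑ j, (2 * Real.pi * |η j|) ^ (2 * Q)) := by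
      refine (one_add_mul_pow_le (by positivity) _).trans ?_
      rw [pow_mul 2 2 Q, show (2 : ℝ) ^ 2 = 4 by norm_num]
      refine mul_le_mul_of_nonneg_left ?_ (by positivity)
      have h8 : (a / L) ^ (2 * Q) = (2 * Real.pi) ^ (2 * Q) * L⁻¹ ^ (2 * Q) * ‖η‖ ^ (2 * Q) := by
        rw [ha, div_eq_mul_inv]; ring
      have h9 : L⁻¹ ^ (2 * Q) ≤ 1 := pow_le_one₀ (by positivity) (inv_le_one_of_one_le₀ hL)
      rw [h8, add_assoc]
      gcongr
      calc (2 * Real.pi) ^ (2 * Q) * L⁻¹ ^ (2 * Q) * ‖η‖ ^ (2 * Q)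
          ≤ (2 * Real.pi) ^ (2 * Q) * L⁻¹ ^ (2 * Q) * (1 + (n : ℝ) ^ Q * ∑ j, |η j| ^ (2 * Q)) := by
            gcongr
            exact norm_pow_le_sum η Q
        _ = (2 * Real.pi) ^ (2 * Q) * L⁻¹ ^ (2 * Q) +
            n ^ Q * L⁻¹ ^ (2 * Q) * ∑ j, (2 * Real.pi * |η j|) ^ (2 * Q) := by
            simp_rw [mul_pow (2 * Real.pi), ← Finset.mul_sum]
            ring
        _ ≤ _ := by
            gcongr
            exact mul_le_of_le_one_right (by positivity) h9
    have h10 : X ^ 2 ≤ (L ^ p) ^ 2 * 4 ^ Q * ((1 + (2 * Real.pi) ^ (2 * Q)) * ‖𝓕 S η‖ ^ 2 +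
        n ^ Q * L⁻¹ ^ (2 * Q) * ∑ j, ‖𝓕 (dS j) η‖ ^ 2) := by
      simp_rw [hdF]
      rw [← Finset.sum_mul]
      calc X ^ 2 ≤ (L ^ p * (1 + a / L) ^ Q * ‖𝓕 S η‖) ^ 2 := by
            rw [hX]
            gcongr
        _ = (L ^ p) ^ 2 * (1 + a / L) ^ (2 * Q) * ‖𝓕 S η‖ ^ 2 := by ring
        _ ≤ (L ^ p) ^ 2 * (4 ^ Q * ((1 + (2 * Real.pi) ^ (2 * Q)) +
        n ^ Q * L⁻¹ ^ (2 * Q) * ∑ j, (2 * Real.pi * |η j|) ^ (2 * Q))) * ‖𝓕 S η‖ ^ 2 := by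
            gcongr
        _ = _ := by ring
    refine h1.trans ?_
    simp only [hRHS]
    gcongr
  have hmono := integral_mono_of_nonneg (Eventually.of_forall fun η => by positivity) hRint
    (Eventually.of_forall hpt)
  refine hmono.trans ?_
  have hval : ∫ η, RHS η = t * I + t⁻¹ * ((L ^ p) ^ 2 * 4 ^ Q * ((1 + (2 * Real.pi) ^ (2 * Q)) *
      (∫ η, ‖𝓕 S η‖ ^ 2) + n ^ Q * L⁻¹ ^ (2 * Q) * ∑ j, ∫ η, ‖𝓕 (dS j) η‖ ^ 2)) := by
    have e1 : ∫ η, RHS η = (∫ η : RSp n, t * (((1 + 2 * Real.pi * ‖η‖) ^ n)⁻¹) ^ 2) +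
        ∫ η, t⁻¹ * ((L ^ p) ^ 2 * 4 ^ Q * ((1 + (2 * Real.pi) ^ (2 * Q)) * ‖𝓕 S η‖ ^ 2 +
      n ^ Q * L⁻¹ ^ (2 * Q) * ∑ j, ‖𝓕 (dS j) η‖ ^ 2)) := integral_add hRi1 hRi5
    have e2 : ∫ η, ((1 + (2 * Real.pi) ^ (2 * Q)) * ‖𝓕 S η‖ ^ 2 +
      n ^ Q * L⁻¹ ^ (2 * Q) * ∑ j, ‖𝓕 (dS j) η‖ ^ 2) =
      (∫ η, (1 + (2 * Real.pi) ^ (2 * Q)) * ‖𝓕 S η‖ ^ 2) +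
        ∫ η, n ^ Q * L⁻¹ ^ (2 * Q) * ∑ j, ‖𝓕 (dS j) η‖ ^ 2 := integral_add hRi2 hRi4
    rw [e1, integral_const_mul, integral_const_mul, integral_const_mul, e2, integral_const_mul,
      integral_const_mul, integral_finsetSum _ fun j _ => (hPj j).1]
  rw [hval]
  have hsum : ∑ j, ∫ η, ‖𝓕 (dS j) η‖ ^ 2 ≤ n * (Vol * (D * (κ * L) ^ Q) ^ 2) := by
    calc _ ≤ ∑ _j : Fin n, Vol * (D * (κ * L) ^ Q) ^ 2 := Finset.sum_le_sum fun j _ => (hPj j).2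
      _ = _ := by simp
  have hc0pos : 0 ≤ c₀ := by positivity
  have hpow : ∀ x : ℝ, 0 ≤ x → x ≤ c₀ → x ^ (Q + 1) ≤ c₀ ^ (Q + 1) := fun x hx h =>
    pow_le_pow_left₀ hx h _
  have t1 : I ≤ c₀ ^ (Q + 1) := by
    have : 1 + I ≤ (1 + I) ^ (Q + 1) := le_self_pow₀ (by linarith) (by simp)
    have := hpow (1 + I) (by positivity) (by simp only [hc₀]; nlinarith)
    linarith
  have hV1 : Vol ≤ (1 + Vol) ^ (Q + 1) := by
    have : 1 + Vol ≤ (1 + Vol) ^ (Q + 1) := le_self_pow₀ (by linarith) (by simp)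
    linarith
  have t2 : 4 ^ Q * Vol ≤ c₀ ^ (Q + 1) := by
    refine le_trans ?_ (hpow (4 * (1 + Vol)) (by positivity) (by simp only [hc₀]; linarith))
    rw [mul_pow]
    gcongr
    · norm_num
    · omega
  have t3 : 4 ^ Q * (2 * Real.pi) ^ (2 * Q) * Vol ≤ c₀ ^ (Q + 1) := by
    refine le_trans ?_ (hpow (4 * (2 * Real.pi) ^ 2 * (1 + Vol)) (by positivity)
      (by simp only [hc₀]; linarith))
    rw [mul_pow _ (1 + Vol), mul_pow 4 ((2 * Real.pi) ^ 2), ← pow_mul]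
    gcongr
    · norm_num
    · omega
    · linarith
    · omega
  have t4 : 4 ^ Q * n ^ Q * n * κ ^ (2 * Q) * Vol ≤ c₀ ^ (Q + 1) := by
    refine le_trans ?_ (hpow (4 * n * κ ^ 2 * (1 + Vol)) (by positivity)
      (by simp only [hc₀]; linarith))
    rw [mul_pow, mul_pow, mul_pow, ← pow_mul, mul_assoc (4 ^ Q) (_ ^ Q), ← pow_succ]
    gcongr
    · norm_num
    · omega
    · omega
  -- The growth L^Q of the derivatives cancels against the weight (|η|/L)^Q.
  have hLQ : L⁻¹ ^ (2 * Q) * L ^ (2 * Q) = 1 := by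
    rw [← mul_pow, inv_mul_cancel₀ hL0.ne', one_pow]
  calc t * I + t⁻¹ * ((L ^ p) ^ 2 * 4 ^ Q * ((1 + (2 * Real.pi) ^ (2 * Q)) *
      (∫ η, ‖𝓕 S η‖ ^ 2) + n ^ Q * L⁻¹ ^ (2 * Q) * ∑ j, ∫ η, ‖𝓕 (dS j) η‖ ^ 2))
      ≤ t * I + t⁻¹ * ((L ^ p) ^ 2 * 4 ^ Q * ((1 + (2 * Real.pi) ^ (2 * Q)) *
      (Vol * D ^ 2) + n ^ Q * L⁻¹ ^ (2 * Q) * (n * (Vol * (D * (κ * L) ^ Q) ^ 2)))) := by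
        gcongr
        exact hP0.2
    _ = t * I + t⁻¹ * ((L ^ p) ^ 2 * 4 ^ Q * ((1 + (2 * Real.pi) ^ (2 * Q)) *
      (Vol * D ^ 2) + n ^ Q * n * Vol * D ^ 2 * κ ^ (2 * Q) * (L⁻¹ ^ (2 * Q) * L ^ (2 * Q)))) := by
        ring
    _ = t⁻¹ * t ^ 2 * (I + 4 ^ Q * Vol + 4 ^ Q * (2 * Real.pi) ^ (2 * Q) * Vol +
        4 ^ Q * n ^ Q * n * κ ^ (2 * Q) * Vol) := by
        rw [hLQ]
        have : t * I = t⁻¹ * t ^ 2 * I := by field_simp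
        rw [this, ht]
        ring
    _ ≤ t⁻¹ * t ^ 2 * (4 * c₀ ^ (Q + 1)) := by
        gcongr
        linarith
    _ = (4 * c₀ ^ (Q + 1)) * t := by field_simp
    _ ≤ (4 * c₀) ^ (Q + 1) * t := by
        rw [mul_pow]
        gcongr
        exact le_self_pow₀ (by norm_num) (by simp)
    _ = _ := by rw [ht]; ring

/-! ### Homogeneous analytic symbols: growth -/

/-- The inclusion `ℝⁿ → ℂⁿ` as a continuous real-linear map. -/
noncomputable def complexifyL (n : ℕ) : RSp n →L[ℝ] CSp n :=
  LinearMap.mkContinuous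
    { toFun := complexify
      map_add' := fun x y => by ext i; simp [complexify]
      map_smul' := fun c x => by ext i; simp [complexify] } 1 fun x => by
    simp [complexify, EuclideanSpace.norm_eq]

@[simp] theorem complexifyL_apply {n : ℕ} (x : RSp n) : complexifyL n x = complexify x := rfl

theorem norm_complexify {n : ℕ} (x : RSp n) : ‖complexify x‖ = ‖x‖ := by
  simp [complexify, EuclideanSpace.norm_eq]

theorem norm_complexifyL_le (n : ℕ) : ‖complexifyL n‖ ≤ 1 :=
  LinearMap.mkContinuous_norm_le _ zero_le_one _

theorem inner_complexify {n : ℕ} (x y : RSp n) :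
    inner ℂ (complexify y) (complexify x) = ((inner ℝ x y : ℝ) : ℂ) := by
  simp [complexify, PiLp.inner_apply, mul_comm]

theorem exp_neg_div_le_mul_rpow {C : ℝ} (hC : 0 < C) (k : ℝ) :
    ∃ c : ℝ, 0 < c ∧ ∀ t : ℝ, 0 ≤ t → Real.exp (-t / C) ≤ c * (1 + t) ^ k := by
  set q := ⌈-k⌉₊
  refine ⟨q.factorial * C ^ q * Real.exp (1 / C), by positivity, fun t ht => ?_⟩
  have h1 : (1 + t) ^ (-k) ≤ (1 + t) ^ q := by
    rw [← Real.rpow_natCast]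
    exact Real.rpow_le_rpow_of_exponent_le (by linarith) (Nat.le_ceil _)
  have h2 : (1 + t) ^ q ≤ q.factorial * C ^ q * Real.exp ((1 + t) / C) := by
    have h3 := Real.pow_div_factorial_le_exp (x := (1 + t) / C) (by positivity) q
    rw [div_le_iff₀ (by positivity), div_pow, div_le_iff₀ (by positivity)] at h3
    linarith
  have h4 : Real.exp ((1 + t) / C) = Real.exp (1 / C) * Real.exp (t / C) := by
    rw [← Real.exp_add]; ring_nf
  have h5 : Real.exp (-t / C) * Real.exp (t / C) = 1 := by
    rw [← Real.exp_add]; ring_nf; simp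
  have h6 : (1 + t) ^ k * (1 + t) ^ (-k) = 1 := by
    rw [← Real.rpow_add (by linarith)]; simp
  have hk : 0 < (1 + t) ^ k := by positivity
  calc Real.exp (-t / C) = Real.exp (-t / C) * ((1 + t) ^ k * (1 + t) ^ (-k)) := by
        rw [h6, mul_one]
    _ ≤ Real.exp (-t / C) * ((1 + t) ^ k *
          (q.factorial * C ^ q * (Real.exp (1 / C) * Real.exp (t / C)))) := by
        rw [← h4]
        gcongr
        exact h1.trans h2
    _ = q.factorial * C ^ q * Real.exp (1 / C) * (1 + t) ^ k *
          (Real.exp (-t / C) * Real.exp (t / C)) := by ring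
    _ = _ := by rw [h5, mul_one]

theorem rpow_le_mul_one_add_rpow {t : ℝ} (ht : 1 ≤ t) (k : ℝ) :
    t ^ k ≤ 2 ^ |k| * (1 + t) ^ k := by
  rcases le_total 0 k with hk | hk
  · calc t ^ k ≤ (1 + t) ^ k := by gcongr; linarith
      _ ≤ _ := le_mul_of_one_le_left (by positivity)
        (Real.one_le_rpow (by norm_num) (abs_nonneg _))
  · rw [abs_of_nonpos hk, Real.rpow_neg (by norm_num), ← Real.inv_rpow (by norm_num),
      ← Real.mul_rpow (by norm_num) (by linarith)]
    exact Real.rpow_le_rpow_of_nonpos (by positivity) (by linarith) hk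

theorem one_le_mul_one_add_rpow {t : ℝ} (ht : 0 ≤ t) (ht1 : t ≤ 1) (k : ℝ) :
    1 ≤ 2 ^ |k| * (1 + t) ^ k := by
  rcases le_total 0 k with hk | hk
  · exact one_le_mul_of_one_le_of_one_le (Real.one_le_rpow (by norm_num) (abs_nonneg _))
      (Real.one_le_rpow (by linarith) hk)
  · rw [abs_of_nonpos hk, Real.rpow_neg (by norm_num), ← Real.inv_rpow (by norm_num),
      ← Real.mul_rpow (by norm_num) (by linarith)]
    exact Real.one_le_rpow_of_pos_of_le_one_of_nonpos (by positivity) (by linarith) hk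

/-- For j ≤ |ξ|/C₁ the factor j^j is absorbed by |ξ|^(-j), leaving (C₀/C₁)^j ≤ 2^(-j): the truncated
formal symbol is dominated by a geometric series. -/
theorem norm_homogeneous_le {n : ℕ} {k C₀ : ℝ} {Λ : Set (CSp n)} {f : CSp n → ℂ} {j : ℕ}
    (hΛ : ∀ ξ : RSp n, ξ ≠ 0 → complexify ξ ∈ Λ)
    (hf : ∀ ζ ∈ Λ, ∀ t : ℝ, 0 < t → f ((t : ℂ) • ζ) = ((t ^ (k - (j : ℝ)) : ℝ) : ℂ) * f ζ)
    (hC₀ : 0 < C₀) (hb : ∀ ζ ∈ Λ, ‖ζ‖ = 1 → ‖f ζ‖ ≤ C₀ ^ (j + 1) * (j : ℝ) ^ j)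
    {C₁ : ℝ} (hC₁ : 2 * C₀ ≤ C₁) {ξ : RSp n} (hξ : 1 ≤ ‖ξ‖) (hj : (j : ℝ) ≤ ‖ξ‖ / C₁) :
    ‖f (complexify ξ)‖ ≤ ‖ξ‖ ^ k * (C₀ * (1 / 2) ^ j) := by
  have hξ0 : 0 < ‖ξ‖ := by linarith
  set v : RSp n := ‖ξ‖⁻¹ • ξ with hv
  have hv1 : ‖v‖ = 1 := by
    rw [hv, norm_smul, norm_inv, norm_norm, inv_mul_cancel₀ hξ0.ne']
  have hvΛ : complexify v ∈ Λ := hΛ v fun h => by simp [h] at hv1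
  have hξv : complexify ξ = ((‖ξ‖ : ℝ) : ℂ) • complexify v := by
    ext i
    have : (‖ξ‖ : ℂ) ≠ 0 := by exact_mod_cast hξ0.ne'
    simp [complexify, hv]
    field_simp
  have hC1 : 0 < C₁ := by linarith
  rw [hξv, hf _ hvΛ _ hξ0, norm_mul, Complex.norm_real, Real.norm_eq_abs,
    abs_of_pos (by positivity), Real.rpow_sub hξ0, Real.rpow_natCast]
  calc ‖ξ‖ ^ k / ‖ξ‖ ^ j * ‖f (complexify v)‖
      ≤ ‖ξ‖ ^ k / ‖ξ‖ ^ j * (C₀ ^ (j + 1) * (j : ℝ) ^ j) := by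
        gcongr
        exact hb _ hvΛ (by rw [norm_complexify, hv1])
    _ ≤ ‖ξ‖ ^ k / ‖ξ‖ ^ j * (C₀ ^ (j + 1) * (‖ξ‖ / C₁) ^ j) := by gcongr
    _ = ‖ξ‖ ^ k * (C₀ * (C₀ / C₁) ^ j) := by
        rw [div_pow, div_pow, pow_succ]
        field_simp
    _ ≤ ‖ξ‖ ^ k * (C₀ * (1 / 2) ^ j) := by
        have : C₀ / C₁ ≤ 1 / 2 := by
          rw [div_le_div_iff₀ hC1 (by norm_num)]; linarith
        gcongr

/-- Everything that the proof uses about the symbol: a holomorphic extension in x to a complex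
neighbourhood, with growth of order k in real ξ. The conic holomorphy in ξ plays no further part. -/
theorem IsHomogeneousAnalyticSymbol.exists_bounded_extension {n : ℕ} {k : ℝ} {V : Set (RSp n)}
    {b : RSp n → RSp n → ℂ} (hb : IsHomogeneousAnalyticSymbol k V b) :
    ∃ (Ω : Set (CSp n)) (B : CSp n → RSp n → ℂ) (Cb : ℝ), IsOpen Ω ∧ (∀ x ∈ V, complexify x ∈ Ω) ∧
      (∀ x ∈ V, ∀ ξ, B (complexify x) ξ = b x ξ) ∧
      (∀ ξ, DifferentiableOn ℂ (fun z => B z ξ) Ω) ∧ (∀ z ∈ Ω, Measurable (B z)) ∧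
      0 < Cb ∧ ∀ z ∈ Ω, ∀ ξ, ‖B z ξ‖ ≤ Cb * (1 + ‖ξ‖) ^ k := by
  obtain ⟨Ω, Λ, a, B, hΩ, hVΩ, -, hΛ, -, -, hhom, ⟨C₀, hC₀, haC⟩, hBb, hBd, hBm, ⟨C₃, hC₃⟩,
    ⟨C₄, hC₄, hC₁⟩⟩ := hb
  -- C₄ makes the approximation available, 2C₀ gives the ratio 1/2 of the geometric series.
  obtain ⟨C₂, hC₂, happ⟩ := hC₁ (max C₄ (2 * C₀)) (le_max_left _ _)
  set C₁ := max C₄ (2 * C₀)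
  have hC1 : 2 * C₀ ≤ C₁ := le_max_right _ _
  have hC1pos : 0 < C₁ := by linarith
  obtain ⟨c, hc, hexp⟩ := exp_neg_div_le_mul_rpow hC₂ k
  refine ⟨Ω, B, (|C₃| + 2 * C₀) * 2 ^ |k| + C₂ * c, hΩ, hVΩ, hBb, hBd, hBm, by positivity,
    fun z hz ξ => ?_⟩
  rcases le_total ‖ξ‖ 1 with h1 | h1
  · have h2 := one_le_mul_one_add_rpow (norm_nonneg ξ) h1 k
    have h3 : 0 < (1 + ‖ξ‖) ^ k := by positivity
    calc ‖B z ξ‖ ≤ |C₃| * 1 := by rw [mul_one]; exact (hC₃ z hz ξ h1).trans (le_abs_self _)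
      _ ≤ |C₃| * (2 ^ |k| * (1 + ‖ξ‖) ^ k) := by gcongr
      _ ≤ |C₃| * (2 ^ |k| * (1 + ‖ξ‖) ^ k) + 2 * C₀ * 2 ^ |k| * (1 + ‖ξ‖) ^ k +
          C₂ * c * (1 + ‖ξ‖) ^ k := by
          have : 0 ≤ 2 * C₀ * 2 ^ |k| * (1 + ‖ξ‖) ^ k := by positivity
          have : 0 ≤ C₂ * c * (1 + ‖ξ‖) ^ k := by positivity
          linarith
      _ = _ := by ring
  · have hsum : ‖∑ j ∈ Finset.range (⌊‖ξ‖ / C₁⌋₊ + 1), a j z (complexify ξ)‖ ≤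
        ‖ξ‖ ^ k * (C₀ * 2) := by
      refine (norm_sum_le _ _).trans ?_
      calc ∑ j ∈ Finset.range (⌊‖ξ‖ / C₁⌋₊ + 1), ‖a j z (complexify ξ)‖
          ≤ ∑ j ∈ Finset.range (⌊‖ξ‖ / C₁⌋₊ + 1), ‖ξ‖ ^ k * (C₀ * (1 / 2) ^ j) := by
            refine Finset.sum_le_sum fun j hj => ?_
            have hj' : (j : ℝ) ≤ ‖ξ‖ / C₁ := (Nat.le_floor_iff (by positivity)).1
              (Nat.lt_succ_iff.1 (Finset.mem_range.1 hj))
            exact norm_homogeneous_le hΛ (hhom j z hz) hC₀ (haC j z hz) hC1 h1 hj'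
        _ = ‖ξ‖ ^ k * (C₀ * ∑ j ∈ Finset.range (⌊‖ξ‖ / C₁⌋₊ + 1), (1 / 2 : ℝ) ^ j) := by
            rw [Finset.mul_sum, Finset.mul_sum]
        _ ≤ ‖ξ‖ ^ k * (C₀ * 2) := by
            gcongr
            exact sum_geometric_two_le _
    have h2 := happ z hz ξ h1
    have h3 := rpow_le_mul_one_add_rpow h1 k
    have h4 := hexp ‖ξ‖ (norm_nonneg _)
    have h5 : ‖B z ξ‖ ≤ C₂ * Real.exp (-‖ξ‖ / C₂) + ‖ξ‖ ^ k * (C₀ * 2) := by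
      have := norm_add_le (B z ξ - ∑ j ∈ Finset.range (⌊‖ξ‖ / C₁⌋₊ + 1), a j z (complexify ξ))
        (∑ j ∈ Finset.range (⌊‖ξ‖ / C₁⌋₊ + 1), a j z (complexify ξ))
      rw [sub_add_cancel] at this
      linarith
    have h6 : 0 < (1 + ‖ξ‖) ^ k := by positivity
    calc ‖B z ξ‖ ≤ C₂ * (c * (1 + ‖ξ‖) ^ k) + 2 ^ |k| * (1 + ‖ξ‖) ^ k * (C₀ * 2) := by
          refine h5.trans ?_
          gcongr
      _ ≤ C₂ * (c * (1 + ‖ξ‖) ^ k) + 2 ^ |k| * (1 + ‖ξ‖) ^ k * (C₀ * 2) +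
          |C₃| * (2 ^ |k| * (1 + ‖ξ‖) ^ k) := by
          have : 0 ≤ |C₃| * (2 ^ |k| * (1 + ‖ξ‖) ^ k) := by positivity
          linarith
      _ = _ := by ring

/-! ### The oscillatory integral as an integral of holomorphic functions -/

/-- The integrand of the action of a pseudodifferential operator, with holomorphic dependence on
the base point. -/
noncomputable def oscIntegrand {n : ℕ} (B : CSp n → RSp n → ℂ) (F : RSp n → ℂ) (z : CSp n)
    (η : RSp n) : ℂ :=
  B z ((2 * Real.pi) • η) *
    Complex.exp (2 * Real.pi * Complex.I * inner ℂ (complexify η) z) * F η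

/-- The real point x contributes a factor of modulus 1, so only the displacement z - x can make the
exponential grow. -/
theorem norm_exp_inner_le {n : ℕ} (x η : RSp n) (z : CSp n) :
    ‖Complex.exp (2 * Real.pi * Complex.I * inner ℂ (complexify η) z)‖ ≤
      Real.exp (2 * Real.pi * ‖η‖ * ‖z - complexify x‖) := by
  have h1 : inner ℂ (complexify η) z = inner ℂ (complexify η) (z - complexify x) +
      ((inner ℝ x η : ℝ) : ℂ) := by
    rw [inner_sub_right, inner_complexify]; ring
  rw [h1, Complex.norm_exp]
  gcongr
  have h2 : (2 * Real.pi * Complex.I * (inner ℂ (complexify η) (z - complexify x) +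
      ((inner ℝ x η : ℝ) : ℂ))).re =
      (2 * Real.pi * Complex.I * inner ℂ (complexify η) (z - complexify x)).re := by
    rw [mul_add, Complex.add_re]
    simp
  rw [h2]
  refine (Complex.re_le_norm _).trans ?_
  have h3 : ‖inner ℂ (complexify η) (z - complexify x)‖ ≤ ‖η‖ * ‖z - complexify x‖ := by
    rw [← norm_complexify η]
    exact norm_inner_le_norm _ _
  simp only [norm_mul, Complex.norm_real, Complex.norm_ofNat, Complex.norm_I, Real.norm_eq_abs,
      abs_of_pos Real.pi_pos, mul_one]
  have := Real.pi_pos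
  rw [mul_assoc (2 * Real.pi)]
  gcongr

theorem differentiableOn_oscIntegrand {n : ℕ} {B : CSp n → RSp n → ℂ} {Ω : Set (CSp n)}
    (hBd : ∀ ξ, DifferentiableOn ℂ (fun z => B z ξ) Ω) (F : RSp n → ℂ) (η : RSp n) :
    DifferentiableOn ℂ (fun z => oscIntegrand B F z η) Ω := by
  have h1 : Differentiable ℂ fun z : CSp n => inner ℂ (complexify η) z :=
    (innerSL ℂ (complexify η)).differentiable
  exact ((hBd _).mul ((h1.const_mul _).cexp.differentiableOn)).mul_const _

theorem contDiffOn_oscIntegrand {n : ℕ} {B : CSp n → RSp n → ℂ} {Ω : Set (CSp n)} (hΩ : IsOpen Ω)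
    (hBd : ∀ ξ, DifferentiableOn ℂ (fun z => B z ξ) Ω) {O : Set (RSp n)}
    (hO : ∀ x ∈ O, complexify x ∈ Ω) (F : RSp n → ℂ) (η : RSp n) :
    ContDiffOn ℝ ∞ (fun x => oscIntegrand B F (complexify x) η) O :=
  (((differentiableOn_oscIntegrand hBd F η).contDiffOn_of_complex hΩ).restrict_scalars ℝ).comp
    (complexifyL n).contDiff.contDiffOn hO

/-- Cauchy's estimate with step ρ = R/(m + 1 + 2π|η|). The total radius (m + 1)ρ is at most R, so
the symbol stays defined, and over it the exponential grows by at most e^{R(m+1)}; m derivatives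
cost (2/ρ)^m. -/
theorem norm_iteratedFDeriv_oscIntegrand_le {n : ℕ} {B : CSp n → RSp n → ℂ} {Ω : Set (CSp n)}
    (hBd : ∀ ξ, DifferentiableOn ℂ (fun z => B z ξ) Ω) {Cb k R : ℝ} (hCb : 0 < Cb)
    (hBb : ∀ z ∈ Ω, ∀ ξ, ‖B z ξ‖ ≤ Cb * (1 + ‖ξ‖) ^ k) (hR : 0 < R) {x : RSp n}
    (hx : Metric.ball (complexify x) R ⊆ Ω) (F : RSp n → ℂ) (η : RSp n) (m : ℕ) :
    ‖iteratedFDeriv ℝ m (fun y => oscIntegrand B F (complexify y) η) x‖ ≤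
      Cb * Real.exp R ^ (m + 1) * (2 / R) ^ m *
        (((m + 1 : ℕ) + 2 * Real.pi * ‖η‖) ^ m * (1 + 2 * Real.pi * ‖η‖) ^ k * ‖F η‖) := by
  have hpi := Real.pi_pos
  set a := 2 * Real.pi * ‖η‖ with ha
  have ha0 : 0 ≤ a := by positivity
  set ρ := R / (m + 1 + a) with hρ
  have hρ0 : 0 < ρ := by positivity
  have hsub : Metric.ball (complexify x) ((m + 1) * ρ) ⊆ Metric.ball (complexify x) R := by
    apply Metric.ball_subset_ball
    rw [hρ, mul_div_assoc', div_le_iff₀ (by positivity)]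
    nlinarith
  have hξ : ‖(2 * Real.pi) • η‖ = a := by
    rw [norm_smul, Real.norm_eq_abs, abs_of_pos (by positivity)]
  have h1 := norm_iteratedFDeriv_comp_real_le (complexifyL n) (norm_complexifyL_le n) hρ0 x m ℂ
    (fun z => oscIntegrand B F z η) (Cb * (1 + a) ^ k * Real.exp R ^ (m + 1) * ‖F η‖)
    ((differentiableOn_oscIntegrand hBd F η).mono (hsub.trans hx)) (fun z hz => by
      rw [oscIntegrand, norm_mul, norm_mul]
      gcongr
      · have := hBb z (hx (hsub hz)) ((2 * Real.pi) • η)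
        rwa [hξ] at this
      · refine (norm_exp_inner_le x η z).trans ?_
        rw [← Real.exp_nat_mul]
        refine Real.exp_le_exp.2 ?_
        have h2 : ‖z - complexify x‖ ≤ (m + 1) * ρ := by
          rw [← mem_closedBall_iff_norm]
          exact Metric.ball_subset_closedBall hz
        calc a * ‖z - complexify x‖ ≤ a * ((m + 1) * ρ) := by gcongr
          _ = (m + 1) * R * (a / (m + 1 + a)) := by rw [hρ]; ring
          _ ≤ (m + 1) * R * 1 := by
              gcongr
              rw [div_le_one (by positivity)]
              linarith
          _ = ((m + 1 : ℕ) : ℝ) * R := by push_cast; ring)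
  refine h1.trans (le_of_eq ?_)
  have h3 : 2 / ρ = 2 / R * (m + 1 + a) := by rw [hρ]; field_simp
  rw [h3, mul_pow (2 / R)]
  push_cast
  ring

open FourierTransform in
theorem aestronglyMeasurable_oscIntegrand {n : ℕ} {B : CSp n → RSp n → ℂ} {z : CSp n}
    (hBm : Measurable (B z)) {F : RSp n → ℂ} (hF : Continuous F) :
    AEStronglyMeasurable (oscIntegrand B F z) := by
  have h1 : Measurable fun η : RSp n => B z ((2 * Real.pi) • η) :=
    hBm.comp (measurable_const_smul _)
  have h2 : Continuous fun η : RSp n => complexify η := (complexifyL n).continuous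
  have h3 : Continuous fun η : RSp n =>
      Complex.exp (2 * Real.pi * Complex.I * inner ℂ (complexify η) z) := by fun_prop
  exact (h1.aestronglyMeasurable.mul h3.aestronglyMeasurable).mul hF.aestronglyMeasurable

open FourierTransform in
-- Where χ = 1 on the support of f, the inner integral is a Fourier transform. The substitution ξ =
-- 2πη passes to the normalisation of `𝓕` and absorbs (2π)^(-n).
theorem oscillatoryAction_eq_integral {n : ℕ} {B : CSp n → RSp n → ℂ} {V : Set (RSp n)}
    {b : RSp n → RSp n → ℂ} {χ : ℝ → ℝ} {x : RSp n} {f : RSp n → ℂ}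
    (hBb : ∀ ξ, B (complexify x) ξ = b x ξ) (hfV : ∀ y, y ∉ V → f y = 0)
    (hχ : ∀ y, f y ≠ 0 → χ ‖x - y‖ = 1) :
    oscillatoryAction b χ V f x = ∫ η, oscIntegrand B (𝓕 f) (complexify x) η := by
  have hpi := Real.pi_pos
  have hin : ∀ ξ : RSp n, ∫ y in V, Complex.exp (Complex.I * ((inner ℝ (x - y) ξ : ℝ) : ℂ)) *
        ((χ ‖x - y‖ : ℝ) : ℂ) * f y =
      Complex.exp (Complex.I * ((inner ℝ x ξ : ℝ) : ℂ)) * 𝓕 f ((2 * Real.pi)⁻¹ • ξ) := by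
    intro ξ
    rw [setIntegral_eq_integral_of_forall_compl_eq_zero fun y hy => by rw [hfV y hy, mul_zero],
      Real.fourier_eq', ← integral_const_mul]
    congr 1
    funext y
    by_cases hy : f y = 0
    · simp [hy]
    rw [hχ y hy, smul_eq_mul, ← mul_assoc, ← Complex.exp_add, Complex.ofReal_one, mul_one]
    congr 2
    rw [inner_sub_left, inner_smul_right]
    push_cast
    field_simp
    ring
  simp_rw [oscillatoryAction, hin]
  set G : RSp n → ℂ := fun ξ => b x ξ * (Complex.exp (Complex.I * ((inner ℝ x ξ : ℝ) : ℂ)) *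
    𝓕 f ((2 * Real.pi)⁻¹ • ξ)) with hG
  have h1 := Measure.integral_comp_smul (volume : Measure (RSp n)) G (2 * Real.pi)
  rw [finrank_euclideanSpace_fin, abs_of_pos (by positivity)] at h1
  have h2 : ∀ η, oscIntegrand B (𝓕 f) (complexify x) η = G ((2 * Real.pi) • η) := by
    intro η
    rw [oscIntegrand, hG, hBb, inner_complexify]
    simp only [smul_smul, inv_mul_cancel₀ (by positivity : 2 * Real.pi ≠ 0), one_smul,
      inner_smul_right]
    push_cast
    rw [mul_assoc]
    congr 3
    ring
  simp_rw [h2]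
  rw [h1, Complex.real_smul]
  push_cast
  rfl

open FourierTransform LineDeriv in
-- The central estimate, with the cutoff chosen after m: Cauchy's estimate for the integrand meets
-- the weighted Fourier bound for the cut function. E is uniform in m, θ, f, D and lam. The separate
-- hypothesis for n = 0 replaces the line estimates, which are empty there.
theorem exists_oscIntegrand_estimate {n : ℕ} {k : ℝ} (hk : -(n : ℝ) ≤ k) {Ω : Set (CSp n)}
    {B : CSp n → RSp n → ℂ} {Cb R r K C : ℝ} {c : RSp n} (hΩ : IsOpen Ω)
    (hBd : ∀ ξ, DifferentiableOn ℂ (fun z => B z ξ) Ω) (hBm : ∀ z ∈ Ω, Measurable (B z))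
    (hCb : 0 < Cb) (hBb : ∀ z ∈ Ω, ∀ ξ, ‖B z ξ‖ ≤ Cb * (1 + ‖ξ‖) ^ k) (hR : 0 < R) (hr : 0 < r)
    (hball : ∀ x ∈ openCube c r, Metric.ball (complexify x) R ⊆ Ω) (hK : 0 < K) (hC : 0 < C) :
    ∃ E : ℝ, 0 < E ∧ ∀ (m : ℕ) (θ : ℝ → ℝ) (f : RSp n → ℂ) (O : Set (RSp n)) (D lam : ℝ),
      IsOpen O → ContDiffOn ℝ ∞ f O → closedCube c (3 * r) ⊆ O → 0 ≤ D → 0 ≤ lam →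
      ContDiff ℝ ∞ θ → (∀ t, 0 ≤ θ t ∧ θ t ≤ 1) → (∀ t, 3 * r ≤ |t| → θ t = 0) →
      (∀ q ≤ m + ⌈k + n⌉₊, ∀ t,
        |iteratedDeriv q θ t| ≤ (K * ((m + ⌈k + n⌉₊ : ℕ) : ℝ)) ^ q) →
      (∀ (j : Fin n) (q : ℕ), ∀ y ∈ O,
        ‖iteratedDeriv q (fun s : ℝ => f (y + s • EuclideanSpace.single j (1 : ℝ))) 0‖ ≤
          D * (C * (q + lam)) ^ q) → (n = 0 → ∀ y ∈ O, ‖f y‖ ≤ D) →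
      ContDiffOn ℝ ∞ (fun x => ∫ η, oscIntegrand B (𝓕 (cutProd θ c f)) (complexify x) η)
        (openCube c r) ∧
      ∀ x ∈ openCube c r,
        ‖iteratedFDeriv ℝ m
          (fun x => ∫ η, oscIntegrand B (𝓕 (cutProd θ c f)) (complexify x) η) x‖ ≤
          D * E ^ (m + 1) * (1 + (m + ⌈k + n⌉₊ : ℕ) + lam) ^ ((m : ℝ) + k + n) := by
  have hpi := Real.pi_pos
  set q₀ := ⌈k + n⌉₊ with hq₀
  have hcomp : IsCompact (closedCube c (3 * r)) := isCompact_closedCube c (by positivity)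
  -- The Leibniz bound KN + C(N + lam) is at most (K + C + 1)L for L = 1 + N + lam.
  obtain ⟨w, hw, hW⟩ := integral_weighted_fourier_le n (κ := K + C + 1)
    (Vol := (volume (closedCube c (3 * r))).toReal) (by linarith) ENNReal.toReal_nonneg
  set w' := max w 1 with hw'
  have hw'1 : 1 ≤ w' := le_max_right _ _
  -- The power q₀ + 1 turns w^(N+1) into an (m+1)-st power, as N + 1 ≤ (q₀ + 1)(m + 1); the maxima
  -- with 1 make the powers monotone.
  refine ⟨(Cb + 1) * Real.exp R * max (2 / R) 1 * w' ^ (q₀ + 1), by positivity, ?_⟩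
  intro m θ f O D lam hO hf hcO hD hlam hθ h01 h0 hθK hfb hf0
  set N := m + q₀ with hN
  set L : ℝ := 1 + (N : ℕ) + lam with hL
  have hL1 : 1 ≤ L := by
    have : (0 : ℝ) ≤ (N : ℕ) := Nat.cast_nonneg _
    linarith
  have hsm := contDiff_cutProd hO hf hθ h0 hcO
  have hcs : HasCompactSupport (cutProd θ c f) :=
    hcomp.of_isClosed_subset (isClosed_tsupport _) (tsupport_cutProd_subset h0)
  let S : SchwartzMap (RSp n) ℂ := hcs.toSchwartzMap hsm
  have hSf : 𝓕 (cutProd θ c f) = ((𝓕 S : SchwartzMap (RSp n) ℂ) : RSp n → ℂ) := rfl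
  have hline : ∀ (j : Fin n) (q : ℕ) (x : RSp n),
      ((lineDerivOp (EuclideanSpace.single j (1 : ℝ)) :
        SchwartzMap (RSp n) ℂ → SchwartzMap (RSp n) ℂ)^[q] S) x =
      iteratedDeriv q (fun s : ℝ => cutProd θ c f (x + s • EuclideanSpace.single j (1 : ℝ))) 0 := by
    intro j q x
    have := S.lineDerivOp_iterate_line (EuclideanSpace.single j (1 : ℝ)) x q 0
    rwa [zero_smul, add_zero] at this
  have hfD : ∀ y ∈ O, ‖f y‖ ≤ D := by
    rcases Nat.eq_zero_or_pos n with h | h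
    · exact hf0 h
    · intro y hy
      simpa using hfb ⟨0, h⟩ 0 y hy
  have hSD : ∀ x, ‖S x‖ ≤ D := by
    intro x
    change ‖cutProd θ c f x‖ ≤ D
    by_cases hx : x ∈ O
    · exact (norm_cutProd_le c f h01 x).trans (hfD x hx)
    · rw [cutProd_eq_zero h0 fun h => hx (hcO (openCube_subset_closedCube c le_rfl h)), norm_zero]
      exact hD
  have hexp0 : 0 ≤ k + n := by linarith
  have hmkn : (0 : ℝ) ≤ m + k + n := by
    have : (0 : ℝ) ≤ m := Nat.cast_nonneg m
    linarith
  have hLz := norm_iteratedDeriv_cutProd_le hO hf hθ h01 h0 hcO hK hD hC hlam hθK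
  have hwt := hW S (closedCube c (3 * r)) D L (m + k + n) N (isClosed_closedCube _ _).measurableSet
    (by rw [ENNReal.ofReal_toReal hcomp.measure_lt_top.ne]) hD hL1 hmkn
    (by
      have := Nat.le_ceil (k + n)
      rw [hN]; push_cast; linarith) hSD
    (fun x hx => by
      change cutProd θ c f x = 0
      exact cutProd_eq_zero h0 fun h => hx (openCube_subset_closedCube c le_rfl h))
    (fun j x => by
      rw [hline]
      refine ((hLz j (hfb j) le_rfl x).1).trans ?_
      gcongr
      have hN0 : (0 : ℝ) ≤ (N : ℕ) := Nat.cast_nonneg _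
      rw [hL]
      nlinarith [mul_nonneg hK.le hlam])
    (fun j x hx => by
      rw [hline]
      exact (hLz j (hfb j) le_rfl x).2 hx)
  have hxΩ : ∀ x ∈ openCube c r, complexify x ∈ Ω := fun x hx =>
    hball x hx (Metric.mem_ball_self hR)
  rw [hSf]
  set bd : ℕ → RSp n → ℝ := fun i η => Cb * Real.exp R ^ (i + 1) * (2 / R) ^ i *
        (((i + 1 : ℕ) + 2 * Real.pi * ‖η‖) ^ i * (1 + 2 * Real.pi * ‖η‖) ^ k * ‖𝓕 S η‖) with hbd
  have hfam := contDiffOn_integral_of_dominated (ν := volume) (isOpen_openCube c r)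
    (g := fun x η => oscIntegrand B (𝓕 S : SchwartzMap (RSp n) ℂ) (complexify x) η) (bd := bd)
    (fun x hx => aestronglyMeasurable_oscIntegrand (hBm _ (hxΩ x hx)) (𝓕 S).continuous)
    (Eventually.of_forall fun η => contDiffOn_oscIntegrand hΩ hBd hxΩ _ η)
    (fun i => Eventually.of_forall fun η x hx =>
      norm_iteratedFDeriv_oscIntegrand_le hBd hCb hBb hR (hball x hx) _ η i)
    (fun i => (integrable_weight_mul_fourier S (Nat.cast_nonneg _) i k).const_mul _)
  refine ⟨hfam.1, fun x hx => (hfam.2 m x hx).trans ?_⟩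
  have hint : ∫ η, ((m + 1 : ℕ) + 2 * Real.pi * ‖η‖) ^ m * (1 + 2 * Real.pi * ‖η‖) ^ k * ‖𝓕 S η‖ ≤
      w ^ (N + 1) * D * L ^ ((m : ℝ) + k + n) := by
    refine le_trans ?_ hwt
    refine integral_mono_of_nonneg (Eventually.of_forall fun η => by positivity) ?_
      (Eventually.of_forall fun η => ?_)
    · refine (integrable_weight_mul_fourier S (a := L) (by linarith) (m + q₀) 0).mono'
        (Continuous.aestronglyMeasurable ?_) (Eventually.of_forall fun η => ?_)
      · refine (Continuous.mul ?_ ?_).mul (𝓕 S).continuous.norm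
        · refine Continuous.rpow_const (by fun_prop) fun η => Or.inl ?_
          positivity
        · refine Continuous.inv₀ (by fun_prop) fun η => ?_
          exact (show (0 : ℝ) < (1 + 2 * Real.pi * ‖η‖) ^ n by positivity).ne'
      · rw [Real.norm_eq_abs, abs_of_nonneg (by positivity), Real.rpow_zero, mul_one]
        have h2 : ((1 + 2 * Real.pi * ‖η‖) ^ n)⁻¹ ≤ 1 := inv_le_one_of_one_le₀
          (one_le_pow₀ (by
            have : 0 ≤ 2 * Real.pi * ‖η‖ := by positivity
            linarith))
        have h3 : (L + 2 * Real.pi * ‖η‖) ^ ((m : ℝ) + k + n) ≤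
            (L + 2 * Real.pi * ‖η‖) ^ (m + q₀) := by
          rw [← Real.rpow_natCast]
          refine Real.rpow_le_rpow_of_exponent_le ?_ ?_
          · have : 0 ≤ 2 * Real.pi * ‖η‖ := by positivity
            linarith
          · have := Nat.le_ceil (k + n)
            push_cast; linarith
        have h4 : 0 ≤ (L + 2 * Real.pi * ‖η‖) ^ (m + q₀) := by positivity
        gcongr
        calc _ ≤ (L + 2 * Real.pi * ‖η‖) ^ (m + q₀) * 1 := by gcongr
          _ = _ := mul_one _
    · have ha : 0 ≤ 2 * Real.pi * ‖η‖ := by positivity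
      set a := 2 * Real.pi * ‖η‖
      have h1a : 0 < 1 + a := by linarith
      have hLa : 0 < L + a := by linarith
      change ((m + 1 : ℕ) + a) ^ m * (1 + a) ^ k * ‖𝓕 S η‖ ≤
        (L + a) ^ ((m : ℝ) + k + n) * ((1 + a) ^ n)⁻¹ * ‖𝓕 S η‖
      refine mul_le_mul_of_nonneg_right ?_ (norm_nonneg _)
      -- Here k ≥ -n enters: (1 + a)^(k+n) ≤ (L + a)^(k+n) needs a nonnegative exponent.
      have h5 : (1 + a) ^ k = (1 + a) ^ (k + n) * ((1 + a) ^ n)⁻¹ := by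
        rw [Real.rpow_add h1a, Real.rpow_natCast, mul_assoc, mul_inv_cancel₀ (by positivity),
          mul_one]
      have h6 : (L + a) ^ ((m : ℝ) + k + n) = (L + a) ^ m * (L + a) ^ (k + n) := by
        rw [add_assoc (m : ℝ), Real.rpow_add hLa, Real.rpow_natCast]
      rw [h5, h6, ← mul_assoc]
      have hmL : ((m + 1 : ℕ) : ℝ) ≤ L := by
        rw [hL, hN]
        push_cast
        have : (0 : ℝ) ≤ q₀ := Nat.cast_nonneg _
        linarith
      gcongr
  have hwN : w ^ (N + 1) ≤ (w' ^ (q₀ + 1)) ^ (m + 1) := by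
    calc w ^ (N + 1) ≤ w' ^ (N + 1) := by gcongr; exact le_max_left _ _
      _ ≤ w' ^ ((q₀ + 1) * (m + 1)) := by
          refine pow_le_pow_right₀ hw'1 ?_
          rw [hN]
          nlinarith
      _ = _ := pow_mul _ _ _
  have hLp : 0 ≤ L ^ ((m : ℝ) + k + n) := by positivity
  calc ∫ η, bd m η = Cb * Real.exp R ^ (m + 1) * (2 / R) ^ m *
        ∫ η, ((m + 1 : ℕ) + 2 * Real.pi * ‖η‖) ^ m * (1 + 2 * Real.pi * ‖η‖) ^ k * ‖𝓕 S η‖ :=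
        integral_const_mul _ _
    _ ≤ (Cb + 1) ^ (m + 1) * Real.exp R ^ (m + 1) * (max (2 / R) 1) ^ (m + 1) *
        ((w' ^ (q₀ + 1)) ^ (m + 1) * D * L ^ ((m : ℝ) + k + n)) := by
        have h7 : Cb ≤ (Cb + 1) ^ (m + 1) :=
          le_trans (by linarith) (le_self_pow₀ (by linarith : 1 ≤ Cb + 1) (by simp))
        have h8 : (2 / R) ^ m ≤ (max (2 / R) 1) ^ (m + 1) :=
          le_trans (pow_le_pow_left₀ (by positivity) (le_max_left _ _) _)
            (pow_le_pow_right₀ (le_max_right _ _) (by simp))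
        refine mul_le_mul (by gcongr) (hint.trans (by gcongr))
          (integral_nonneg fun η => by positivity) (by positivity)
    _ = _ := by
        simp only [mul_pow]
        ring

/-! ### Analytic charts: lifting functions, densities, kernels -/

open Classical in
/-- The extension by zero to the manifold of a function given in a chart. -/
noncomputable def chartLift {n : ℕ} {M : Type*} [TopologicalSpace M]
    (e : OpenPartialHomeomorph M (RSp n)) (f : RSp n → ℂ) : M → ℂ :=
  fun p => if p ∈ e.source then f (e p) else 0

section Chart

variable {n : ℕ} {M : Type*} [TopologicalSpace M]

theorem chartLift_symm {e : OpenPartialHomeomorph M (RSp n)} (f : RSp n → ℂ) {y : RSp n}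
    (hy : y ∈ e.target) : chartLift e f (e.symm y) = f y := by
  rw [chartLift, if_pos (e.map_target hy), e.right_inv hy]

theorem chartLift_of_mem {e : OpenPartialHomeomorph M (RSp n)} (f : RSp n → ℂ) {p : M}
    (hp : p ∈ e.source) : chartLift e f p = f (e p) := if_pos hp

theorem chartLift_eq_zero {e : OpenPartialHomeomorph M (RSp n)} {f : RSp n → ℂ}
    {K : Set (RSp n)} (hf : ∀ y ∉ K, f y = 0) {p : M} (hp : p ∉ e.symm '' K) :
    chartLift e f p = 0 := by
  by_cases h : p ∈ e.source
  · rw [chartLift_of_mem f h]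
    exact hf _ fun h' => hp ⟨e p, h', e.left_inv h⟩
  · exact if_neg h

theorem isCompact_symm_image {e : OpenPartialHomeomorph M (RSp n)} {K : Set (RSp n)}
    (hK : IsCompact K) (hKe : K ⊆ e.target) : IsCompact (e.symm '' K) :=
  hK.image_of_continuousOn (e.continuousOn_symm.mono hKe)

theorem tsupport_chartLift_subset [T2Space M] {e : OpenPartialHomeomorph M (RSp n)}
    {f : RSp n → ℂ} {K : Set (RSp n)} (hK : IsCompact K) (hKe : K ⊆ e.target)
    (hf : ∀ y ∉ K, f y = 0) : tsupport (chartLift e f) ⊆ e.symm '' K := by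
  refine closure_minimal (fun p hp => ?_) (isCompact_symm_image hK hKe).isClosed
  by_contra h
  exact hp (chartLift_eq_zero hf h)

variable [ChartedSpace (RSp n) M]

theorem contMDiff_chartLift [T2Space M] {e : OpenPartialHomeomorph M (RSp n)}
    (he : e ∈ IsManifold.maximalAtlas 𝓘(ℝ, RSp n) ω M) {f : RSp n → ℂ} {K : Set (RSp n)}
    (hK : IsCompact K) (hKe : K ⊆ e.target) (hf : ∀ y ∉ K, f y = 0) (hfs : ContDiff ℝ ∞ f) :
    ContMDiff 𝓘(ℝ, RSp n) 𝓘(ℝ, ℂ) ∞ (chartLift e f) := by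
  intro p
  by_cases hp : p ∈ e.source
  · have h1 : ContMDiffAt 𝓘(ℝ, RSp n) 𝓘(ℝ, RSp n) ∞ e p :=
      ((contMDiffOn_of_mem_maximalAtlas he).of_le le_top).contMDiffAt (e.open_source.mem_nhds hp)
    have h2 : ContMDiffAt 𝓘(ℝ, RSp n) 𝓘(ℝ, ℂ) ∞ (f ∘ e) p :=
      (hfs.contMDiff.contMDiffAt).comp p h1
    refine h2.congr_of_eventuallyEq ?_
    filter_upwards [e.open_source.mem_nhds hp] with q hq
    exact chartLift_of_mem f hq
  · have h3 : (e.symm '' K)ᶜ ∈ 𝓝 p := by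
      refine (isCompact_symm_image hK hKe).isClosed.isOpen_compl.mem_nhds ?_
      rintro ⟨y, hy, rfl⟩
      exact hp (e.map_target (hKe hy))
    refine (contMDiffAt_const (c := (0 : ℂ))).congr_of_eventuallyEq ?_
    filter_upwards [h3] with q hq
    exact chartLift_eq_zero hf hq

theorem contDiffOn_comp_symm {e : OpenPartialHomeomorph M (RSp n)}
    (he : e ∈ IsManifold.maximalAtlas 𝓘(ℝ, RSp n) ω M) {w : M → ℂ}
    (hw : ContMDiff 𝓘(ℝ, RSp n) 𝓘(ℝ, ℂ) ∞ w) : ContDiffOn ℝ ∞ (w ∘ e.symm) e.target := by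
  rw [← contMDiffOn_iff_contDiffOn]
  exact hw.comp_contMDiffOn ((contMDiffOn_symm_of_mem_maximalAtlas he).of_le le_top)

theorem analyticAt_kernel_of_ne {e c : OpenPartialHomeomorph M (RSp n)} [T2Space M]
    (he : e ∈ IsManifold.maximalAtlas 𝓘(ℝ, RSp n) ω M)
    (hc : c ∈ IsManifold.maximalAtlas 𝓘(ℝ, RSp n) ω M) {κ : M × M → ℂ}
    (hκ : ContMDiffOn (𝓘(ℝ, RSp n).prod 𝓘(ℝ, RSp n)) 𝓘(ℝ, ℂ) ω κ {p | p.1 ≠ p.2})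
    {q : RSp n × RSp n} (hq1 : q.1 ∈ e.target) (hq2 : q.2 ∈ c.target)
    (hq : e.symm q.1 ≠ c.symm q.2) :
    AnalyticAt ℝ (fun p : RSp n × RSp n => κ (e.symm p.1, c.symm p.2)) q := by
  set Ψ : RSp n × RSp n → M × M := fun p => (e.symm p.1, c.symm p.2) with hΨ
  have hΨd : ContMDiffOn 𝓘(ℝ, RSp n × RSp n) (𝓘(ℝ, RSp n).prod 𝓘(ℝ, RSp n)) ω Ψ
      (e.target ×ˢ c.target) := by
    refine ContMDiffOn.prodMk ?_ ?_
    · exact (contMDiffOn_symm_of_mem_maximalAtlas he).comp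
        contDiff_fst.contMDiff.contMDiffOn fun p hp => hp.1
    · exact (contMDiffOn_symm_of_mem_maximalAtlas hc).comp
        contDiff_snd.contMDiff.contMDiffOn fun p hp => hp.2
  have hopen : IsOpen {p : M × M | p.1 ≠ p.2} :=
    isOpen_ne_fun continuous_fst continuous_snd
  have ho : IsOpen (e.target ×ˢ c.target) := e.open_target.prod c.open_target
  have hO : IsOpen ((e.target ×ˢ c.target) ∩ Ψ ⁻¹' {p | p.1 ≠ p.2}) :=
    hΨd.continuousOn.isOpen_inter_preimage ho hopen
  have h1 : ContMDiffOn 𝓘(ℝ, RSp n × RSp n) 𝓘(ℝ, ℂ) ω (κ ∘ Ψ)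
      ((e.target ×ˢ c.target) ∩ Ψ ⁻¹' {p | p.1 ≠ p.2}) :=
    hκ.comp (hΨd.mono inter_subset_left) fun p hp => hp.2
  rw [contMDiffOn_iff_contDiffOn] at h1
  have h2 := h1.contDiffAt (hO.mem_nhds (x := q) ⟨⟨hq1, hq2⟩, hq⟩)
  exact h2.analyticAt

theorem continuousAt_kernel_of_ne [T2Space M] {κ : M × M → ℂ}
    (hκ : ContMDiffOn (𝓘(ℝ, RSp n).prod 𝓘(ℝ, RSp n)) 𝓘(ℝ, ℂ) ω κ {p | p.1 ≠ p.2})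
    {p : M × M} (hp : p.1 ≠ p.2) : ContinuousAt κ p :=
  hκ.continuousOn.continuousAt ((isOpen_ne_fun continuous_fst continuous_snd).mem_nhds hp)

theorem analyticAt_kernel_left [IsManifold 𝓘(ℝ, RSp n) ω M] [T2Space M]
    {e : OpenPartialHomeomorph M (RSp n)}
    (he : e ∈ IsManifold.maximalAtlas 𝓘(ℝ, RSp n) ω M) {κ : M × M → ℂ}
    (hκ : ContMDiffOn (𝓘(ℝ, RSp n).prod 𝓘(ℝ, RSp n)) 𝓘(ℝ, ℂ) ω κ {p | p.1 ≠ p.2})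
    {x : RSp n} {y : M} (hx : x ∈ e.target) (hxy : e.symm x ≠ y) :
    AnalyticAt ℝ (fun x => κ (e.symm x, y)) x := by
  have hy : y ∈ (chartAt (RSp n) y).source := mem_chart_source _ y
  have hl := (chartAt (RSp n) y).left_inv hy
  have h1 := analyticAt_kernel_of_ne he (IsManifold.chart_mem_maximalAtlas (n := ω) y) hκ
    (q := (x, chartAt (RSp n) y y)) hx ((chartAt (RSp n) y).map_source hy) (by
      change e.symm x ≠ _
      rwa [hl])
  have h2 : AnalyticAt ℝ (fun x : RSp n => (x, chartAt (RSp n) y y)) x :=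
    analyticAt_id.prod analyticAt_const
  have h3 := AnalyticAt.fun_comp (f := fun x : RSp n => (x, chartAt (RSp n) y y)) h1 h2
  simpa only [hl] using h3

/-- The second variable runs over the manifold, so joint analyticity is read in a chart about each
second component and the local bounds are patched by compactness. -/
theorem exists_norm_iteratedFDeriv_kernel_le [IsManifold 𝓘(ℝ, RSp n) ω M] [T2Space M]
    {e : OpenPartialHomeomorph M (RSp n)}
    (he : e ∈ IsManifold.maximalAtlas 𝓘(ℝ, RSp n) ω M) {κ : M × M → ℂ}
    (hκ : ContMDiffOn (𝓘(ℝ, RSp n).prod 𝓘(ℝ, RSp n)) 𝓘(ℝ, ℂ) ω κ {p | p.1 ≠ p.2})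
    {S : Set (RSp n × M)} (hS : IsCompact S) (hSe : ∀ q ∈ S, q.1 ∈ e.target ∧ e.symm q.1 ≠ q.2) :
    ∃ C : ℝ, 0 < C ∧ ∀ q ∈ S, ∀ m : ℕ,
      ‖iteratedFDeriv ℝ m (fun x => κ (e.symm x, q.2)) q.1‖ ≤ C ^ (m + 1) * m.factorial := by
  refine hS.induction_on (p := fun s => ∃ C : ℝ, 0 < C ∧ ∀ q ∈ s, ∀ m : ℕ,
      ‖iteratedFDeriv ℝ m (fun x => κ (e.symm x, q.2)) q.1‖ ≤ C ^ (m + 1) * m.factorial)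
    ⟨1, one_pos, by simp⟩ ?_ ?_ ?_
  · rintro s t hst ⟨C, hC, h⟩
    exact ⟨C, hC, fun q hq => h q (hst hq)⟩
  · rintro s t ⟨C, hC, h⟩ ⟨D, hD, h'⟩
    refine ⟨max C D, by positivity, ?_⟩
    rintro q (hq | hq) m
    · refine (h q hq m).trans ?_
      gcongr
      exact le_max_left _ _
    · refine (h' q hq m).trans ?_
      gcongr
      exact le_max_right _ _
  · intro q hq
    set c := chartAt (RSp n) q.2 with hcdef
    have hy : q.2 ∈ c.source := mem_chart_source _ q.2
    have h1 := analyticAt_kernel_of_ne he (IsManifold.chart_mem_maximalAtlas (n := ω) q.2) hκ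
      (q := (q.1, c q.2)) (hSe q hq).1 (c.map_source hy) (by
        change e.symm q.1 ≠ c.symm (c q.2)
        rw [c.left_inv hy]
        exact (hSe q hq).2)
    obtain ⟨C, hC, h⟩ := h1.eventually_norm_iteratedFDeriv_le
    have hcont : ContinuousAt (fun p : RSp n × M => (p.1, c p.2)) q :=
      continuousAt_fst.prodMk ((c.continuousAt hy).comp continuousAt_snd)
    have h2 := hcont.eventually (h.and h1.eventually_analyticAt)
    have h3 : ∀ᶠ p : RSp n × M in 𝓝 q, p.2 ∈ c.source :=
      continuousAt_snd.eventually (c.open_source.mem_nhds hy)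
    refine ⟨_, mem_nhdsWithin_of_mem_nhds (h2.and h3), C, hC, fun p hp m => ?_⟩
    obtain ⟨⟨hp1, hp2⟩, hp3⟩ := hp
    have h4 := (norm_iteratedFDeriv_slice_le m hp2.contDiffAt).trans (hp1 m)
    have h5 : c.symm (c p.2) = p.2 := c.left_inv hp3
    rw [← hcdef] at h4
    simpa only [h5] using h4

end Chart

section Density

variable {n : ℕ} {M : Type*} [TopologicalSpace M] [MeasurableSpace M] [BorelSpace M]

/-- Since `e.symm` is well behaved on the target only, merely almost everywhere measurability is
available, and the push-forward is handled in that form. -/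
theorem restrict_source_eq_map {μ : Measure M} {e : OpenPartialHomeomorph M (RSp n)}
    {ρ : RSp n → ℝ}
    (h : ∀ s : Set M, MeasurableSet s → s ⊆ e.source →
        μ s = ∫⁻ y in e.target ∩ e.symm ⁻¹' s, ENNReal.ofReal (ρ y)) :
    AEMeasurable e.symm ((volume.restrict e.target).withDensity fun y => ENNReal.ofReal (ρ y)) ∧
    μ.restrict e.source =
      ((volume.restrict e.target).withDensity fun y => ENNReal.ofReal (ρ y)).map e.symm := by
  have hmt : MeasurableSet e.target := e.open_target.measurableSet
  have ham : AEMeasurable e.symm (volume.restrict e.target) :=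
    e.continuousOn_symm.aemeasurable hmt
  have ham' : AEMeasurable e.symm
      ((volume.restrict e.target).withDensity fun y => ENNReal.ofReal (ρ y)) :=
    ham.mono_ac (withDensity_absolutelyContinuous _ _)
  refine ⟨ham', ?_⟩
  ext s hs
  have hset : e.target ∩ e.symm ⁻¹' (s ∩ e.source) = e.symm ⁻¹' s ∩ e.target := by
    ext y
    constructor
    · rintro ⟨h1, h2, -⟩
      exact ⟨h2, h1⟩
    · rintro ⟨h1, h2⟩
      exact ⟨h2, h1, e.map_target h2⟩
  rw [Measure.restrict_apply hs, h _ (hs.inter e.open_source.measurableSet) inter_subset_right,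
    Measure.map_apply_of_aemeasurable ham' hs, withDensity_apply',
    Measure.restrict_restrict₀ (ham.nullMeasurableSet_preimage hs), hset]

theorem integral_source_eq {μ : Measure M} {e : OpenPartialHomeomorph M (RSp n)}
    {ρ : RSp n → ℝ} (hρ : ContinuousOn ρ e.target) (hpos : ∀ y ∈ e.target, 0 < ρ y)
    (h : ∀ s : Set M, MeasurableSet s → s ⊆ e.source →
        μ s = ∫⁻ y in e.target ∩ e.symm ⁻¹' s, ENNReal.ofReal (ρ y))
    {f : M → ℂ} (hf : AEStronglyMeasurable f μ) :
    ∫ p in e.source, f p ∂μ = ∫ y in e.target, (ρ y : ℂ) * f (e.symm y) := by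
  obtain ⟨ham, hmap⟩ := restrict_source_eq_map h
  have hmt : MeasurableSet e.target := e.open_target.measurableSet
  have hρm : AEMeasurable (fun y => ENNReal.ofReal (ρ y)) (volume.restrict e.target) :=
    (hρ.aemeasurable hmt).ennreal_ofReal
  rw [hmap, integral_map ham (by rw [← hmap]; exact hf.restrict),
    integral_withDensity_eq_integral_toReal_smul₀ hρm (by simp)]
  refine setIntegral_congr_fun hmt fun y hy => ?_
  simp only [ENNReal.toReal_ofReal (hpos y hy).le, Complex.real_smul]

theorem lintegral_comp_symm_le {μ : Measure M} {e : OpenPartialHomeomorph M (RSp n)}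
    {ρ : RSp n → ℝ} (hρ : ContinuousOn ρ e.target)
    (h : ∀ s : Set M, MeasurableSet s → s ⊆ e.source →
        μ s = ∫⁻ y in e.target ∩ e.symm ⁻¹' s, ENNReal.ofReal (ρ y))
    {K : Set (RSp n)} (hKm : MeasurableSet K) (hK : K ⊆ e.target) {δ : ℝ}
    (hδ : ∀ y ∈ K, δ ≤ ρ y) {f : M → ℂ} (hf : AEStronglyMeasurable f μ) :
    ENNReal.ofReal δ * ∫⁻ y in K, ‖f (e.symm y)‖ₑ ≤ ∫⁻ p, ‖f p‖ₑ ∂μ := by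
  obtain ⟨ham, hmap⟩ := restrict_source_eq_map h
  have hmt : MeasurableSet e.target := e.open_target.measurableSet
  have hρm : AEMeasurable (fun y => ENNReal.ofReal (ρ y)) (volume.restrict e.target) :=
    (hρ.aemeasurable hmt).ennreal_ofReal
  have hfe : AEMeasurable (fun p => ‖f p‖ₑ) (μ.restrict e.source) := hf.restrict.enorm
  calc ENNReal.ofReal δ * ∫⁻ y in K, ‖f (e.symm y)‖ₑ
      ≤ ∫⁻ y in K, ENNReal.ofReal δ * ‖f (e.symm y)‖ₑ := lintegral_const_mul_le _ _
    _ ≤ ∫⁻ y in K, ENNReal.ofReal (ρ y) * ‖f (e.symm y)‖ₑ :=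
        setLIntegral_mono' hKm fun y hy => by
          gcongr
          exact hδ y hy
    _ ≤ ∫⁻ y in e.target, ENNReal.ofReal (ρ y) * ‖f (e.symm y)‖ₑ :=
        lintegral_mono_set hK
    _ = ∫⁻ y, ‖f (e.symm y)‖ₑ
          ∂((volume.restrict e.target).withDensity fun y => ENNReal.ofReal (ρ y)) := by
        rw [lintegral_withDensity_eq_lintegral_mul_non_measurable₀ _ hρm (by simp)]
        rfl
    _ = ∫⁻ p in e.source, ‖f p‖ₑ ∂μ := by
        rw [hmap] at hfe ⊢
        rw [lintegral_map' hfe ham]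
    _ ≤ ∫⁻ p, ‖f p‖ₑ ∂μ := setLIntegral_le_lintegral _ _

theorem IsAnalyticDensity.isFiniteMeasure [T2Space M] [CompactSpace M]
    [ChartedSpace (RSp n) M] [IsManifold 𝓘(ℝ, RSp n) ω M] {μ : Measure M} (hμ : IsAnalyticDensity n μ) :
    IsFiniteMeasure μ := by
  have hloc : IsLocallyFiniteMeasure μ := by
    refine ⟨fun p => ?_⟩
    set e := chartAt (RSp n) p with he
    obtain ⟨ρ, hρ, hpos, hs⟩ := hμ e (IsManifold.chart_mem_maximalAtlas (n := ω) p)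
    have hp : p ∈ e.source := mem_chart_source _ p
    obtain ⟨ε, hε, hball⟩ := Metric.nhds_basis_closedBall.mem_iff.1
      (e.open_target.mem_nhds (e.map_source hp))
    set K := Metric.closedBall (e p) ε
    have hK : IsCompact K := isCompact_closedBall _ _
    obtain ⟨C, hC⟩ := hK.exists_bound_of_continuousOn (hρ.continuousOn.mono hball)
    have hKc := isCompact_symm_image (e := e) hK hball
    have hsub : e.symm '' K ⊆ e.source := by
      rintro _ ⟨y, hy, rfl⟩
      exact e.map_target (hball hy)
    refine ⟨e.symm '' K, ?_, ?_⟩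
    · have h1 : e.source ∩ e ⁻¹' K ∈ 𝓝 p := inter_mem (e.open_source.mem_nhds hp)
        ((e.continuousAt hp).preimage_mem_nhds (Metric.closedBall_mem_nhds _ hε))
      refine mem_of_superset h1 fun q hq => ⟨e q, hq.2, e.left_inv hq.1⟩
    · rw [hs _ hKc.measurableSet hsub]
      calc ∫⁻ y in e.target ∩ e.symm ⁻¹' (e.symm '' K), ENNReal.ofReal (ρ y)
          ≤ ∫⁻ y in K, ENNReal.ofReal (ρ y) := by
            refine lintegral_mono_set ?_
            rintro y ⟨hy, z, hz, hzy⟩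
            have : z = y := by
              rw [← e.right_inv (hball hz), hzy, e.right_inv hy]
            exact this ▸ hz
        _ ≤ ∫⁻ _ in K, ENNReal.ofReal C :=
            setLIntegral_mono' hK.measurableSet fun y hy => by
              gcongr
              exact (le_abs_self _).trans (hC y hy)
        _ < ⊤ := by
            rw [setLIntegral_const]
            exact ENNReal.mul_lt_top ENNReal.ofReal_lt_top hK.measure_lt_top
  infer_instance

end Density

/-! ### Integral operators with analytic kernels -/

theorem contDiffOn_integral_kernel_mul {n : ℕ} {α : Type*} [MeasurableSpace α] {ν : Measure α}
    {O : Set (RSp n)} (hO : IsOpen O) {g : RSp n → α → ℂ} {f : α → ℂ} {C : ℝ}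
    (hm : ∀ x ∈ O, AEStronglyMeasurable (g x) ν)
    (hs : ∀ᵐ a ∂ν, ContDiffOn ℝ ∞ (fun x => g x a) O)
    (hb : ∀ᵐ a ∂ν, ∀ m : ℕ, ∀ x ∈ O,
      ‖iteratedFDeriv ℝ m (fun x => g x a) x‖ ≤ C ^ (m + 1) * m.factorial)
    (hf : Integrable f ν) :
    ContDiffOn ℝ ∞ (fun x => ∫ a, g x a * f a ∂ν) O ∧
      ∀ m : ℕ, ∀ x ∈ O, ‖iteratedFDeriv ℝ m (fun x => ∫ a, g x a * f a ∂ν) x‖ ≤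
        C ^ (m + 1) * m.factorial * ∫ a, ‖f a‖ ∂ν := by
  have h := contDiffOn_integral_of_dominated (ν := ν) hO (g := fun x a => g x a * f a)
    (bd := fun m a => C ^ (m + 1) * m.factorial * ‖f a‖)
    (fun x hx => (hm x hx).mul hf.aestronglyMeasurable)
    (hs.mono fun a ha => ha.mul contDiffOn_const)
    (fun m => by
      filter_upwards [hs, hb] with a ha hba x hx
      have h1 : (fun x => g x a * f a) = f a • fun x => g x a := by
        ext x; simp [mul_comm]
      rw [h1, iteratedFDeriv_const_smul_apply
        ((ha.contDiffAt (hO.mem_nhds hx)).of_le (by exact_mod_cast le_top)), norm_smul, mul_comm]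
      gcongr
      exact hba m x hx)
    (fun m => hf.norm.const_mul _)
  refine ⟨h.1, fun m x hx => (h.2 m x hx).trans_eq ?_⟩
  rw [integral_const_mul]

/-! ### Pairing of oscillatory integrals with test functions -/

open FourierTransform in
-- The constant is fixed before f and its scale w, so that the decay holds uniformly over a family
-- of functions indexed by a frequency.
theorem exists_norm_fourier_le_of_tsupport_subset {n : ℕ} {K : Set (RSp n)} (hK : IsCompact K)
    {A : ℕ → ℝ} (hA : ∀ i, 0 ≤ A i) (N : ℕ) :
    ∃ C : ℝ, 0 ≤ C ∧ ∀ (f : RSp n → ℂ) (w : ℝ), ContDiff ℝ ∞ f → tsupport f ⊆ K → 0 ≤ w →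
      (∀ i x, ‖iteratedFDeriv ℝ i f x‖ ≤ A i * w) →
      ∀ ξ, ‖𝓕 f ξ‖ ≤ C * w * (1 + ‖ξ‖) ^ (-(N : ℝ)) := by
  set S : ℕ → ℝ := fun N => 2 ^ N *
    ∑ p ∈ Finset.range 1 ×ˢ Finset.range (N + 1), A p.2 * (volume K).toReal with hS
  have hS0 : ∀ N, 0 ≤ S N := fun N => mul_nonneg (by positivity) (Finset.sum_nonneg fun p _ =>
    mul_nonneg (hA _) ENNReal.toReal_nonneg)
  refine ⟨2 ^ N * (S 0 + S N), mul_nonneg (by positivity) (add_nonneg (hS0 _) (hS0 _)),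
    fun f w hf hfK hw hfb ξ => ?_⟩
  have hsupp : ∀ i, tsupport (fun v => ‖iteratedFDeriv ℝ i f v‖) ⊆ K := fun i =>
    (tsupport_comp_subset norm_zero _).trans ((tsupport_iteratedFDeriv_subset i).trans hfK)
  have hcont : ∀ i, Continuous (fun v => ‖iteratedFDeriv ℝ i f v‖) := fun i =>
    (hf.continuous_iteratedFDeriv (by exact_mod_cast le_top)).norm
  have hint : ∀ i j : ℕ, Integrable (fun v : RSp n => ‖v‖ ^ i * ‖iteratedFDeriv ℝ j f v‖) := by
    intro i j
    refine Continuous.integrable_of_hasCompactSupport ((continuous_norm.pow i).mul (hcont j)) ?_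
    exact hK.of_isClosed_subset (isClosed_tsupport _)
      ((tsupport_mul_subset_right (f := fun v : RSp n => ‖v‖ ^ i)).trans (hsupp j))
  have hI : ∀ i, ∫ v, ‖iteratedFDeriv ℝ i f v‖ ≤ A i * (volume K).toReal * w := by
    intro i
    rw [← setIntegral_eq_integral_of_forall_compl_eq_zero (s := K) fun x hx => by
      by_contra h
      exact hx (hsupp i (subset_tsupport _ h))]
    calc ∫ v in K, ‖iteratedFDeriv ℝ i f v‖ ≤ ∫ _ in K, A i * w :=
          setIntegral_mono_on ((hcont i).continuousOn.integrableOn_compact hK)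
            (integrableOn_const hK.measure_lt_top.ne) hK.isClosed.measurableSet fun x _ => hfb i x
      _ = A i * (volume K).toReal * w := by
          rw [setIntegral_const, smul_eq_mul, Measure.real]; ring
  have hF : ∀ N : ℕ, ‖ξ‖ ^ N * ‖𝓕 f ξ‖ ≤ S N * w := by
    intro N
    have h := Real.pow_mul_norm_iteratedFDeriv_fourier_le (K := 0) (N := ⊤) (k := 0) (n := N)
      hf (fun i j _ _ => hint i j) (by simp) le_top ξ
    rw [norm_iteratedFDeriv_zero] at h
    refine h.trans ?_
    rw [hS]
    simp only [pow_zero, one_mul, Nat.cast_zero, mul_zero, zero_add]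
    rw [mul_assoc, Finset.sum_mul]
    gcongr with p hp
    have hp1 : p.1 = 0 := by
      have := (Finset.mem_product.1 hp).1
      simpa using this
    simpa [hp1] using hI p.2
  have h0 := hF 0
  have hN := hF N
  rw [pow_zero, one_mul] at h0
  have h2 := one_add_mul_pow_le (norm_nonneg ξ) N
  rw [Real.rpow_neg (by positivity), ← div_eq_mul_inv, le_div_iff₀ (by positivity),
    Real.rpow_natCast]
  calc ‖𝓕 f ξ‖ * (1 + ‖ξ‖) ^ N ≤ ‖𝓕 f ξ‖ * (2 ^ N * (1 + ‖ξ‖ ^ N)) := by gcongr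
    _ = 2 ^ N * (‖𝓕 f ξ‖ + ‖ξ‖ ^ N * ‖𝓕 f ξ‖) := by ring
    _ ≤ 2 ^ N * (S 0 * w + S N * w) := by gcongr
    _ = _ := by ring

open FourierTransform in
-- With ψ(x, η) = φ(x) B(x, 2πη), Fubini turns the pairing into the integral of 𝓕 f(η) times the
-- Fourier transform of ψ(·, η) at -η. The latter decays rapidly, with constants growing only like
-- the symbol, while |𝓕 f| is at most the L¹ norm of f. Hence the pairing is L¹-continuous in f for
-- every order k.
theorem exists_norm_integral_mul_oscIntegrand_le {n : ℕ} {k : ℝ} {Ω : Set (CSp n)}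
    {B : CSp n → RSp n → ℂ} {Cb R : ℝ} {O : Set (RSp n)} (hΩ : IsOpen Ω)
    (hBd : ∀ ξ, DifferentiableOn ℂ (fun z => B z ξ) Ω) (hBm : ∀ z ∈ Ω, Measurable (B z))
    (hCb : 0 < Cb) (hBb : ∀ z ∈ Ω, ∀ ξ, ‖B z ξ‖ ≤ Cb * (1 + ‖ξ‖) ^ k) (hR : 0 < R)
    (hO : IsOpen O) (hball : ∀ x ∈ O, Metric.ball (complexify x) R ⊆ Ω) {φ : RSp n → ℂ}
    (hφ : ContDiff ℝ ∞ φ) (hφc : HasCompactSupport φ) (hφO : tsupport φ ⊆ O) :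
    ∃ C : ℝ, 0 ≤ C ∧ ∀ f : RSp n → ℂ, ContDiff ℝ ∞ f → HasCompactSupport f →
      Integrable (fun x => φ x * ∫ η, oscIntegrand B (𝓕 f) (complexify x) η) ∧
      ‖∫ x, φ x * ∫ η, oscIntegrand B (𝓕 f) (complexify x) η‖ ≤ C * ∫ y, ‖f y‖ := by
  have hpi := Real.pi_pos
  have hxΩ : ∀ x ∈ O, complexify x ∈ Ω := fun x hx => hball x hx (Metric.mem_ball_self hR)
  set ψ : RSp n → RSp n → ℂ := fun x η => φ x * B (complexify x) ((2 * Real.pi) • η) with hψ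
  set w : RSp n → ℝ := fun η => (1 + 2 * Real.pi * ‖η‖) ^ k with hw
  have hw0 : ∀ η, 0 < w η := fun η => by positivity
  have hnorm : ∀ η : RSp n, ‖(2 * Real.pi) • η‖ = 2 * Real.pi * ‖η‖ := fun η => by
    rw [norm_smul, Real.norm_eq_abs, abs_of_pos (by positivity)]
  have hψs : ∀ η, ContDiff ℝ ∞ fun x => ψ x η := by
    intro η
    refine contDiff_iff_contDiffAt.2 fun x => ?_
    by_cases hx : x ∈ O
    · refine hφ.contDiffAt.mul ?_
      exact ((((hBd _).contDiffOn_of_complex hΩ).restrict_scalars ℝ).comp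
        (complexifyL n).contDiff.contDiffOn hxΩ).contDiffAt (hO.mem_nhds hx)
    · have h1 : (fun x => ψ x η) =ᶠ[𝓝 x] fun _ => 0 := by
        filter_upwards [notMem_tsupport_iff_eventuallyEq.1 fun h => hx (hφO h)] with y hy
        simp [hψ, hy]
      exact contDiffAt_const.congr_of_eventuallyEq h1
  have hψt : ∀ η, tsupport (fun x => ψ x η) ⊆ tsupport φ := fun η =>
    tsupport_mul_subset_left
  have hφb : ∀ i, ∃ C, ∀ x, ‖iteratedFDeriv ℝ i φ x‖ ≤ C := fun i =>
    (hφ.continuous_iteratedFDeriv (by exact_mod_cast le_top)).bounded_above_of_compact_support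
      (hφc.iteratedFDeriv i)
  choose Mφ hMφ using hφb
  have hMφ0 : ∀ i, 0 ≤ Mφ i := fun i => (norm_nonneg _).trans (hMφ i 0)
  -- Leibniz, with Cauchy step R/(i - j + 1) for the i - j derivatives of the symbol, so that the
  -- total radius is R.
  set A : ℕ → ℝ := fun i => ∑ j ∈ Finset.range (i + 1),
    (i.choose j : ℝ) * Mφ j * (Cb * (2 / (R / ((i - j : ℕ) + 1))) ^ (i - j)) with hA
  have hA0 : ∀ i, 0 ≤ A i := fun i => Finset.sum_nonneg fun j _ => by
    have := hMφ0 j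
    positivity
  have hψb : ∀ η i x, ‖iteratedFDeriv ℝ i (fun x => ψ x η) x‖ ≤ A i * w η := by
    intro η i x
    by_cases hx : x ∈ O
    · have h2 : ContDiffOn ℝ ∞ (fun x => B (complexify x) ((2 * Real.pi) • η)) O :=
        (((hBd _).contDiffOn_of_complex hΩ).restrict_scalars ℝ).comp
          (complexifyL n).contDiff.contDiffOn hxΩ
      have h3 := norm_iteratedFDerivWithin_mul_le (n := i) hφ.contDiffOn h2 hO.uniqueDiffOn hx
        (by exact_mod_cast le_top)
      simp only [iteratedFDerivWithin_of_isOpen _ hO hx] at h3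
      refine h3.trans ?_
      rw [hA, Finset.sum_mul]
      refine Finset.sum_le_sum fun j _ => ?_
      have h4 := norm_iteratedFDeriv_comp_real_le (complexifyL n) (norm_complexifyL_le n)
        (ρ := R / ((i - j : ℕ) + 1)) (by positivity) x (i - j) ℂ
        (fun z => B z ((2 * Real.pi) • η)) (Cb * w η)
        ((hBd _).mono (by
          rw [mul_div_cancel₀ _ (by positivity)]
          exact hball x hx)) (fun z hz => by
          rw [mul_div_cancel₀ _ (by positivity)] at hz
          have := hBb z (hball x hx hz) ((2 * Real.pi) • η)
          rwa [hnorm] at this)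
      have := hMφ j x
      have := hMφ0 j
      calc _ ≤ (i.choose j : ℝ) * Mφ j * (Cb * w η * (2 / (R / ((i - j : ℕ) + 1))) ^ (i - j)) := by
            gcongr
            exact h4
        _ = _ := by ring
    · have h1 : iteratedFDeriv ℝ i (fun x => ψ x η) x = 0 := image_eq_zero_of_notMem_tsupport
        fun h => hx (hφO (hψt η (tsupport_iteratedFDeriv_subset i h)))
      rw [h1, norm_zero]
      exact mul_nonneg (hA0 i) (hw0 η).le
  -- Enough decay to absorb the symbol growth and leave the integrable power -(n + 1).
  set N := ⌈|k|⌉₊ + n + 1 with hN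
  obtain ⟨C, hC, hfour⟩ := exists_norm_fourier_le_of_tsupport_subset hφc hA0 N
  -- A Carathéodory function, continuous in x and measurable in η, is jointly measurable, as Fubini
  -- requires.
  have hψm : Measurable (Function.uncurry ψ) := by
    have h1 : ∀ x, Measurable (ψ x) := by
      intro x
      by_cases hx : x ∈ O
      · exact ((hBm _ (hxΩ x hx)).comp (measurable_const_smul _)).const_mul _
      · have h2 : φ x = 0 := image_eq_zero_of_notMem_tsupport fun h => hx (hφO h)
        simp only [hψ, h2, zero_mul]
        exact measurable_const
    exact measurable_uncurry_of_continuous_of_measurable (fun η => (hψs η).continuous) h1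
  set J : ℝ := ∫ η : RSp n, C * (1 + 2 * Real.pi) ^ |k| * (1 + ‖η‖) ^ (-((n : ℝ) + 1)) with hJ
  have hJi : Integrable fun η : RSp n =>
      C * (1 + 2 * Real.pi) ^ |k| * (1 + ‖η‖) ^ (-((n : ℝ) + 1)) :=
    (integrable_one_add_norm (by rw [finrank_euclideanSpace_fin]; linarith)).const_mul _
  refine ⟨J, integral_nonneg fun η => by positivity, fun f hf hfc => ?_⟩
  set S : SchwartzMap (RSp n) ℂ := hfc.toSchwartzMap hf
  have hSf : 𝓕 f = ((𝓕 S : SchwartzMap (RSp n) ℂ) : RSp n → ℂ) := rfl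
  set E : RSp n → RSp n → ℂ := fun x η =>
    Complex.exp (2 * Real.pi * Complex.I * inner ℂ (complexify η) (complexify x)) with hE
  have hE1 : ∀ x η, E x η = Complex.exp (((2 * Real.pi * inner ℝ x η : ℝ) : ℂ) * Complex.I) := by
    intro x η
    rw [hE]
    simp only [inner_complexify]
    congr 1
    push_cast
    ring
  have hEn : ∀ x η, ‖E x η‖ = 1 := fun x η => by rw [hE1, Complex.norm_exp_ofReal_mul_I]
  set T : RSp n × RSp n → ℂ := fun p => ψ p.1 p.2 * E p.1 p.2 * 𝓕 f p.2 with hT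
  have hEc : Continuous fun p : RSp n × RSp n => E p.1 p.2 := by
    simp only [hE1]
    fun_prop
  have hTm : AEStronglyMeasurable T (volume.prod volume) := by
    refine (hψm.aestronglyMeasurable.mul hEc.aestronglyMeasurable).mul ?_
    rw [hSf]
    exact ((𝓕 S).continuous.comp continuous_snd).aestronglyMeasurable
  have hφi : Integrable φ := hφ.continuous.integrable_of_hasCompactSupport hφc
  have hTi : Integrable T (volume.prod volume) := by
    have h1 := integrable_weight_mul_fourier S (a := 1) zero_le_one 0 k
    have h2 : Integrable (fun p : RSp n × RSp n => ‖φ p.1‖ * (Cb * (w p.2 * ‖𝓕 f p.2‖)))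
        (volume.prod volume) := by
      have h3 : Integrable fun η => w η * ‖𝓕 f η‖ := by simpa [hw, hSf] using h1
      exact hφi.norm.mul_prod (h3.const_mul Cb)
    refine h2.mono' hTm (Eventually.of_forall fun p => ?_)
    rw [hT]
    simp only [norm_mul, hEn, mul_one, hψ]
    by_cases hp : p.1 ∈ O
    · have := hBb _ (hxΩ _ hp) ((2 * Real.pi) • p.2)
      rw [hnorm] at this
      rw [mul_assoc, ← mul_assoc Cb]
      gcongr
    · have h3 : φ p.1 = 0 := image_eq_zero_of_notMem_tsupport fun h => hp (hφO h)
      simp [h3]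
  have hin : ∀ x, φ x * ∫ η, oscIntegrand B (𝓕 f) (complexify x) η = ∫ η, T (x, η) := by
    intro x
    rw [← integral_const_mul]
    congr 1
    funext η
    simp only [hT, hψ, oscIntegrand, hE]
    ring
  refine ⟨by simpa only [hin] using hTi.integral_prod_left, ?_⟩
  have hswap : ∫ x, φ x * ∫ η, oscIntegrand B (𝓕 f) (complexify x) η =
      ∫ η, 𝓕 f η * 𝓕 (fun x => ψ x η) (-η) := by
    simp_rw [hin]
    rw [integral_integral_swap (f := fun x η => T (x, η)) hTi]
    congr 1
    funext η
    rw [Real.fourier_eq' (fun x => ψ x η), ← integral_const_mul]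
    congr 1
    funext x
    simp only [hT, hE1, inner_neg_right, smul_eq_mul]
    rw [show (-2 * Real.pi * -inner ℝ x η : ℝ) = 2 * Real.pi * inner ℝ x η by ring]
    ring
  rw [hswap]
  have hFb : ∀ η, ‖𝓕 f η‖ ≤ ∫ y, ‖f y‖ := fun η =>
    VectorFourier.norm_fourierIntegral_le_integral_norm Real.fourierChar volume (innerₗ (RSp n)) f η
  calc ‖∫ η, 𝓕 f η * 𝓕 (fun x => ψ x η) (-η)‖
      ≤ ∫ η : RSp n, C * (1 + 2 * Real.pi) ^ |k| * (1 + ‖η‖) ^ (-((n : ℝ) + 1)) *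
          ∫ y, ‖f y‖ := by
        refine norm_integral_le_of_norm_le (hJi.mul_const _) (Eventually.of_forall fun η => ?_)
        rw [norm_mul, mul_comm]
        have h1 := hfour (fun x => ψ x η) (w η) (hψs η) (hψt η) (hw0 η).le (hψb η) (-η)
        rw [norm_neg] at h1
        have h2 : w η ≤ (1 + 2 * Real.pi) ^ |k| * (1 + ‖η‖) ^ |k| := by
          have h3 : 0 ≤ 2 * Real.pi * ‖η‖ := by positivity
          calc w η ≤ (1 + 2 * Real.pi * ‖η‖) ^ |k| :=
                Real.rpow_le_rpow_of_exponent_le (by linarith) (le_abs_self k)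
            _ ≤ ((1 + 2 * Real.pi) * (1 + ‖η‖)) ^ |k| := by
                gcongr
                nlinarith [norm_nonneg η]
            _ = _ := Real.mul_rpow (by positivity) (by positivity)
        refine mul_le_mul (h1.trans ?_) (hFb η) (norm_nonneg _) (by positivity)
        have h4 : (1 + ‖η‖) ^ |k| * (1 + ‖η‖) ^ (-(N : ℝ)) ≤ (1 + ‖η‖) ^ (-((n : ℝ) + 1)) := by
          rw [← Real.rpow_add (by positivity)]
          refine Real.rpow_le_rpow_of_exponent_le (by linarith [norm_nonneg η]) ?_
          have := Nat.le_ceil |k|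
          rw [hN]; push_cast; linarith
        calc C * w η * (1 + ‖η‖) ^ (-(N : ℝ))
            ≤ C * ((1 + 2 * Real.pi) ^ |k| * (1 + ‖η‖) ^ |k|) * (1 + ‖η‖) ^ (-(N : ℝ)) := by
              gcongr
          _ = C * (1 + 2 * Real.pi) ^ |k| * ((1 + ‖η‖) ^ |k| * (1 + ‖η‖) ^ (-(N : ℝ))) := by ring
          _ ≤ _ := by gcongr
    _ = J * ∫ y, ‖f y‖ := by rw [integral_mul_const]

/-! ### Local structure of homogeneous analytic pseudodifferential operators -/

section LocalStructure

variable {n : ℕ} {M : Type*} [TopologicalSpace M] [ChartedSpace (RSp n) M] [MeasurableSpace M]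

open FourierTransform in
/-- In the cube with centre `c` and half side `r`, in the chart `e`, the operator `P` is the sum of
an oscillatory integral, whose symbol extends holomorphically to a complex neighbourhood of uniform
size, and of an operator with analytic kernel. -/
structure IsLocalRepresentation (k : ℝ) (P : smoothFunctions n M →ₗ[ℂ] smoothFunctions n M)
    (e : OpenPartialHomeomorph M (RSp n)) (c : RSp n) (r R₀ Cb : ℝ) (Ω : Set (CSp n))
    (B : CSp n → RSp n → ℂ) (R : RSp n × RSp n → ℂ) : Prop where
  r_pos : 0 < r
  radius_pos : 0 < R₀
  bound_pos : 0 < Cb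
  isOpen : IsOpen Ω
  differentiableOn : ∀ ξ, DifferentiableOn ℂ (fun z => B z ξ) Ω
  measurable : ∀ z ∈ Ω, Measurable (B z)
  norm_le : ∀ z ∈ Ω, ∀ ξ, ‖B z ξ‖ ≤ Cb * (1 + ‖ξ‖) ^ k
  ball_subset : ∀ x ∈ openCube c r, Metric.ball (complexify x) R₀ ⊆ Ω
  analytic : AnalyticOnNhd ℝ R (closedCube c (3 * r) ×ˢ closedCube c (3 * r))
  apply_eq : ∀ (f : RSp n → ℂ) (w : smoothFunctions n M), (∀ y ∉ closedCube c (3 * r), f y = 0) →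
    (w : M → ℂ) = chartLift e f → ∀ x ∈ openCube c r,
      (P w : M → ℂ) (e.symm x) = (∫ η, oscIntegrand B (𝓕 f) (complexify x) η) +
        ∫ y in closedCube c (3 * r), R (x, y) * f y

/-- The size r is fixed here, by P, the chart, x₀ and U alone, before any estimate on u; so the
neighbourhood W does not depend on the constants in the hypotheses on u. -/
theorem IsHomogeneousAnalyticPDO.exists_local_representation [T2Space M] {μ : Measure M} {k : ℝ}
    {P : smoothFunctions n M →ₗ[ℂ] smoothFunctions n M} (hP : IsHomogeneousAnalyticPDO μ k P)
    {e : OpenPartialHomeomorph M (RSp n)} (he : e ∈ IsManifold.maximalAtlas 𝓘(ℝ, RSp n) ω M)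
    {x₀ : M} {U : Set M} (hU : IsOpen U) (hx₀ : x₀ ∈ U) (hUe : U ⊆ e.source) :
    ∃ (r R₀ Cb : ℝ) (Ω : Set (CSp n)) (B : CSp n → RSp n → ℂ) (R : RSp n × RSp n → ℂ),
      closedCube (e x₀) (3 * r) ⊆ e '' U ∧ IsLocalRepresentation k P e (e x₀) r R₀ Cb Ω B R := by
  obtain ⟨V, b, χ, R, hV, hxV, hVe, hb, -, -, hχ1, hR, hrep⟩ :=
    hP.near_diagonal e he x₀ (hUe hx₀)
  obtain ⟨Ω, B, Cb, hΩ, hVΩ, hBb, hBd, hBm, hCb, hB⟩ := hb.exists_bounded_extension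
  set c := e x₀ with hc
  have hO : IsOpen (V ∩ e '' U) := hV.inter (e.isOpen_image_of_subset_source hU hUe)
  obtain ⟨ε₁, hε₁, h1⟩ := Metric.isOpen_iff.1 hO c ⟨hxV, mem_image_of_mem _ hx₀⟩
  obtain ⟨ε₂, hε₂, h2⟩ := Metric.eventually_nhds_iff.1 hχ1
  obtain ⟨ε₃, hε₃, h3⟩ := Metric.isOpen_iff.1 hΩ (complexify c) (hVΩ c hxV)
  set ε := min (min ε₁ ε₂) ε₃ with hε
  have hε0 : 0 < ε := by positivity
  have he1 : ε ≤ ε₁ := (min_le_left _ _).trans (min_le_left _ _)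
  have he2 : ε ≤ ε₂ := (min_le_left _ _).trans (min_le_right _ _)
  have he3 : ε ≤ ε₃ := min_le_right _ _
  set r := ε / (4 * (n + 1)) with hr
  have hr0 : 0 < r := by positivity
  -- Points of Q_r and Q_3r are at distance at most nr + 3nr, inside the region where χ = 1.
  have hnr : 4 * (n * r) < ε := by
    have : 4 * ((n + 1) * r) = ε := by rw [hr]; field_simp
    nlinarith
  have hnr0 : 0 ≤ n * r := by positivity
  have hcube : closedCube c (3 * r) ⊆ V ∩ e '' U := fun y hy => h1 <| by
    rw [Metric.mem_ball, dist_eq_norm]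
    have := norm_sub_le_of_mem_closedCube (by positivity) hy
    linarith
  have hsmall : ∀ x ∈ openCube c r, ‖x - c‖ ≤ n * r := fun x hx =>
    norm_sub_le_of_mem_closedCube hr0.le (openCube_subset_closedCube c le_rfl hx)
  have hcubes : openCube c r ⊆ closedCube c (3 * r) :=
    openCube_subset_closedCube c (by linarith)
  refine ⟨r, ε / 2, Cb, Ω, B, R, fun y hy => (hcube hy).2, hr0, by positivity, hCb, hΩ, hBd, hBm,
    hB, fun x hx z hz => h3 ?_, hR.mono (prod_mono (fun y hy => (hcube hy).1)
      fun y hy => (hcube hy).1), fun f w hf hw x hx => ?_⟩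
  · rw [Metric.mem_ball, dist_eq_norm] at hz ⊢
    have h4 : complexify x - complexify c = complexify (x - c) :=
      ((complexifyL n).map_sub x c).symm
    have h5 := norm_sub_le_norm_sub_add_norm_sub z (complexify x) (complexify c)
    rw [h4, norm_complexify] at h5
    have := hsmall x hx
    linarith
  · have hKe : closedCube c (3 * r) ⊆ e.target := fun y hy => hVe (hcube hy).1
    have hsupp : tsupport (w : M → ℂ) ⊆ e.source ∩ e ⁻¹' V := by
      rw [hw]
      refine (tsupport_chartLift_subset (isCompact_closedCube c (by positivity)) hKe hf).trans ?_
      rintro _ ⟨y, hy, rfl⟩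
      refine ⟨e.map_target (hKe hy), ?_⟩
      rw [mem_preimage, e.right_inv (hKe hy)]
      exact (hcube hy).1
    have hxV' : x ∈ V := (hcube (hcubes hx)).1
    have hwf : ∀ y ∈ V, (w : M → ℂ) (e.symm y) = f y := fun y hy => by
      rw [hw, chartLift_symm f (hVe hy)]
    have hfV : ∀ y ∉ V, f y = 0 := fun y hy => hf y fun h => hy (hcube h).1
    rw [hrep w hsupp x hxV']
    congr 1
    · rw [← oscillatoryAction_eq_integral (V := V) (b := b) (χ := χ) (hBb x hxV') hfV]
      · simp only [oscillatoryAction]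
        congr 2
        funext ξ
        congr 1
        refine setIntegral_congr_fun hV.measurableSet fun y hy => ?_
        simp only [hwf y hy]
      · intro y hy
        refine h2 ?_
        have hy' : y ∈ closedCube c (3 * r) := by
          by_contra h
          exact hy (hf y h)
        have h6 := norm_sub_le_of_mem_closedCube (by positivity) hy'
        have h7 := norm_sub_le_norm_sub_add_norm_sub x c y
        rw [norm_sub_rev c y] at h7
        have := hsmall x hx
        rw [dist_zero_right, norm_norm]
        linarith
    · rw [setIntegral_congr_fun hV.measurableSet (g := fun y => R (x, y) * f y)
        fun y hy => by simp only [hwf y hy],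
        setIntegral_eq_integral_of_forall_compl_eq_zero fun y hy => by rw [hfV y hy, mul_zero],
        setIntegral_eq_integral_of_forall_compl_eq_zero fun y hy => by rw [hf y hy, mul_zero]]

theorem integrable_kernel_mul [T2Space M] [CompactSpace M] [BorelSpace M] {μ : Measure M}
    {κ : M × M → ℂ}
    (hκ : ContMDiffOn (𝓘(ℝ, RSp n).prod 𝓘(ℝ, RSp n)) 𝓘(ℝ, ℂ) ω κ {p | p.1 ≠ p.2})
    {Z : Set M} (hZ : IsOpen Z) {p : M} (hp : p ∈ Z) {u : M → ℂ} (hu : Integrable u μ) :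
    IntegrableOn (fun y => κ (p, y) * u y) Zᶜ μ := by
  refine IntegrableOn.continuousOn_mul (fun y hy => ?_) hu.integrableOn hZ.isClosed_compl.isCompact
  have h1 : ContinuousAt (fun y => κ (p, y)) y :=
    (continuousAt_kernel_of_ne hκ (p := (p, y)) fun h => hy ((show p = y from h) ▸ hp)).comp
      (Continuous.prodMk_right p).continuousAt
  exact h1.continuousWithinAt

theorem integrable_smoothFunctions [CompactSpace M] [T2Space M] [BorelSpace M] {μ : Measure M}
    [IsFiniteMeasure μ] (w : smoothFunctions n M) : Integrable (w : M → ℂ) μ :=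
  w.2.continuous.integrable_of_hasCompactSupport (HasCompactSupport.of_compactSpace _)

/-- The off-diagonal contribution does not depend on how a function is cut off. -/
theorem apply_add_integral_kernel_eq [T2Space M] [CompactSpace M] [BorelSpace M] {μ : Measure M}
    [IsFiniteMeasure μ] {P : smoothFunctions n M →ₗ[ℂ] smoothFunctions n M} {κ : M × M → ℂ}
    (hκ : ContMDiffOn (𝓘(ℝ, RSp n).prod 𝓘(ℝ, RSp n)) 𝓘(ℝ, ℂ) ω κ {p | p.1 ≠ p.2})
    (hoff : ∀ (w : smoothFunctions n M) (x : M), x ∉ tsupport (w : M → ℂ) →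
      (P w : M → ℂ) x = ∫ y, κ (x, y) * (w : M → ℂ) y ∂μ)
    {Z : Set M} (hZ : IsOpen Z) {p : M} (hp : p ∈ Z) {w₁ w₂ : smoothFunctions n M}
    (h12 : ∀ q ∈ Z, (w₁ : M → ℂ) q = (w₂ : M → ℂ) q) {u : M → ℂ} (hu : Integrable u μ) :
    (P w₁ : M → ℂ) p + ∫ y in Zᶜ, κ (p, y) * (u y - (w₁ : M → ℂ) y) ∂μ =
      (P w₂ : M → ℂ) p + ∫ y in Zᶜ, κ (p, y) * (u y - (w₂ : M → ℂ) y) ∂μ := by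
  -- The difference vanishes on the open set Z containing p, so at p the operator acts on it through
  -- the off-diagonal kernel.
  have h0 : ∀ q ∈ Z, ((w₁ - w₂ : smoothFunctions n M) : M → ℂ) q = 0 := fun q hq => by
    rw [Submodule.coe_sub, Pi.sub_apply, h12 q hq, sub_self]
  have hp' : p ∉ tsupport ((w₁ - w₂ : smoothFunctions n M) : M → ℂ) := by
    rw [notMem_tsupport_iff_eventuallyEq]
    filter_upwards [hZ.mem_nhds hp] with q hq using h0 q hq
  have h1 := hoff (w₁ - w₂) p hp'
  rw [← setIntegral_eq_integral_of_forall_compl_eq_zero (s := Zᶜ) fun y hy => by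
    rw [h0 y (not_notMem.1 hy), mul_zero], map_sub, Submodule.coe_sub, Pi.sub_apply] at h1
  have hi : ∀ w : smoothFunctions n M, IntegrableOn (fun y => κ (p, y) * (u y - (w : M → ℂ) y))
      Zᶜ μ := fun w =>
    integrable_kernel_mul hκ hZ hp (hu.sub (integrable_smoothFunctions w))
  have h2 : ∫ y in Zᶜ, κ (p, y) * ((w₁ - w₂ : smoothFunctions n M) : M → ℂ) y ∂μ =
      (∫ y in Zᶜ, κ (p, y) * (u y - (w₂ : M → ℂ) y) ∂μ) -
        ∫ y in Zᶜ, κ (p, y) * (u y - (w₁ : M → ℂ) y) ∂μ := by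
    rw [← integral_sub (hi w₂) (hi w₁)]
    congr 1
    funext y
    rw [Submodule.coe_sub, Pi.sub_apply]
    ring
  rw [h2] at h1
  linear_combination h1

/-! ### The extension to square integrable functions -/

theorem integral_norm_le_of_eLpNorm_le [BorelSpace M] {μ : Measure M} [IsFiniteMeasure μ]
    {f : M → ℂ} (hf : AEStronglyMeasurable f μ) {A : ℝ} (hA : 0 ≤ A)
    (h : eLpNorm f 2 μ ≤ ENNReal.ofReal A) :
    ∫ x, ‖f x‖ ∂μ ≤ A * (μ univ).toReal ^ (1 / 2 : ℝ) := by
  rw [integral_norm_eq_lintegral_enorm hf, ← eLpNorm_one_eq_lintegral_enorm]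
  have h1 := eLpNorm_le_eLpNorm_mul_rpow_measure_univ (p := 1) (q := 2) (by norm_num) hf
  have h2 : (1 / (1 : ENNReal).toReal - 1 / (2 : ENNReal).toReal : ℝ) = 1 / 2 := by norm_num
  rw [h2] at h1
  have h3 : eLpNorm f 1 μ ≤ ENNReal.ofReal A * μ univ ^ (1 / 2 : ℝ) :=
    h1.trans (by gcongr)
  have h4 := ENNReal.toReal_mono (ENNReal.mul_ne_top ENNReal.ofReal_ne_top
    (ENNReal.rpow_ne_top_of_nonneg (by norm_num) (measure_ne_top μ _))) h3
  rwa [ENNReal.toReal_mul, ENNReal.toReal_ofReal hA, ← ENNReal.toReal_rpow] at h4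

/-- A criterion, in terms of `L¹` bounds of the pairings, for the extension by continuity of the
operator. -/
theorem equalsOn_of_norm_integral_le [BorelSpace M] [CompactSpace M] [T2Space M] {μ : Measure M}
    [IsFiniteMeasure μ] {P : smoothFunctions n M →ₗ[ℂ] smoothFunctions n M} {u v : M → ℂ}
    {W : Set M} (hu : AEStronglyMeasurable u μ)
    (h : ∀ φ : smoothFunctions n M, tsupport (φ : M → ℂ) ⊆ W → ∃ C : ℝ, 0 ≤ C ∧
      ∀ w : smoothFunctions n M,
        ‖(∫ x, (P w : M → ℂ) x * (φ : M → ℂ) x ∂μ) - ∫ x, v x * (φ : M → ℂ) x ∂μ‖ ≤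
          C * ∫ x, ‖(w : M → ℂ) x - u x‖ ∂μ) :
    EqualsOn μ P u W v := by
  intro φ hφ δ hδ
  obtain ⟨C, hC, hb⟩ := h φ hφ
  set m := (μ univ).toReal ^ (1 / 2 : ℝ)
  have hm : 0 ≤ m := by positivity
  -- On a finite measure space L¹ is bounded by m times L²; the summand 1 avoids division by zero
  -- and gives strictness.
  refine ⟨δ / (C * m + 1), by positivity, fun w hw => (hb w).trans_lt ?_⟩
  have h1 := integral_norm_le_of_eLpNorm_le
    ((integrable_smoothFunctions (μ := μ) w).aestronglyMeasurable.sub hu)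
    (by positivity : 0 ≤ δ / (C * m + 1)) hw.le
  calc C * ∫ x, ‖(w : M → ℂ) x - u x‖ ∂μ ≤ C * (δ / (C * m + 1) * m) := by
        gcongr
        exact h1
    _ = δ * (C * m / (C * m + 1)) := by ring
    _ < δ * 1 := by
        gcongr
        rw [div_lt_one (by positivity)]
        linarith
    _ = δ := mul_one δ

end LocalStructure

/-! ### Pairing with test functions on the manifold -/

section Pairing

variable {n : ℕ} {M : Type*} [TopologicalSpace M] [ChartedSpace (RSp n) M]

/-- A test function on the manifold supported in a chart, multiplied by the density, is a test
function in the chart. -/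
theorem exists_chart_testFunction [CompactSpace M] {e : OpenPartialHomeomorph M (RSp n)}
    (he : e ∈ IsManifold.maximalAtlas 𝓘(ℝ, RSp n) ω M) {ρ : RSp n → ℝ}
    (hρ : AnalyticOnNhd ℝ ρ e.target) {Q : Set (RSp n)} (hQ : Q ⊆ e.target)
    (φ : smoothFunctions n M) (hφ : tsupport (φ : M → ℂ) ⊆ e.symm '' Q) :
    ∃ ψ : RSp n → ℂ, ContDiff ℝ ∞ ψ ∧ HasCompactSupport ψ ∧ tsupport ψ ⊆ Q ∧
      (∀ y ∈ e.target, ψ y = ρ y * (φ : M → ℂ) (e.symm y)) ∧ ∀ y ∉ e.target, ψ y = 0 := by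
  classical
  have hsrc : tsupport (φ : M → ℂ) ⊆ e.source := fun p hp => by
    obtain ⟨y, hy, rfl⟩ := hφ hp
    exact e.map_target (hQ hy)
  set K := e '' tsupport (φ : M → ℂ) with hK
  have hKc : IsCompact K := (isClosed_tsupport _).isCompact.image_of_continuousOn
    (e.continuousOn.mono hsrc)
  have hKQ : K ⊆ Q := by
    rintro _ ⟨p, hp, rfl⟩
    obtain ⟨y, hy, rfl⟩ := hφ hp
    rwa [e.right_inv (hQ hy)]
  set ψ : RSp n → ℂ := fun y => if y ∈ e.target then ρ y * (φ : M → ℂ) (e.symm y) else 0 with hψ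
  have hψ0 : ∀ y ∉ K, ψ y = 0 := by
    intro y hy
    by_cases h : y ∈ e.target
    · have : (φ : M → ℂ) (e.symm y) = 0 := image_eq_zero_of_notMem_tsupport fun h' =>
        hy ⟨_, h', e.right_inv h⟩
      simp [hψ, this]
    · simp [hψ, h]
  have hts : tsupport ψ ⊆ K := closure_minimal (fun y hy => by
    by_contra h
    exact hy (hψ0 y h)) hKc.isClosed
  refine ⟨ψ, contDiff_iff_contDiffAt.2 fun y => ?_, hKc.of_isClosed_subset (isClosed_tsupport _) hts,
    hts.trans hKQ, fun y hy => if_pos hy, fun y hy => if_neg hy⟩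
  by_cases h : y ∈ e.target
  · have h1 : ContDiffAt ℝ ∞ (fun y => (ρ y : ℂ) * (φ : M → ℂ) (e.symm y)) y := by
      refine ContDiffAt.mul ?_
        ((contDiffOn_comp_symm he φ.2).contDiffAt (e.open_target.mem_nhds h))
      exact Complex.ofRealCLM.contDiff.contDiffAt.comp y (hρ y h).contDiffAt
    refine h1.congr_of_eventuallyEq ?_
    filter_upwards [e.open_target.mem_nhds h] with z hz using if_pos hz
  · refine (contDiffAt_const (c := (0 : ℂ))).congr_of_eventuallyEq ?_
    filter_upwards [hKc.isClosed.isOpen_compl.mem_nhds fun h' => h (hQ (hKQ h'))] with z hz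
    exact hψ0 z hz

theorem exists_norm_integral_kernel_le {c : RSp n} {s : ℝ} (hs : 0 ≤ s) {R : RSp n × RSp n → ℂ}
    (hR : AnalyticOnNhd ℝ R (closedCube c s ×ˢ closedCube c s)) :
    ∃ C : ℝ, 0 ≤ C ∧ ∀ f : RSp n → ℂ, Integrable f → ∀ x ∈ closedCube c s,
      ‖∫ y in closedCube c s, R (x, y) * f y‖ ≤ C * ∫ y, ‖f y‖ := by
  obtain ⟨C, hC⟩ := ((isCompact_closedCube c hs).prod
    (isCompact_closedCube c hs)).exists_bound_of_continuousOn hR.continuousOn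
  refine ⟨max C 0, le_max_right _ _, fun f hf x hx => ?_⟩
  rw [← integral_const_mul]
  refine (norm_integral_le_of_norm_le (g := fun y => max C 0 * ‖f y‖)
    (hf.norm.const_mul _).integrableOn ?_).trans ?_
  · filter_upwards [ae_restrict_mem (isClosed_closedCube c s).measurableSet] with y hy
    rw [norm_mul]
    gcongr
    exact (hC (x, y) ⟨hx, hy⟩).trans (le_max_left _ _)
  · exact setIntegral_le_integral (hf.norm.const_mul _)
      (Eventually.of_forall fun y => by
        have := le_max_right C 0
        positivity)

variable [MeasurableSpace M] [BorelSpace M] {μ : Measure M}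
  {e : OpenPartialHomeomorph M (RSp n)} {c : RSp n}

/-- On the compact cube the density has a positive minimum, whose inverse compares Lebesgue measure
with μ. -/
theorem exists_integral_norm_cutProd_le (hμ : IsAnalyticDensity n μ)
    (he : e ∈ IsManifold.maximalAtlas 𝓘(ℝ, RSp n) ω M) {s : ℝ} (hs : 0 < s)
    (hc : closedCube c s ⊆ e.target) :
    ∃ C : ℝ, 0 ≤ C ∧ ∀ (θ : ℝ → ℝ) (f : M → ℂ), (∀ t, 0 ≤ θ t ∧ θ t ≤ 1) →
      (∀ t, s ≤ |t| → θ t = 0) → Integrable f μ → Continuous (cutProd θ c (f ∘ e.symm)) →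
      ∫ y, ‖cutProd θ c (f ∘ e.symm) y‖ ≤ C * ∫ p, ‖f p‖ ∂μ := by
  obtain ⟨ρ, hρ, hpos, hint⟩ := hμ e he
  obtain ⟨y₀, hy₀, hmin⟩ := (isCompact_closedCube c hs.le).exists_isMinOn
    ⟨c, openCube_subset_closedCube c le_rfl (mem_openCube_self c hs)⟩
    (hρ.continuousOn.mono hc)
  have hδ : 0 < ρ y₀ := hpos _ (hc hy₀)
  refine ⟨(ρ y₀)⁻¹, by positivity, fun θ f h01 h0 hf hcont => ?_⟩
  rw [inv_mul_eq_div, le_div_iff₀ hδ, mul_comm,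
    integral_norm_eq_lintegral_enorm hcont.aestronglyMeasurable,
    integral_norm_eq_lintegral_enorm hf.aestronglyMeasurable]
  have h1 := lintegral_comp_symm_le hρ.continuousOn hint (isClosed_closedCube c s).measurableSet
    hc (fun y hy => hmin hy) hf.aestronglyMeasurable
  have h2 : ∫⁻ y, ‖cutProd θ c (f ∘ e.symm) y‖ₑ ≤
      ∫⁻ y in closedCube c s, ‖f (e.symm y)‖ₑ := by
    rw [← setLIntegral_eq_of_support_subset (s := closedCube c s) fun y hy =>
      support_cutProd_subset h0 (by simpa using hy)]
    refine lintegral_mono fun y => ?_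
    rw [← ofReal_norm, ← ofReal_norm]
    exact ENNReal.ofReal_le_ofReal (norm_cutProd_le c _ h01 y)
  have h3 : ENNReal.ofReal (ρ y₀) * ∫⁻ y, ‖cutProd θ c (f ∘ e.symm) y‖ₑ ≤ ∫⁻ p, ‖f p‖ₑ ∂μ :=
    le_trans (by gcongr) h1
  have h4 := ENNReal.toReal_mono hf.hasFiniteIntegral.ne h3
  rwa [ENNReal.toReal_mul, ENNReal.toReal_ofReal hδ.le] at h4

variable [T2Space M] [CompactSpace M] {k : ℝ}
  {P : smoothFunctions n M →ₗ[ℂ] smoothFunctions n M} {r R₀ Cb : ℝ} {Ω : Set (CSp n)}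
  {B : CSp n → RSp n → ℂ} {R : RSp n × RSp n → ℂ}

open FourierTransform in
-- In the chart, φ times the density is a test function. The oscillatory part is L¹-continuous by
-- duality, the kernel R because it is bounded on a compact set.
theorem IsLocalRepresentation.exists_norm_integral_mul_le
    (hP : IsLocalRepresentation k P e c r R₀ Cb Ω B R) [IsFiniteMeasure μ]
    (hμ : IsAnalyticDensity n μ) (he : e ∈ IsManifold.maximalAtlas 𝓘(ℝ, RSp n) ω M)
    (hc : closedCube c (3 * r) ⊆ e.target) (φ : smoothFunctions n M)
    (hφ : tsupport (φ : M → ℂ) ⊆ e.symm '' openCube c r) :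
    ∃ C : ℝ, 0 ≤ C ∧ ∀ (f : RSp n → ℂ) (w : smoothFunctions n M), ContDiff ℝ ∞ f →
      (∀ y ∉ closedCube c (3 * r), f y = 0) → (w : M → ℂ) = chartLift e f →
      ‖∫ p, (P w : M → ℂ) p * (φ : M → ℂ) p ∂μ‖ ≤ C * ∫ y, ‖f y‖ := by
  obtain ⟨ρ, hρ, hpos, hint⟩ := hμ e he
  have hr := hP.r_pos
  have hsub : openCube c r ⊆ closedCube c (3 * r) := openCube_subset_closedCube c (by linarith)
  obtain ⟨ψ, hψs, hψc, hψt, hψe, hψ0⟩ := exists_chart_testFunction he hρ (hsub.trans hc) φ hφ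
  obtain ⟨C₁, hC₁, h1⟩ := exists_norm_integral_mul_oscIntegrand_le hP.isOpen hP.differentiableOn
    hP.measurable hP.bound_pos hP.norm_le hP.radius_pos (isOpen_openCube c r) hP.ball_subset
    hψs hψc hψt
  obtain ⟨C₂, hC₂, h2⟩ := exists_norm_integral_kernel_le (by positivity : 0 ≤ 3 * r) hP.analytic
  have hψi : Integrable ψ := hψs.continuous.integrable_of_hasCompactSupport hψc
  refine ⟨C₁ + C₂ * ∫ y, ‖ψ y‖, by positivity, fun f w hf hf0 hw => ?_⟩
  have hfc : HasCompactSupport f := HasCompactSupport.intro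
    (isCompact_closedCube c (by positivity)) fun y hy => hf0 y hy
  have hfi : Integrable f := hf.continuous.integrable_of_hasCompactSupport hfc
  obtain ⟨h3, h4⟩ := h1 f hf hfc
  have hsrc : ∀ p ∉ e.source, (P w : M → ℂ) p * (φ : M → ℂ) p = 0 := fun p hp => by
    rw [image_eq_zero_of_notMem_tsupport (f := (φ : M → ℂ)), mul_zero]
    intro h
    obtain ⟨y, hy, rfl⟩ := hφ h
    exact hp (e.map_target (hc (hsub hy)))
  have hmeas : AEStronglyMeasurable (fun p => (P w : M → ℂ) p * (φ : M → ℂ) p) μ :=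
    (integrable_smoothFunctions (P w)).aestronglyMeasurable.mul
      (integrable_smoothFunctions φ).aestronglyMeasurable
  have h5 : ∫ p, (P w : M → ℂ) p * (φ : M → ℂ) p ∂μ =
      ∫ y, ψ y * (P w : M → ℂ) (e.symm y) := by
    rw [← setIntegral_eq_integral_of_forall_compl_eq_zero hsrc,
      integral_source_eq hρ.continuousOn hpos hint hmeas,
      ← setIntegral_eq_integral_of_forall_compl_eq_zero (s := e.target)
        (f := fun y => ψ y * (P w : M → ℂ) (e.symm y)) fun y hy => by rw [hψ0 y hy, zero_mul]]
    refine setIntegral_congr_fun e.open_target.measurableSet fun y hy => ?_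
    simp only [hψe y hy]
    ring
  have hzero : ∀ y ∉ openCube c r, ψ y = 0 := fun y hy =>
    image_eq_zero_of_notMem_tsupport fun h => hy (hψt h)
  have h6 : ∀ y, ψ y * (P w : M → ℂ) (e.symm y) =
      ψ y * (∫ η, oscIntegrand B (𝓕 f) (complexify y) η) +
        ψ y * ∫ z in closedCube c (3 * r), R (y, z) * f z := by
    intro y
    by_cases hy : y ∈ openCube c r
    · rw [hP.apply_eq f w hf0 hw y hy, mul_add]
    · simp [hzero y hy]
  have h7 : Integrable fun y => ψ y * (P w : M → ℂ) (e.symm y) := by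
    refine Continuous.integrable_of_hasCompactSupport ?_ hψc.mul_right
    refine ContinuousOn.continuous_of_tsupport_subset (s := e.target)
      (hψs.continuous.continuousOn.mul (contDiffOn_comp_symm he (P w).2).continuousOn)
      e.open_target ?_
    exact tsupport_mul_subset_left.trans (hψt.trans (hsub.trans hc))
  -- Obtained as a difference, since the sum and the oscillatory part are already known to be
  -- integrable.
  have h8 : Integrable fun y => ψ y * ∫ z in closedCube c (3 * r), R (y, z) * f z := by
    refine (h7.sub h3).congr (Eventually.of_forall fun y => ?_)
    simp only [Pi.sub_apply, h6]
    ring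
  rw [h5]
  simp_rw [h6]
  rw [integral_add h3 h8, add_mul]
  refine (norm_add_le _ _).trans (add_le_add h4 ?_)
  calc ‖∫ y, ψ y * ∫ z in closedCube c (3 * r), R (y, z) * f z‖
      ≤ ∫ y, ‖ψ y‖ * (C₂ * ∫ z, ‖f z‖) := by
        refine norm_integral_le_of_norm_le (hψi.norm.mul_const _)
          (Eventually.of_forall fun y => ?_)
        rw [norm_mul]
        by_cases hy : y ∈ openCube c r
        · gcongr
          exact h2 f hfi y (hsub hy)
        · simp [hzero y hy]
    _ = C₂ * (∫ y, ‖ψ y‖) * ∫ y, ‖f y‖ := by rw [integral_mul_const]; ring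

end Pairing

/-! ### The action on square integrable functions, smooth near a point -/

/-- A smooth cutoff on the line, equal to `1` on `[-a, a]` and to `0` outside `(-b, b)`. -/
structure IsCutoff (θ : ℝ → ℝ) (a b : ℝ) : Prop where
  contDiff : ContDiff ℝ ∞ θ
  mem_Icc : ∀ t, 0 ≤ θ t ∧ θ t ≤ 1
  eq_one : ∀ t, |t| ≤ a → θ t = 1
  eq_zero : ∀ t, b ≤ |t| → θ t = 0

section CutAction

variable {n : ℕ} {M : Type*} [TopologicalSpace M]

theorem IsCutoff.chartLift_eq {θ : ℝ → ℝ} {a b : ℝ} (hθ : IsCutoff θ a b)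
    {e : OpenPartialHomeomorph M (RSp n)} {c : RSp n} (hc : openCube c a ⊆ e.target) (f : M → ℂ)
    {p : M} (hp : p ∈ e.symm '' openCube c a) :
    chartLift e (cutProd θ c (f ∘ e.symm)) p = f p := by
  obtain ⟨y, hy, rfl⟩ := hp
  rw [chartLift_symm _ (hc hy),
    cutProd_eq_self hθ.eq_one (openCube_subset_closedCube c le_rfl hy), Function.comp_apply]

theorem IsCutoff.norm_chartLift_le {θ : ℝ → ℝ} {a b : ℝ} (hθ : IsCutoff θ a b)
    (e : OpenPartialHomeomorph M (RSp n)) (c : RSp n) (f : M → ℂ) (p : M) :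
    ‖chartLift e (cutProd θ c (f ∘ e.symm)) p‖ ≤ ‖f p‖ := by
  by_cases h : p ∈ e.source
  · rw [chartLift_of_mem _ h]
    refine (norm_cutProd_le c _ hθ.mem_Icc _).trans ?_
    rw [Function.comp_apply, e.left_inv h]
  · rw [chartLift, if_neg h, norm_zero]
    exact norm_nonneg _

theorem IsCutoff.cutProd_eq_zero {θ : ℝ → ℝ} {a b : ℝ} (hθ : IsCutoff θ a b) {c : RSp n}
    {f : RSp n → ℂ} : ∀ y ∉ closedCube c b, cutProd θ c f y = 0 := fun _ hy =>
  _root_.cutProd_eq_zero hθ.eq_zero fun h => hy (openCube_subset_closedCube c le_rfl h)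

variable [ChartedSpace (RSp n) M]

theorem IsCutoff.exists_chartLift [T2Space M] {θ : ℝ → ℝ} {a b : ℝ} (hθ : IsCutoff θ a b)
    (hb : 0 ≤ b) {e : OpenPartialHomeomorph M (RSp n)}
    (he : e ∈ IsManifold.maximalAtlas 𝓘(ℝ, RSp n) ω M) {c : RSp n} {O : Set (RSp n)}
    (hO : IsOpen O) (hcO : closedCube c b ⊆ O) (hce : closedCube c b ⊆ e.target) {f : M → ℂ}
    (hf : ContDiffOn ℝ ∞ (f ∘ e.symm) O) :
    ∃ w : smoothFunctions n M, (w : M → ℂ) = chartLift e (cutProd θ c (f ∘ e.symm)) :=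
  ⟨⟨_, contMDiff_chartLift he (isCompact_closedCube c hb) hce (fun _ hy => hθ.cutProd_eq_zero _ hy)
    (contDiff_cutProd hO hf hθ.contDiff hθ.eq_zero hcO)⟩, rfl⟩

variable [MeasurableSpace M]

/-- The action of `P` on a function `u` near points of `Z`, if `w` is smooth and equal to `u`
on `Z`: the difference `u - w` contributes through the kernel off the diagonal. -/
noncomputable def cutAction (μ : Measure M) (P : smoothFunctions n M →ₗ[ℂ] smoothFunctions n M)
    (κ : M × M → ℂ) (Z : Set M) (w : smoothFunctions n M) (u : M → ℂ) (p : M) : ℂ :=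
  (P w : M → ℂ) p + ∫ y in Zᶜ, κ (p, y) * (u y - (w : M → ℂ) y) ∂μ

variable [BorelSpace M] [T2Space M] [CompactSpace M] {μ : Measure M} [IsFiniteMeasure μ] {k : ℝ}
  {P : smoothFunctions n M →ₗ[ℂ] smoothFunctions n M} {e : OpenPartialHomeomorph M (RSp n)}
  {c : RSp n} {r R₀ Cb : ℝ} {Ω : Set (CSp n)} {B : CSp n → RSp n → ℂ} {R : RSp n × RSp n → ℂ}
  {κ : M × M → ℂ}

theorem integral_norm_sub_chartLift_le {θ : ℝ → ℝ} {a b : ℝ} (hθ : IsCutoff θ a b) {u : M → ℂ}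
    (hu : Integrable u μ) {w : smoothFunctions n M}
    (hw : (w : M → ℂ) = chartLift e (cutProd θ c (u ∘ e.symm))) (Z : Set M) :
    ∫ y in Z, ‖u y - (w : M → ℂ) y‖ ∂μ ≤ 2 * ∫ y, ‖u y‖ ∂μ := by
  have hi := hu.sub (integrable_smoothFunctions (μ := μ) w)
  refine (setIntegral_le_integral hi.norm (Eventually.of_forall fun y => norm_nonneg _)).trans ?_
  rw [← integral_const_mul]
  refine integral_mono hi.norm (hu.norm.const_mul 2) fun y => ?_
  refine (norm_sub_le _ _).trans ?_
  rw [hw]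
  have := hθ.norm_chartLift_le e c u y
  linarith

/-- For smooth w, the difference Pw - v has on W the same form as v, with w - u in place of u. Its
local part is L¹-continuous against φ, and its off-diagonal part is bounded because κ is bounded on
supp φ × Zᶜ. Smoothness of u near the cube ensures that P acts on the cut difference. -/
theorem IsLocalRepresentation.equalsOn_cutAction
    (hP : IsLocalRepresentation k P e c r R₀ Cb Ω B R) (hμ : IsAnalyticDensity n μ)
    (he : e ∈ IsManifold.maximalAtlas 𝓘(ℝ, RSp n) ω M) (hc : closedCube c (3 * r) ⊆ e.target)
    (hκ : ContMDiffOn (𝓘(ℝ, RSp n).prod 𝓘(ℝ, RSp n)) 𝓘(ℝ, ℂ) ω κ {p | p.1 ≠ p.2})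
    (hoff : ∀ (w : smoothFunctions n M) (x : M), x ∉ tsupport (w : M → ℂ) →
      (P w : M → ℂ) x = ∫ y, κ (x, y) * (w : M → ℂ) y ∂μ)
    {θ : ℝ → ℝ} (hθ : IsCutoff θ (2 * r) (3 * r)) {u : M → ℂ} (hu : Integrable u μ)
    {O : Set (RSp n)} (hO : IsOpen O) (hcO : closedCube c (3 * r) ⊆ O)
    (huO : ContDiffOn ℝ ∞ (u ∘ e.symm) O) {w₀ : smoothFunctions n M} (hw₀ : (w₀ : M → ℂ) = chartLift e (cutProd θ c (u ∘ e.symm)))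
    (hcont : ContinuousOn (cutAction μ P κ (e.symm '' openCube c (2 * r)) w₀ u)
      (e.symm '' openCube c r)) :
    EqualsOn μ P u (e.symm '' openCube c r)
      (cutAction μ P κ (e.symm '' openCube c (2 * r)) w₀ u) := by
  have hr := hP.r_pos
  have hsub : openCube c r ⊆ openCube c (2 * r) := fun y hy j => (hy j).trans (by linarith)
  have hsub2 : openCube c (2 * r) ⊆ e.target :=
    (openCube_subset_closedCube c (by linarith)).trans hc
  set W := e.symm '' openCube c r with hW
  set Z := e.symm '' openCube c (2 * r) with hZ
  have hWZ : W ⊆ Z := image_mono hsub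
  have hWo : IsOpen W :=
    e.isOpen_image_symm_of_subset_target (isOpen_openCube c r) (hsub.trans hsub2)
  have hZo : IsOpen Z := e.isOpen_image_symm_of_subset_target (isOpen_openCube c _) hsub2
  set v := cutAction μ P κ Z w₀ u with hv
  refine equalsOn_of_norm_integral_le hu.aestronglyMeasurable fun φ hφ => ?_
  obtain ⟨C₁, hC₁, h1⟩ := hP.exists_norm_integral_mul_le hμ he hc φ hφ
  obtain ⟨C₂, hC₂, h2⟩ := exists_integral_norm_cutProd_le hμ he (by positivity : 0 < 3 * r) hc
  obtain ⟨C₃, hC₃⟩ : ∃ C, ∀ p ∈ tsupport (φ : M → ℂ) ×ˢ Zᶜ, ‖κ p‖ ≤ C := by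
    refine ((isClosed_tsupport _).isCompact.prod
      hZo.isClosed_compl.isCompact).exists_bound_of_continuousOn fun p hp => ?_
    refine (continuousAt_kernel_of_ne hκ fun h => hp.2 ?_).continuousWithinAt
    exact h ▸ hWZ (hφ hp.1)
  obtain ⟨C₄, hC₄⟩ := φ.2.continuous.bounded_above_of_compact_support
    (HasCompactSupport.of_compactSpace _)
  -- The 2 comes from |f - θf| ≤ |f| + |θf| ≤ 2|f|.
  refine ⟨C₁ * C₂ + max C₃ 0 * 2 * max C₄ 0 * μ.real univ, by positivity, fun w => ?_⟩
  obtain ⟨w₁, hw₁⟩ := hθ.exists_chartLift (by positivity) he e.open_target hc hc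
    (contDiffOn_comp_symm he w.2)
  have hwu : Integrable (fun y => (w : M → ℂ) y - u y) μ :=
    (integrable_smoothFunctions w).sub hu
  have hlift : ((w₁ - w₀ : smoothFunctions n M) : M → ℂ) =
      chartLift e (cutProd θ c ((fun y => (w : M → ℂ) y - u y) ∘ e.symm)) := by
    rw [Submodule.coe_sub, hw₁, hw₀]
    funext p
    by_cases h : p ∈ e.source
    · simp only [Pi.sub_apply, chartLift_of_mem _ h, cutProd, Function.comp_apply]
      ring
    · simp [chartLift, h]
  have hcut : ContDiff ℝ ∞ (cutProd θ c ((fun y => (w : M → ℂ) y - u y) ∘ e.symm)) :=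
    contDiff_cutProd (hO.inter e.open_target)
      (((contDiffOn_comp_symm he w.2).mono inter_subset_right).sub (huO.mono inter_subset_left))
      hθ.contDiff hθ.eq_zero (subset_inter hcO hc)
  have hdiff : ∀ p ∈ W, (P w : M → ℂ) p - v p = (P (w₁ - w₀) : M → ℂ) p +
      ∫ y in Zᶜ, κ (p, y) *
        (((w : M → ℂ) y - u y) - ((w₁ - w₀ : smoothFunctions n M) : M → ℂ) y) ∂μ := by
    intro p hp
    have h3 := apply_add_integral_kernel_eq hκ hoff hZo (hWZ hp) (w₁ := w) (w₂ := w₁)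
      (fun q hq => by rw [hw₁, hθ.chartLift_eq hsub2 _ hq])
      (integrable_smoothFunctions (μ := μ) w)
    simp only [sub_self, mul_zero, integral_zero, add_zero] at h3
    have h4 : ∫ y in Zᶜ, κ (p, y) *
        (((w : M → ℂ) y - u y) - ((w₁ - w₀ : smoothFunctions n M) : M → ℂ) y) ∂μ =
        (∫ y in Zᶜ, κ (p, y) * ((w : M → ℂ) y - (w₁ : M → ℂ) y) ∂μ) -
          ∫ y in Zᶜ, κ (p, y) * (u y - (w₀ : M → ℂ) y) ∂μ := by
      refine Eq.trans ?_ (integral_sub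
        (integrable_kernel_mul hκ hZo (hWZ hp)
          ((integrable_smoothFunctions w).sub (integrable_smoothFunctions w₁)))
        (integrable_kernel_mul hκ hZo (hWZ hp) (hu.sub (integrable_smoothFunctions w₀))))
      congr 1
      funext y
      rw [Submodule.coe_sub, Pi.sub_apply]
      ring
    rw [h3, h4, hv, cutAction, map_sub, Submodule.coe_sub, Pi.sub_apply]
    ring
  set I := ∫ x, ‖(w : M → ℂ) x - u x‖ ∂μ with hI
  have hI0 : 0 ≤ I := integral_nonneg fun _ => norm_nonneg _
  have hφ0 : ∀ p ∉ W, (φ : M → ℂ) p = 0 := fun p hp =>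
    image_eq_zero_of_notMem_tsupport fun h => hp (hφ h)
  have hi : ∀ w : smoothFunctions n M,
      Integrable (fun p => (P w : M → ℂ) p * (φ : M → ℂ) p) μ := fun w =>
    ((P w).2.continuous.mul φ.2.continuous).integrable_of_hasCompactSupport
      (HasCompactSupport.of_compactSpace _)
  have hvi : Integrable (fun p => v p * (φ : M → ℂ) p) μ := by
    refine Continuous.integrable_of_hasCompactSupport ?_ (HasCompactSupport.of_compactSpace _)
    exact ContinuousOn.continuous_of_tsupport_subset (hcont.mul φ.2.continuous.continuousOn) hWo
      (tsupport_mul_subset_right.trans hφ)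
  have hsplit : (∫ x, (P w : M → ℂ) x * (φ : M → ℂ) x ∂μ) - ∫ x, v x * (φ : M → ℂ) x ∂μ =
      (∫ x, (P (w₁ - w₀) : M → ℂ) x * (φ : M → ℂ) x ∂μ) +
        ∫ x, ((P w : M → ℂ) x * (φ : M → ℂ) x - v x * (φ : M → ℂ) x -
          (P (w₁ - w₀) : M → ℂ) x * (φ : M → ℂ) x) ∂μ := by
    have h3 := integral_sub ((hi w).sub hvi) (hi (w₁ - w₀))
    have h4 := integral_sub (hi w) hvi
    simp only [Pi.sub_apply] at h3
    rw [h3, h4]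
    ring
  rw [hsplit]
  refine (norm_add_le _ _).trans ?_
  rw [add_mul]
  refine add_le_add ?_ ?_
  · calc ‖∫ x, (P (w₁ - w₀) : M → ℂ) x * (φ : M → ℂ) x ∂μ‖
        ≤ C₁ * ∫ y, ‖cutProd θ c ((fun y => (w : M → ℂ) y - u y) ∘ e.symm) y‖ :=
          h1 _ _ hcut (fun y hy => hθ.cutProd_eq_zero y hy) hlift
      _ ≤ C₁ * (C₂ * I) := by
          gcongr
          exact h2 θ _ hθ.mem_Icc hθ.eq_zero hwu hcut.continuous
      _ = C₁ * C₂ * I := by ring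
  · have h5 : ∀ p, ‖(P w : M → ℂ) p * (φ : M → ℂ) p - v p * (φ : M → ℂ) p -
          (P (w₁ - w₀) : M → ℂ) p * (φ : M → ℂ) p‖ ≤ max C₃ 0 * (2 * I) * max C₄ 0 := by
      intro p
      by_cases hp : p ∈ tsupport (φ : M → ℂ)
      · rw [← sub_mul, ← sub_mul, hdiff p (hφ hp), add_sub_cancel_left, norm_mul]
        gcongr
        · refine (norm_integral_le_of_norm_le (g := fun y => max C₃ 0 *
            ‖((w : M → ℂ) y - u y) - ((w₁ - w₀ : smoothFunctions n M) : M → ℂ) y‖)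
            ((hwu.sub (integrable_smoothFunctions (w₁ - w₀))).norm.const_mul _).integrableOn
            ?_).trans ?_
          · filter_upwards [ae_restrict_mem hZo.isClosed_compl.measurableSet] with y hy
            rw [norm_mul]
            gcongr
            exact (hC₃ (p, y) ⟨hp, hy⟩).trans (le_max_left _ _)
          · rw [integral_const_mul]
            gcongr
            exact integral_norm_sub_chartLift_le hθ hwu hlift _
        · exact (hC₄ p).trans (le_max_left _ _)
      · rw [image_eq_zero_of_notMem_tsupport hp]
        simp only [mul_zero, sub_self, norm_zero]
        positivity
    refine (norm_integral_le_of_norm_le_const (Eventually.of_forall h5)).trans_eq ?_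
    ring

end CutAction

/-! ### Derivative estimates -/

theorem norm_iteratedFDeriv_le_of_eqOn_add {E F : Type*} [NormedAddCommGroup E] [NormedSpace ℝ E]
    [NormedAddCommGroup F] [NormedSpace ℝ F] {O : Set E} (hO : IsOpen O) {g f₁ f₂ f₃ : E → F}
    (h₁ : ContDiffOn ℝ ∞ f₁ O) (h₂ : ContDiffOn ℝ ∞ f₂ O) (h₃ : ContDiffOn ℝ ∞ f₃ O)
    (hg : EqOn g (f₁ + f₂ + f₃) O) (m : ℕ) {x : E} (hx : x ∈ O) :
    ‖iteratedFDeriv ℝ m g x‖ ≤ ‖iteratedFDeriv ℝ m f₁ x‖ + ‖iteratedFDeriv ℝ m f₂ x‖ +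
      ‖iteratedFDeriv ℝ m f₃ x‖ := by
  have hnx := hO.mem_nhds hx
  have h₁x := (h₁.contDiffAt hnx).of_le (m := m) (by exact_mod_cast le_top)
  have h₂x := (h₂.contDiffAt hnx).of_le (m := m) (by exact_mod_cast le_top)
  have h₃x := (h₃.contDiffAt hnx).of_le (m := m) (by exact_mod_cast le_top)
  rw [((hg.eventuallyEq_of_mem hnx).iteratedFDeriv ℝ m).eq_of_nhds,
    iteratedFDeriv_add_apply (f := f₁ + f₂) (h₁x.add h₂x) h₃x, iteratedFDeriv_add_apply h₁x h₂x]
  exact norm_add₃_le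

theorem exists_contDiffOn_analytic_kernel {n : ℕ} {c : RSp n} {r s : ℝ} (hs : 0 ≤ s) (hrs : r ≤ s)
    {R : RSp n × RSp n → ℂ} (hR : AnalyticOnNhd ℝ R (closedCube c s ×ˢ closedCube c s)) :
    ∃ C : ℝ, 0 < C ∧ ∀ f : RSp n → ℂ, Integrable f →
      ContDiffOn ℝ ∞ (fun x => ∫ y in closedCube c s, R (x, y) * f y) (openCube c r) ∧
      ∀ m : ℕ, ∀ x ∈ openCube c r,
        ‖iteratedFDeriv ℝ m (fun x => ∫ y in closedCube c s, R (x, y) * f y) x‖ ≤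
          C ^ (m + 1) * m.factorial * ∫ y, ‖f y‖ := by
  have hcomp := isCompact_closedCube c hs
  have hsub : openCube c r ⊆ closedCube c s := openCube_subset_closedCube c hrs
  obtain ⟨C, hC, hb⟩ := AnalyticOnNhd.exists_norm_iteratedFDeriv_slice_le (hcomp.prod hcomp) hR
  refine ⟨C, hC, fun f hf => ?_⟩
  have h := contDiffOn_integral_kernel_mul (ν := volume.restrict (closedCube c s))
    (isOpen_openCube c r) (g := fun x y => R (x, y)) (C := C)
    (fun x hx => by
      refine ContinuousOn.aestronglyMeasurable ?_ hcomp.measurableSet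
      exact hR.continuousOn.comp (by fun_prop) fun y hy => ⟨hsub hx, hy⟩)
    (by
      filter_upwards [ae_restrict_mem hcomp.measurableSet] with y hy x hx
      have h1 : AnalyticAt ℝ (fun x : RSp n => (x, y)) x := analyticAt_id.prod analyticAt_const
      exact (AnalyticAt.fun_comp (f := fun x : RSp n => (x, y))
        (hR (x, y) ⟨hsub hx, hy⟩) h1).contDiffAt.contDiffWithinAt)
    (by
      filter_upwards [ae_restrict_mem hcomp.measurableSet] with y hy m x hx
      exact hb (x, y) ⟨hsub hx, hy⟩ m)
    hf.integrableOn
  refine ⟨h.1, fun m x hx => (h.2 m x hx).trans ?_⟩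
  exact mul_le_mul_of_nonneg_left
    (setIntegral_le_integral hf.norm (Eventually.of_forall fun y => norm_nonneg _)) (by positivity)

section Estimate

variable {n : ℕ} {M : Type*} [TopologicalSpace M] [ChartedSpace (RSp n) M] [MeasurableSpace M]
  [BorelSpace M] [T2Space M] [CompactSpace M] {μ : Measure M}
  {k : ℝ} {P : smoothFunctions n M →ₗ[ℂ] smoothFunctions n M}
  {e : OpenPartialHomeomorph M (RSp n)} {c : RSp n} {r R₀ Cb : ℝ} {Ω : Set (CSp n)}
  {B : CSp n → RSp n → ℂ} {R : RSp n × RSp n → ℂ} {κ : M × M → ℂ}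

theorem exists_contDiffOn_kernel [IsManifold 𝓘(ℝ, RSp n) ω M]
    (he : e ∈ IsManifold.maximalAtlas 𝓘(ℝ, RSp n) ω M)
    (hκ : ContMDiffOn (𝓘(ℝ, RSp n).prod 𝓘(ℝ, RSp n)) 𝓘(ℝ, ℂ) ω κ {p | p.1 ≠ p.2})
    {s : ℝ} (hr : 0 ≤ r) (hrs : r < s) (hs : openCube c s ⊆ e.target) :
    ∃ C : ℝ, 0 < C ∧ ∀ f : M → ℂ, Integrable f μ →
      ContDiffOn ℝ ∞ (fun x => ∫ y in (e.symm '' openCube c s)ᶜ, κ (e.symm x, y) * f y ∂μ)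
        (openCube c r) ∧
      ∀ m : ℕ, ∀ x ∈ openCube c r,
        ‖iteratedFDeriv ℝ m
          (fun x => ∫ y in (e.symm '' openCube c s)ᶜ, κ (e.symm x, y) * f y ∂μ) x‖ ≤
          C ^ (m + 1) * m.factorial * ∫ y in (e.symm '' openCube c s)ᶜ, ‖f y‖ ∂μ := by
  have hZ : IsOpen (e.symm '' openCube c s) :=
    e.isOpen_image_symm_of_subset_target (isOpen_openCube c s) hs
  have hsub : closedCube c r ⊆ openCube c s := closedCube_subset_openCube c hrs
  have hsub' : openCube c r ⊆ closedCube c r := openCube_subset_closedCube c le_rfl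
  have hne : ∀ x ∈ closedCube c r, ∀ y ∈ (e.symm '' openCube c s)ᶜ, e.symm x ≠ y :=
    fun x hx y hy h => hy ⟨x, hsub hx, h⟩
  obtain ⟨C, hC, hb⟩ := exists_norm_iteratedFDeriv_kernel_le he hκ
    ((isCompact_closedCube c hr).prod hZ.isClosed_compl.isCompact)
    fun q hq => ⟨hs (hsub hq.1), hne _ hq.1 _ hq.2⟩
  have hmem := ae_restrict_mem (μ := μ) hZ.isClosed_compl.measurableSet
  refine ⟨C, hC, fun f hf => ?_⟩
  refine contDiffOn_integral_kernel_mul (isOpen_openCube c r) (fun x hx => ?_) ?_ ?_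
    hf.integrableOn
  · refine ContinuousOn.aestronglyMeasurable (fun y hy => ?_) hZ.isClosed_compl.measurableSet
    exact ((continuousAt_kernel_of_ne hκ (p := (e.symm x, y)) (hne x (hsub' hx) y hy)).comp
      (Continuous.prodMk_right (e.symm x)).continuousAt).continuousWithinAt
  · filter_upwards [hmem] with y hy x hx
    exact (analyticAt_kernel_left he hκ (hs (hsub (hsub' hx)))
      (hne x (hsub' hx) y hy)).contDiffAt.contDiffWithinAt
  · filter_upwards [hmem] with y hy m x hx
    exact hb (x, y) ⟨hsub' hx, hy⟩ m

open FourierTransform in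
-- The function estimated is built with the fixed cutoff θ; for each m it is rewritten with a cutoff
-- θ' adapted to m, which leaves it unchanged on Q_r. Then the oscillatory part obeys the central
-- estimate and the two analytic kernels give the factorial term.
theorem IsLocalRepresentation.exists_cutAction_estimate [IsManifold 𝓘(ℝ, RSp n) ω M]
    [IsFiniteMeasure μ]
    (hP : IsLocalRepresentation k P e c r R₀ Cb Ω B R) (hk : -(n : ℝ) ≤ k)
    (he : e ∈ IsManifold.maximalAtlas 𝓘(ℝ, RSp n) ω M) (hc : closedCube c (3 * r) ⊆ e.target)
    (hκ : ContMDiffOn (𝓘(ℝ, RSp n).prod 𝓘(ℝ, RSp n)) 𝓘(ℝ, ℂ) ω κ {p | p.1 ≠ p.2})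
    (hoff : ∀ (w : smoothFunctions n M) (x : M), x ∉ tsupport (w : M → ℂ) →
      (P w : M → ℂ) x = ∫ y, κ (x, y) * (w : M → ℂ) y ∂μ)
    {O : Set (RSp n)} (hO : IsOpen O) (hcO : closedCube c (3 * r) ⊆ O)
    {θ : ℝ → ℝ} (hθ : IsCutoff θ (2 * r) (3 * r)) {C : ℝ} (hC : 0 < C) :
    ∃ E : ℝ, 0 < E ∧ ∀ (u : M → ℂ) (w₀ : smoothFunctions n M) (D lam : ℝ), Integrable u μ →
      ContDiffOn ℝ ∞ (u ∘ e.symm) O → (w₀ : M → ℂ) = chartLift e (cutProd θ c (u ∘ e.symm)) →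
      0 ≤ D → 0 ≤ lam →
      (∀ (j : Fin n) (q : ℕ), ∀ y ∈ O, ‖iteratedDeriv q
        (fun s : ℝ => (u ∘ e.symm) (y + s • EuclideanSpace.single j (1 : ℝ))) 0‖ ≤
          D * (C * (q + lam)) ^ q) → (n = 0 → ∀ y ∈ O, ‖(u ∘ e.symm) y‖ ≤ D) →
      ContDiffOn ℝ ∞ (cutAction μ P κ (e.symm '' openCube c (2 * r)) w₀ u ∘ e.symm)
        (openCube c r) ∧
      ∀ m : ℕ, ∀ x ∈ openCube c r,
        ‖iteratedFDeriv ℝ m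
          (cutAction μ P κ (e.symm '' openCube c (2 * r)) w₀ u ∘ e.symm) x‖ ≤
          E ^ (m + 1) * (D * (1 + (m + ⌈k + n⌉₊ : ℕ) + lam) ^ ((m : ℝ) + k + n) +
            (D + ∫ p, ‖u p‖ ∂μ) * m.factorial) := by
  have hr := hP.r_pos
  have hr3 : 0 ≤ 3 * r := by positivity
  have hcomp := isCompact_closedCube c hr3
  have hsub2 : openCube c (2 * r) ⊆ e.target :=
    (openCube_subset_closedCube c (by linarith)).trans hc
  have hsub : openCube c r ⊆ openCube c (2 * r) := fun y hy j => (hy j).trans (by linarith)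
  set Z := e.symm '' openCube c (2 * r) with hZ
  have hZo : IsOpen Z := e.isOpen_image_symm_of_subset_target (isOpen_openCube c _) hsub2
  obtain ⟨K, hK, hcut⟩ := exists_cutoff_of_order (a := 2 * r) (b := 3 * r) (by positivity)
    (by linarith)
  obtain ⟨E, hE, h1⟩ := exists_oscIntegrand_estimate hk hP.isOpen hP.differentiableOn hP.measurable
    hP.bound_pos hP.norm_le hP.radius_pos hr hP.ball_subset hK hC
  obtain ⟨C₁, hC₁, h2⟩ := exists_contDiffOn_analytic_kernel (r := r) hr3 (by linarith) hP.analytic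
  obtain ⟨C₂, hC₂, h3⟩ := exists_contDiffOn_kernel (μ := μ) he hκ hr.le
    (by linarith : r < 2 * r) hsub2
  set Vol := (volume (closedCube c (3 * r))).toReal with hVol
  have hVol0 : 0 ≤ Vol := ENNReal.toReal_nonneg
  -- One base for all three parts; Vol + 2 absorbs both the volume factor of the R term and the 2 of
  -- the off-diagonal term.
  set E' := E + (C₁ + C₂) * (Vol + 2) with hE'
  have hE'1 : E ≤ E' := by
    have : 0 ≤ (C₁ + C₂) * (Vol + 2) := by positivity
    linarith
  have hpow : ∀ (t : ℝ) (m : ℕ), 0 ≤ t → t ≤ Vol + 2 → ∀ C', 0 < C' → C' ≤ C₁ + C₂ →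
      C' ^ (m + 1) * t ≤ E' ^ (m + 1) := by
    intro t m ht ht' C' hC' hC''
    calc C' ^ (m + 1) * t ≤ (C₁ + C₂) ^ (m + 1) * (Vol + 2) ^ (m + 1) := by
          gcongr
          exact ht'.trans (le_self_pow₀ (by linarith) (by omega))
      _ = ((C₁ + C₂) * (Vol + 2)) ^ (m + 1) := (mul_pow _ _ _).symm
      _ ≤ E' ^ (m + 1) := by
          gcongr
          linarith
  refine ⟨E', by linarith, fun u w₀ D lam hu huO hw₀ hD hlam hline hn => ?_⟩
  have key : ∀ m : ℕ,
      ContDiffOn ℝ ∞ (cutAction μ P κ Z w₀ u ∘ e.symm) (openCube c r) ∧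
      ∀ x ∈ openCube c r, ‖iteratedFDeriv ℝ m (cutAction μ P κ Z w₀ u ∘ e.symm) x‖ ≤
        E' ^ (m + 1) * (D * (1 + (m + ⌈k + n⌉₊ : ℕ) + lam) ^ ((m : ℝ) + k + n) +
            (D + ∫ p, ‖u p‖ ∂μ) * m.factorial) := by
    intro m
    obtain ⟨θ', hs, h01, hone, hzero, hbd⟩ := hcut (m + ⌈k + n⌉₊)
    have hθ' : IsCutoff θ' (2 * r) (3 * r) := ⟨hs, h01, hone, hzero⟩
    obtain ⟨w, hw⟩ := hθ'.exists_chartLift hr3 he hO hcO hc huO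
    set f := cutProd θ' c (u ∘ e.symm) with hf
    have hfs : ContDiff ℝ ∞ f := contDiff_cutProd hO huO hs hzero hcO
    have hfi : Integrable f := hfs.continuous.integrable_of_hasCompactSupport
      (hcomp.of_isClosed_subset (isClosed_tsupport _) (tsupport_cutProd_subset hzero))
    have hfD : ∫ y, ‖f y‖ ≤ Vol * D := by
      rw [← setIntegral_eq_integral_of_forall_compl_eq_zero (s := closedCube c (3 * r))
        fun y hy => by rw [hf, hθ'.cutProd_eq_zero y hy, norm_zero]]
      calc ∫ y in closedCube c (3 * r), ‖f y‖ ≤ ∫ _ in closedCube c (3 * r), D := by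
            refine setIntegral_mono_on hfi.norm.integrableOn
              (integrableOn_const hcomp.measure_lt_top.ne) hcomp.measurableSet fun y hy => ?_
            refine (norm_cutProd_le c _ h01 y).trans ?_
            rcases Nat.eq_zero_or_pos n with h | h
            · exact hn h y (hcO hy)
            · simpa using hline ⟨0, h⟩ 0 y (hcO hy)
        _ = Vol * D := by rw [setIntegral_const, smul_eq_mul, Measure.real]
    have hui : Integrable (fun y => u y - (w : M → ℂ) y) μ :=
      hu.sub (integrable_smoothFunctions w)
    obtain ⟨hT, hTb⟩ := h1 m θ' (u ∘ e.symm) O D lam hO huO hcO hD hlam hs h01 hzero hbd hline hn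
    obtain ⟨hS, hSb⟩ := h2 f hfi
    obtain ⟨hV, hVb⟩ := h3 _ hui
    have heq : EqOn (cutAction μ P κ Z w₀ u ∘ e.symm)
        (((fun x => ∫ η, oscIntegrand B (𝓕 f) (complexify x) η) +
          fun x => ∫ y in closedCube c (3 * r), R (x, y) * f y) +
          fun x => ∫ y in Zᶜ, κ (e.symm x, y) * (u y - (w : M → ℂ) y) ∂μ) (openCube c r) := by
      intro x hx
      have hxZ : e.symm x ∈ Z := mem_image_of_mem _ (hsub hx)
      have h4 := apply_add_integral_kernel_eq hκ hoff hZo hxZ (w₁ := w₀) (w₂ := w)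
        (fun q hq => by rw [hw₀, hw, hθ.chartLift_eq hsub2 _ hq, hθ'.chartLift_eq hsub2 _ hq]) hu
      simp only [Function.comp_apply, cutAction, Pi.add_apply]
      rw [h4, hP.apply_eq f w hθ'.cutProd_eq_zero hw x hx]
    refine ⟨((hT.add hS).add hV).congr heq, fun x hx => ?_⟩
    have hlam' : (0 : ℝ) ≤ 1 + (m + ⌈k + n⌉₊ : ℕ) + lam := by positivity
    have hI : 0 ≤ ∫ p, ‖u p‖ ∂μ := integral_nonneg fun _ => norm_nonneg _
    have b1 : D * E ^ (m + 1) * (1 + (m + ⌈k + n⌉₊ : ℕ) + lam) ^ ((m : ℝ) + k + n) ≤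
        E' ^ (m + 1) * (D * (1 + (m + ⌈k + n⌉₊ : ℕ) + lam) ^ ((m : ℝ) + k + n)) := by
      rw [mul_comm D, mul_assoc]
      gcongr
    have b2 : C₁ ^ (m + 1) * m.factorial * ∫ y, ‖f y‖ ≤ E' ^ (m + 1) * (D * m.factorial) := by
      calc C₁ ^ (m + 1) * m.factorial * ∫ y, ‖f y‖
          ≤ C₁ ^ (m + 1) * m.factorial * (Vol * D) := by gcongr
        _ = C₁ ^ (m + 1) * Vol * (D * m.factorial) := by ring
        _ ≤ _ := by
            gcongr
            exact hpow Vol m hVol0 (by linarith) C₁ hC₁ (by linarith)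
    have b3 : C₂ ^ (m + 1) * m.factorial * ∫ y in Zᶜ, ‖u y - (w : M → ℂ) y‖ ∂μ ≤
        E' ^ (m + 1) * ((∫ p, ‖u p‖ ∂μ) * m.factorial) := by
      calc C₂ ^ (m + 1) * m.factorial * ∫ y in Zᶜ, ‖u y - (w : M → ℂ) y‖ ∂μ
          ≤ C₂ ^ (m + 1) * m.factorial * (2 * ∫ p, ‖u p‖ ∂μ) := by
            gcongr
            exact integral_norm_sub_chartLift_le hθ' hu hw _
        _ = C₂ ^ (m + 1) * 2 * ((∫ p, ‖u p‖ ∂μ) * m.factorial) := by ring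
        _ ≤ _ := by
            gcongr
            exact hpow 2 m (by norm_num) (by linarith) C₂ hC₂ (by linarith)
    have t1 := hTb x hx
    have t2 := hSb m x hx
    have t3 := hVb m x hx
    refine (norm_iteratedFDeriv_le_of_eqOn_add (isOpen_openCube c r) hT hS hV heq m hx).trans ?_
    linarith
  exact ⟨(key 0).1, fun m => (key m).2⟩

end Estimate

/-! ### Semiclassical form of the estimates -/

/-- Dividing by h^q turns (hq + ε)^q into (q + ε/h)^q, which shows the shift lam = ε/h and the
amplitude D = AC. -/
theorem norm_iteratedDeriv_le_of_cauchyEstimates {n : ℕ} {h ε A C : ℝ} (hh : 0 < h)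
    {O : Set (RSp n)} (hO : IsOpen O) {f : RSp n → ℂ}
    (hf : CauchyEstimates h ε A C O f) (j : Fin n) (q : ℕ) {y : RSp n} (hy : y ∈ O) :
    ‖iteratedDeriv q (fun s : ℝ => f (y + s • EuclideanSpace.single j (1 : ℝ))) 0‖ ≤
      A * C * (C * (q + ε / h)) ^ q := by
  have h1 := hf.2 (Pi.single j q) y hy
  rw [hDerPow_single, multiLen_single] at h1
  have h2 := hDer_iterate_line (h := h) (j := j) hO hf.1 y q 0 (by simpa using hy)
  rw [zero_smul, add_zero] at h2
  rw [h2, norm_mul, norm_pow, norm_div, Complex.norm_I, div_one, Complex.norm_real,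
    Real.norm_eq_abs, abs_of_pos hh] at h1
  have h3 : A * C ^ (q + 1) * (h * q + ε) ^ q = h ^ q * (A * C * (C * (q + ε / h)) ^ q) := by
    have : h * q + ε = h * (q + ε / h) := by field_simp
    rw [this, mul_pow, mul_pow, pow_succ]
    ring
  rw [h3] at h1
  exact le_of_mul_le_mul_left h1 (by positivity)

/-- With s = k + n, h^m L^(m+s) = (hL)^m (hL)^s h^(-s): the first factor gives (hm + ε)^m up to a
geometric constant, and the second grows at most geometrically in m because h and ε are bounded. The
factorial term has no negative power of h; it is fitted in by 1 ≤ (h₀/h)^s. -/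
theorem exists_semiclassical_bound {k C E ν h₀ ε₀ : ℝ} {n : ℕ} (hk : 0 ≤ k + n) (hC : 0 < C)
    (hE : 0 < E) (hν : 0 ≤ ν) (hh₀ : 0 < h₀) (hε₀ : 0 < ε₀) (q : ℕ) :
    ∃ C' : ℝ, 0 < C' ∧ ∀ (h ε A : ℝ) (m : ℕ), 0 < h → h ≤ h₀ → 0 < ε → ε ≤ ε₀ → 0 ≤ A →
      h ^ m * (E ^ (m + 1) * (A * C * (1 + (m + q : ℕ) + ε / h) ^ ((m : ℝ) + k + n) +
        (A * C + A * ν) * m.factorial)) ≤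
        A * h ^ (-k - (n : ℝ)) * C' ^ (m + 1) * (h * m + ε) ^ m := by
  set s := k + n with hs
  set c₁ := h₀ * (1 + q) + ε₀ with hc₁
  have hc₁0 : 0 < c₁ := by positivity
  set X := C * c₁ ^ s + (C + ν) * h₀ ^ s with hX
  have hX0 : 0 ≤ X := by positivity
  set a : ℝ := (2 + q) * 2 ^ s with ha
  have h2s : (1 : ℝ) ≤ 2 ^ s := Real.one_le_rpow (by norm_num) hk
  have ha1 : 1 ≤ a := by
    have : (0 : ℝ) ≤ q := Nat.cast_nonneg q
    nlinarith
  refine ⟨E * (a * (X + 1)), by positivity, fun h ε A m hh hhh hε hεε hA => ?_⟩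
  have e1 : -k - (n : ℝ) = -s := by rw [hs]; ring
  have e2 : (m : ℝ) + k + n = m + s := by rw [hs]; ring
  set L : ℝ := 1 + (m + q : ℕ) + ε / h with hL
  have hL0 : 0 < L := by positivity
  have hhL : h * L = h * (1 + (m + q : ℕ)) + ε := by rw [hL]; field_simp
  have hm0 : (0 : ℝ) ≤ m := Nat.cast_nonneg m
  have hq0 : (0 : ℝ) ≤ q := Nat.cast_nonneg q
  have hG0 : 0 < h * m + ε := by positivity
  have g1 : (h * L) ^ m ≤ (2 + q : ℝ) ^ m * (h * m + ε) ^ m := by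
    -- For m ≥ 1, 1 + m + q ≤ (2 + q)m; for m = 0 that fails, but both sides are 1.
    rcases Nat.eq_zero_or_pos m with hm | hm
    · simp [hm]
    · rw [← mul_pow]
      have hm1 : (1 : ℝ) ≤ m := by exact_mod_cast hm
      refine pow_le_pow_left₀ (by positivity) ?_ m
      rw [hhL]
      push_cast
      have i1 : h * (1 + (m + q)) ≤ h * ((2 + q) * m) := by
        gcongr
        nlinarith
      nlinarith
  have g2 : (h * L) ^ s ≤ c₁ ^ s * (2 ^ s) ^ m := by
    have i1 : h * L ≤ c₁ * 2 ^ m := by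
      rw [hhL]
      have i2 : (m : ℝ) + 1 ≤ 2 ^ m := by exact_mod_cast Nat.lt_two_pow_self
      calc h * (1 + (m + q : ℕ)) + ε ≤ h₀ * (1 + (m + q : ℕ)) + ε₀ := by gcongr
        _ ≤ c₁ * (m + 1) := by
            rw [hc₁]; push_cast
            nlinarith [mul_nonneg hh₀.le (mul_nonneg hq0 hm0), mul_nonneg hε₀.le hm0]
        _ ≤ c₁ * 2 ^ m := by gcongr
    calc (h * L) ^ s ≤ (c₁ * 2 ^ m) ^ s := by gcongr
      _ = c₁ ^ s * (2 ^ s) ^ m := by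
          rw [Real.mul_rpow hc₁0.le (by positivity), ← Real.rpow_natCast 2 m,
            ← Real.rpow_mul (by norm_num), mul_comm (m : ℝ) s, Real.rpow_mul (by norm_num),
            Real.rpow_natCast]
  have g3 : h ^ m * L ^ ((m : ℝ) + s) = (h * L) ^ m * (h * L) ^ s * h ^ (-s) := by
    rw [Real.rpow_add hL0, Real.rpow_natCast, mul_pow, Real.mul_rpow hh.le hL0.le,
      Real.rpow_neg hh.le]
    have : h ^ s ≠ 0 := by positivity
    field_simp
  have g4 : h ^ m * L ^ ((m : ℝ) + s) ≤ c₁ ^ s * a ^ m * (h * m + ε) ^ m * h ^ (-s) := by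
    rw [g3]
    calc (h * L) ^ m * (h * L) ^ s * h ^ (-s)
        ≤ ((2 + q : ℝ) ^ m * (h * m + ε) ^ m) * (c₁ ^ s * (2 ^ s) ^ m) * h ^ (-s) := by gcongr
      _ = _ := by rw [ha, mul_pow]; ring
  have g5 : h ^ m * (m.factorial : ℝ) ≤ h₀ ^ s * a ^ m * (h * m + ε) ^ m * h ^ (-s) := by
    have i1 : h ^ m * (m.factorial : ℝ) ≤ (h * m + ε) ^ m := by
      calc h ^ m * (m.factorial : ℝ) ≤ h ^ m * (m : ℝ) ^ m := by
            gcongr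
            exact_mod_cast Nat.factorial_le_pow m
        _ = (h * m) ^ m := (mul_pow _ _ _).symm
        _ ≤ _ := by gcongr; linarith
    have i2 : 1 ≤ h₀ ^ s * h ^ (-s) := by
      rw [Real.rpow_neg hh.le, ← div_eq_mul_inv, one_le_div (by positivity)]
      gcongr
    calc h ^ m * (m.factorial : ℝ) ≤ 1 * 1 * (h * m + ε) ^ m := by simpa using i1
      _ ≤ (h₀ ^ s * h ^ (-s)) * a ^ m * (h * m + ε) ^ m := by
          gcongr
          exact one_le_pow₀ ha1
      _ = _ := by ring
  rw [e1, e2]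
  calc h ^ m * (E ^ (m + 1) * (A * C * L ^ ((m : ℝ) + s) + (A * C + A * ν) * m.factorial))
      = A * E ^ (m + 1) * (C * (h ^ m * L ^ ((m : ℝ) + s)) +
          (C + ν) * (h ^ m * m.factorial)) := by ring
    _ ≤ A * E ^ (m + 1) * (C * (c₁ ^ s * a ^ m * (h * m + ε) ^ m * h ^ (-s)) +
          (C + ν) * (h₀ ^ s * a ^ m * (h * m + ε) ^ m * h ^ (-s))) := by gcongr
    _ = A * h ^ (-s) * (E ^ (m + 1) * (a ^ m * X)) * (h * m + ε) ^ m := by rw [hX]; ring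
    _ ≤ A * h ^ (-s) * (E ^ (m + 1) * (a ^ (m + 1) * (X + 1) ^ (m + 1))) * (h * m + ε) ^ m := by
        have i1 : a ^ m ≤ a ^ (m + 1) := pow_le_pow_right₀ ha1 (Nat.le_succ m)
        have i2 : X ≤ (X + 1) ^ (m + 1) :=
          (by linarith : X ≤ X + 1).trans (le_self_pow₀ (by linarith) (Nat.succ_ne_zero m))
        gcongr
    _ = _ := by rw [mul_pow E, mul_pow a]

theorem mainTheorem7 {n : ℕ} {M : Type*} [TopologicalSpace M] [T2Space M] [CompactSpace M]
    [ChartedSpace (RSp n) M] [IsManifold 𝓘(ℝ, RSp n) ω M]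
    [MeasurableSpace M] [BorelSpace M] (μ : Measure M) (hμ : IsAnalyticDensity n μ)
    (k : ℝ) (hk : -(n : ℝ) ≤ k)
    (P : smoothFunctions n M →ₗ[ℂ] smoothFunctions n M)
    (hP : IsHomogeneousAnalyticPDO μ k P)
    (e : OpenPartialHomeomorph M (RSp n))
    (he : e ∈ IsManifold.maximalAtlas 𝓘(ℝ, RSp n) ω M)
    (x₀ : M) (U : Set M) (hU : IsOpen U) (hx₀ : x₀ ∈ U) (hUe : U ⊆ e.source) :
    ∃ W : Set M, IsOpen W ∧ x₀ ∈ W ∧ W ⊆ U ∧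
      ∀ C ε₀ h₀ : ℝ, 0 < C → 0 < ε₀ → 0 < h₀ →
        ∃ C' : ℝ, 0 < C' ∧
          ∀ h ε A : ℝ, 0 < h → h ≤ h₀ → 0 < ε → ε ≤ ε₀ → 0 ≤ A →
            ∀ u : M → ℂ, MemLp u 2 μ → eLpNorm u 2 μ ≤ ENNReal.ofReal A →
              CauchyEstimates h ε A C (e '' U) (u ∘ e.symm) →
                ∃ v : M → ℂ, EqualsOn μ P u W v ∧
                  CauchyEstimates h ε (A * h ^ (-k - (n : ℝ))) C' (e '' W) (v ∘ e.symm) := by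
  have : IsFiniteMeasure μ := hμ.isFiniteMeasure
  obtain ⟨κ, hκ, hoff⟩ := hP.off_diagonal
  obtain ⟨r, R₀, Cb, Ω, B, R, hcU, hloc⟩ := hP.exists_local_representation he hU hx₀ hUe
  have hr := hloc.r_pos
  set c := e x₀ with hc
  have hO : IsOpen (e '' U) := e.isOpen_image_of_subset_source hU hUe
  have hOt : e '' U ⊆ e.target := by
    rintro _ ⟨p, hp, rfl⟩
    exact e.map_source (hUe hp)
  have hct : closedCube c (3 * r) ⊆ e.target := hcU.trans hOt
  have hcc : openCube c r ⊆ closedCube c (3 * r) := openCube_subset_closedCube c (by linarith)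
  obtain ⟨K, -, hcut⟩ := exists_cutoff_of_order (a := 2 * r) (b := 3 * r) (by positivity)
    (by linarith)
  -- This cutoff only serves to define v, so no derivative bounds are required of it.
  obtain ⟨θ, hs, h01, hone, hzero, -⟩ := hcut 0
  have hθ : IsCutoff θ (2 * r) (3 * r) := ⟨hs, h01, hone, hzero⟩
  have heW : e '' (e.symm '' openCube c r) = openCube c r := by
    rw [← image_comp]
    exact (image_congr fun y hy => e.right_inv (hct (hcc hy))).trans (image_id _)
  have hWo : IsOpen (e.symm '' openCube c r) :=
    e.isOpen_image_symm_of_subset_target (isOpen_openCube c r) (hcc.trans hct)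
  refine ⟨e.symm '' openCube c r, hWo, ⟨c, mem_openCube_self c hr, e.left_inv (hUe hx₀)⟩, ?_, ?_⟩
  · rintro _ ⟨y, hy, rfl⟩
    obtain ⟨p, hp, hpy⟩ := hcU (hcc hy)
    rw [← hpy, e.left_inv (hUe hp)]
    exact hp
  intro C ε₀ h₀ hC hε₀ hh₀
  obtain ⟨E, hE, hest⟩ := hloc.exists_cutAction_estimate (μ := μ) hk he hct hκ hoff hO hcU hθ hC
  set ν := (μ univ).toReal ^ (1 / 2 : ℝ) with hν
  obtain ⟨C', hC', hfin⟩ := exists_semiclassical_bound (k := k) (n := n) (by linarith) hC hE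
    (by positivity : 0 ≤ ν) hh₀ hε₀ ⌈k + n⌉₊
  refine ⟨C', hC', fun h ε A hh hhh hε hεε hA u hu huA hce => ?_⟩
  have hui : Integrable u μ := hu.integrable (by norm_num)
  obtain ⟨w₀, hw₀⟩ := hθ.exists_chartLift (by positivity) he hO hcU hct hce.1
  obtain ⟨hsm, hbd⟩ := hest u w₀ (A * C) (ε / h) hui hce.1 hw₀ (by positivity) (by positivity)
    -- In dimension 0 there is no line estimate; the bound by AC is the hypothesis for the empty
    -- multi-index.
    (fun j q y hy => norm_iteratedDeriv_le_of_cauchyEstimates hh hO hce j q hy) (by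
      rintro rfl y hy
      simpa [hDerPow, multiLen] using hce.2 0 y hy)
  set v := cutAction μ P κ (e.symm '' openCube c (2 * r)) w₀ u with hv
  have hcont : ContinuousOn v (e.symm '' openCube c r) := by
    rintro _ ⟨y, hy, rfl⟩
    have hyt : y ∈ e.target := hct (hcc hy)
    have h1 : ContinuousAt (v ∘ e.symm) (e (e.symm y)) := by
      rw [e.right_inv hyt]
      exact hsm.continuousOn.continuousAt ((isOpen_openCube c r).mem_nhds hy)
    have h2 : ContinuousAt ((v ∘ e.symm) ∘ e) (e.symm y) :=
      ContinuousAt.comp h1 (e.continuousAt (e.map_target hyt))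
    refine (h2.congr ?_).continuousWithinAt
    filter_upwards [e.open_source.mem_nhds (e.map_target hyt)] with p hp
    simp only [Function.comp_apply, e.left_inv hp]
  refine ⟨v, hloc.equalsOn_cutAction hμ he hct hκ hoff hθ hui hO hcU hce.1 hw₀ hcont, ?_⟩
  rw [heW]
  refine ⟨hsm, fun β x hx => ?_⟩
  refine (norm_hDerPow_le hh.le (isOpen_openCube c r) hx β hsm).trans ?_
  refine le_trans ?_ (hfin h ε A (multiLen β) hh hhh hε hεε hA)
  have hL1 := integral_norm_le_of_eLpNorm_le hu.aestronglyMeasurable hA huA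
  have hh' := hbd (multiLen β) x hx
  gcongr
  refine hh'.trans ?_
  gcongr
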